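/- Work in the two-sorted language of second-order arithmetic, and let $\mathsf{RCA}_0$ be the theory axiomatized by the basic (discretely ordered semiring) axioms for $0,1,+,\cdot,<$, induction for $\Sigma^0_1$-formulas and comprehension for $\Delta^0_1$-formulas, both with arbitrary number and set parameters. A (countable) linear order $X$ is given by a set of pairs of natural numbers. It is called a well order if there is no infinite sequence $x_0>_X x_1>_X\cdots$ in $X$, and a weak well order if no initial segment $I\subseteq X$ admits an embedding (i.e. a strictly order preserving map) $f:I\to I_0$ into a proper initial segment $I_0\subsetneq I$. For a linear order $X$, let $\omega(X)$ be the set of (codes of) finite sequences $\langle x_0,\dots,x_{n-1}\rangle$ with $x_i\in X$ and $x_0\geq_X\dots\geq_X x_{n-1}$, ordered lexicographically: $\sigma\leq_{\omega(X)}\tau$ holds iff either $l(\sigma)\leq l(\tau)$ and $\sigma_i=\tau_i$ for all $i<l(\sigma)$ (where $l$ denotes length), or there is $j<\min\{l(\sigma),l(\tau)\}$ with $\sigma_j<_X\tau_j$ and $\sigma_i=\tau_i$ for all $i<j$. Write $\omega$ for the natural numbers with their usual order and $\omega^\omega=\omega(\omega)$. Then $\mathsf{RCA}_0$ proves that the order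 $\omega^\omega$ exists and is a weak well order, while $\mathsf{RCA}_0$ does not prove that $\omega^\omega$ exists and is a well order. -/

import Mathlib

namespace SOA

/-! ### Two-sorted language of second-order arithmetic

Formulas use de Bruijn indices, with one index space for number variables and a separate one for
set variables. -/

/-- Number terms; `var i` is the `i`-th number variable. -/
inductive Tm : Type
  | var (i : ℕ)
  | zero
  | one
  | add (s t : Tm)
  | mul (s t : Tm)

/-- Formulas. `mem t X` says that the number `t` is in the `X`-th set variable; `allN` quantifies
over numbers and `allS` over sets, both binding the variable with index `0` of their sort. -/
inductive Fm : Type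
  | falsum
  | eq (s t : Tm)
  | lt (s t : Tm)
  | mem (t : Tm) (X : ℕ)
  | imp (φ ψ : Fm)
  | allN (φ : Fm)
  | allS (φ : Fm)

instance : Zero Tm := ⟨Tm.zero⟩
instance : One Tm := ⟨Tm.one⟩
instance : Add Tm := ⟨Tm.add⟩
instance : Mul Tm := ⟨Tm.mul⟩

/-- Simultaneous substitution of terms for number variables. -/
def Tm.subst (σ : ℕ → Tm) : Tm → Tm
  | .var i => σ i
  | .zero => .zero
  | .one => .one
  | .add s t => .add (s.subst σ) (t.subst σ)
  | .mul s t => .mul (s.subst σ) (t.subst σ)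

/-- Shift all number variables by `k` (used to place a term below `k` number quantifiers). -/
def Tm.lift (k : ℕ) (t : Tm) : Tm := t.subst fun i => .var (i + k)

/-- The number substitution `σ`, adapted to the scope of a number quantifier. -/
def upN (σ : ℕ → Tm) : ℕ → Tm
  | 0 => .var 0
  | i + 1 => (σ i).lift 1

/-- The set renaming `ρ`, adapted to the scope of a set quantifier. -/
def upS (ρ : ℕ → ℕ) : ℕ → ℕ
  | 0 => 0
  | i + 1 => ρ i + 1

/-- Simultaneous capture-avoiding substitution of terms for number variables and of set variables
for set variables. -/
def Fm.subst (σ : ℕ → Tm) (ρ : ℕ → ℕ) : Fm → Fm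
  | .falsum => .falsum
  | .eq s t => .eq (s.subst σ) (t.subst σ)
  | .lt s t => .lt (s.subst σ) (t.subst σ)
  | .mem t X => .mem (t.subst σ) (ρ X)
  | .imp φ ψ => .imp (φ.subst σ ρ) (ψ.subst σ ρ)
  | .allN φ => .allN (φ.subst (upN σ) ρ)
  | .allS φ => .allS (φ.subst σ (upS ρ))

/-- Shift all free number variables by one. -/
def Fm.liftN (φ : Fm) : Fm := φ.subst (fun i => .var (i + 1)) id

/-- Shift all free set variables by one. -/
def Fm.liftS (φ : Fm) : Fm := φ.subst .var Nat.succ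

/-- `φ[t/0]`: instantiate number variable `0` by `t` and lower the other number variables. -/
def Fm.instN (φ : Fm) (t : Tm) : Fm :=
  φ.subst (fun | 0 => t | i + 1 => .var i) id

/-- `φ[X/0]`: instantiate set variable `0` by `X` and lower the other set variables. -/
def Fm.instS (φ : Fm) (X : ℕ) : Fm :=
  φ.subst .var (fun | 0 => X | i + 1 => i)

/-- `φ(x + 1)`, where `x` is number variable `0`; all other variables stay as they are. -/
def Fm.instSucc (φ : Fm) : Fm :=
  φ.subst (fun | 0 => .var 0 + 1 | i + 1 => .var (i + 1)) id

/-! Defined connectives and quantifiers -/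

def Fm.neg (φ : Fm) : Fm := .imp φ .falsum
def Fm.and (φ ψ : Fm) : Fm := (φ.imp ψ.neg).neg
def Fm.or (φ ψ : Fm) : Fm := φ.neg.imp ψ
def Fm.iff (φ ψ : Fm) : Fm := (φ.imp ψ).and (ψ.imp φ)
def Fm.exN (φ : Fm) : Fm := φ.neg.allN.neg
def Fm.exS (φ : Fm) : Fm := φ.neg.allS.neg

prefix:max "♯" => Tm.var
infix:60 " ≐ " => Fm.eq
infix:60 " ≺ " => Fm.lt
infix:60 " ∊ " => Fm.mem
prefix:55 "∼ₐ" => Fm.neg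
infixr:50 " ⋏ " => Fm.and
infixr:45 " ⋎ " => Fm.or
infixr:40 " ⟹ₐ " => Fm.imp
infix:35 " ⟺ₐ " => Fm.iff

/-- `s ≤ t` for numbers. -/
def Fm.le (s t : Tm) : Fm := s ≺ t ⋎ s ≐ t

/-! ### Provability: classical natural deduction with equality -/

/-- `Prf T Γ φ`: the formula `φ` is derivable from the finitely many hypotheses `Γ` in the theory
with axioms `T`. Free variables of an axiom in `T` are read as universally quantified (axioms stay
available when a quantifier is introduced); those of `Γ` are fixed. -/
inductive Prf (T : Set Fm) : List Fm → Fm → Prop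
  | ax {Γ φ} : φ ∈ T → Prf T Γ φ
  | hyp {Γ φ} : φ ∈ Γ → Prf T Γ φ
  | impI {Γ φ ψ} : Prf T (φ :: Γ) ψ → Prf T Γ (.imp φ ψ)
  | impE {Γ φ ψ} : Prf T Γ (.imp φ ψ) → Prf T Γ φ → Prf T Γ ψ
  | byContra {Γ φ} : Prf T (φ.neg :: Γ) .falsum → Prf T Γ φ
  | allNI {Γ φ} : Prf T (Γ.map Fm.liftN) φ → Prf T Γ (.allN φ)
  | allNE {Γ φ} (t : Tm) : Prf T Γ (.allN φ) → Prf T Γ (φ.instN t)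
  | allSI {Γ φ} : Prf T (Γ.map Fm.liftS) φ → Prf T Γ (.allS φ)
  | allSE {Γ φ} (X : ℕ) : Prf T Γ (.allS φ) → Prf T Γ (φ.instS X)
  | eqRefl {Γ} (t : Tm) : Prf T Γ (t ≐ t)
  | eqSubst {Γ} (φ : Fm) {s t : Tm} :
      Prf T Γ (s ≐ t) → Prf T Γ (φ.instN s) → Prf T Γ (φ.instN t)

/-- The theory with axioms `T` proves `φ`. -/
def Proves (T : Set Fm) (φ : Fm) : Prop := Prf T [] φ

/-! ### The axiom system `RCA₀` -/

/-- Bounded quantification `∀ x < t, φ x`; the bound `t` does not contain the bound variable. -/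
def Fm.ballN (t : Tm) (φ : Fm) : Fm := .allN (♯0 ≺ t.lift 1 ⟹ₐ φ)

/-- Bounded formulas, possibly with free number and set variables. (A bounded existential
quantifier is `∼ₐ Fm.ballN t (∼ₐ φ)`.) -/
inductive IsBounded : Fm → Prop
  | falsum : IsBounded .falsum
  | eq (s t : Tm) : IsBounded (s ≐ t)
  | lt (s t : Tm) : IsBounded (s ≺ t)
  | mem (t : Tm) (X : ℕ) : IsBounded (t ∊ X)
  | imp {φ ψ : Fm} : IsBounded φ → IsBounded ψ → IsBounded (φ ⟹ₐ ψ)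
  | ballN (t : Tm) {φ : Fm} : IsBounded φ → IsBounded (.ballN t φ)

/-- `Σ⁰₁`-formulas. -/
def IsSigma1 (φ : Fm) : Prop := ∃ θ, IsBounded θ ∧ φ = .exN θ

/-- `Π⁰₁`-formulas. -/
def IsPi1 (φ : Fm) : Prop := ∃ θ, IsBounded θ ∧ φ = .allN θ

/-- Induction for `φ`, along number variable `0`. -/
def induction (φ : Fm) : Fm :=
  (φ.instN 0 ⋏ .allN (φ ⟹ₐ φ.instSucc)) ⟹ₐ .allN φ

/-- Comprehension for `φ` (in number variable `0`), provided that `φ` is equivalent to `ψ`. The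
shift `φ.liftS` ensures that the new set is not a parameter of `φ`. -/
def comprehension (φ ψ : Fm) : Fm :=
  .allN (φ ⟺ₐ ψ) ⟹ₐ .exS (.allN (♯0 ∊ 0 ⟺ₐ φ.liftS))

/-- The axioms of `RCA₀`: the basic axioms on numbers, `Σ⁰₁`-induction and `Δ⁰₁`-comprehension,
the last two with arbitrary number and set parameters. -/
inductive RCA₀ : Fm → Prop
  | succ_ne_zero : RCA₀ (∼ₐ (♯0 + 1 ≐ 0))
  | succ_inj : RCA₀ (♯0 + 1 ≐ ♯1 + 1 ⟹ₐ ♯0 ≐ ♯1)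
  | add_zero : RCA₀ (♯0 + 0 ≐ ♯0)
  | add_succ : RCA₀ (♯0 + (♯1 + 1) ≐ (♯0 + ♯1) + 1)
  | mul_zero : RCA₀ (♯0 * 0 ≐ 0)
  | mul_succ : RCA₀ (♯0 * (♯1 + 1) ≐ ♯0 * ♯1 + ♯0)
  | not_lt_zero : RCA₀ (∼ₐ (♯0 ≺ 0))
  | lt_succ : RCA₀ (♯0 ≺ ♯1 + 1 ⟺ₐ (♯0 ≺ ♯1 ⋎ ♯0 ≐ ♯1))
  | induction {φ : Fm} : IsSigma1 φ → RCA₀ (induction φ)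
  | comprehension {φ ψ : Fm} : IsSigma1 φ → IsPi1 ψ → RCA₀ (comprehension φ ψ)

/-! ### Pairs and finite sequences, inside second-order arithmetic -/

/-- The pairing function `(i, j) ↦ (i + j)² + i`. -/
def pair (s t : Tm) : Tm := (s + t) * (s + t) + s

/-- A number `c = (l, (m, n))` represents the sequence of length `l` with entries
`n mod (m * (i + 1) + 1)` for `i < l`. This formula says that `c` is of this form, with length `l`. -/
def hasLength (c l : Tm) : Fm :=
  .exN (.exN (c.lift 2 ≐ pair (l.lift 2) (pair ♯1 ♯0)))

/-- The sequence represented by `c` has an `i`-th entry, and that entry is `x`. The variables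
`3`, `2`, `1`, `0` are `l`, `m`, `n` and the quotient of the division of `n`. -/
def hasEntry (c i x : Tm) : Fm :=
  .exN (.exN (.exN (.exN (
    c.lift 4 ≐ pair ♯3 (pair ♯2 ♯1) ⋏
    i.lift 4 ≺ ♯3 ⋏
    x.lift 4 ≺ ♯2 * (i.lift 4 + 1) + 1 ⋏
    ♯1 ≐ ♯0 * (♯2 * (i.lift 4 + 1) + 1) + x.lift 4))))

/-- `c` and `d` represent the same sequence. -/
def sameSeq (c d : Tm) : Fm :=
  .allN (hasLength (c.lift 1) ♯0 ⟺ₐ hasLength (d.lift 1) ♯0) ⋏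
  .allN (.allN (hasEntry (c.lift 2) ♯1 ♯0 ⟺ₐ hasEntry (d.lift 2) ♯1 ♯0))

/-- `c` is the code of a finite sequence, i.e. the least number that represents it. -/
def isSeq (c : Tm) : Fm :=
  .exN (hasLength (c.lift 1) ♯0) ⋏
  .allN (♯0 ≺ c.lift 1 ⟹ₐ ∼ₐ sameSeq (c.lift 1) ♯0)

/-! ### Linear orders, inside second-order arithmetic

An order is a set `X` of pairs; `(s, t) ∈ X` means `s ≤ t`, and the underlying set of the order
consists of the numbers `t` with `(t, t) ∈ X`. -/

def inField (X : ℕ) (t : Tm) : Fm := pair t t ∊ X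
def leIn (X : ℕ) (s t : Tm) : Fm := pair s t ∊ X
def ltIn (X : ℕ) (s t : Tm) : Fm := leIn X s t ⋏ ∼ₐ (s ≐ t)

/-- `X` is a linear order. -/
def isLinearOrder (X : ℕ) : Fm :=
  .allN (♯0 ∊ X ⟹ₐ .exN (.exN (♯2 ≐ pair ♯1 ♯0))) ⋏
  .allN (.allN (leIn X ♯1 ♯0 ⟹ₐ inField X ♯1 ⋏ inField X ♯0)) ⋏
  .allN (.allN (.allN (leIn X ♯2 ♯1 ⋏ leIn X ♯1 ♯0 ⟹ₐ leIn X ♯2 ♯0))) ⋏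
  .allN (.allN (leIn X ♯1 ♯0 ⋏ leIn X ♯0 ♯1 ⟹ₐ ♯1 ≐ ♯0)) ⋏
  .allN (.allN (inField X ♯1 ⋏ inField X ♯0 ⟹ₐ leIn X ♯1 ♯0 ⋎ leIn X ♯0 ♯1))

/-- The set `F` is (the graph of) a function with domain `A` and values in `B`, where `A` and `B`
are given by formulas with a number argument. -/
def isFunction (F : ℕ) (A B : Tm → Fm) : Fm :=
  .allN (♯0 ∊ F ⟹ₐ .exN (.exN (♯2 ≐ pair ♯1 ♯0 ⋏ A ♯1 ⋏ B ♯0))) ⋏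
  .allN (A ♯0 ⟹ₐ .exN (pair ♯1 ♯0 ∊ F)) ⋏
  .allN (.allN (.allN (pair ♯2 ♯1 ∊ F ⋏ pair ♯2 ♯0 ∊ F ⟹ₐ ♯1 ≐ ♯0)))

/-- The set `I` is an initial segment of the order `X`. -/
def isInitialSegment (X I : ℕ) : Fm :=
  .allN (♯0 ∊ I ⟹ₐ inField X ♯0) ⋏
  .allN (.allN (♯0 ∊ I ⋏ ltIn X ♯1 ♯0 ⟹ₐ ♯1 ∊ I))

/-- `J` is a proper subset of `I`. -/
def isProperSubset (J I : ℕ) : Fm :=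
  .allN (♯0 ∊ J ⟹ₐ ♯0 ∊ I) ⋏ .exN (♯0 ∊ I ⋏ ∼ₐ (♯0 ∊ J))

/-- `F` is an embedding, i.e. an order preserving map, from `I` to `J`, both with the order of
`X`. -/
def isEmbedding (X F I J : ℕ) : Fm :=
  isFunction F (fun t => t ∊ I) (fun t => t ∊ J) ⋏
  .allN (.allN (.allN (.allN (
    pair ♯3 ♯2 ∊ F ⋏ pair ♯1 ♯0 ∊ F ⋏ ltIn X ♯3 ♯1 ⟹ₐ ltIn X ♯2 ♯0))))

/-- `X` is a weak well order: a linear order such that no initial segment `I` of `X` embeds into an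
initial segment `J ⊊ I`. The set variables `2`, `1`, `0` are `I`, `J` and the embedding. -/
def isWeakWellOrder (X : ℕ) : Fm :=
  isLinearOrder X ⋏
  ∼ₐ (.exS (.exS (.exS (
    isInitialSegment (X + 3) 2 ⋏ isInitialSegment (X + 3) 1 ⋏ isProperSubset 1 2 ⋏
    isEmbedding (X + 3) 0 2 1))))

/-- `X` is a well order: a linear order without infinite descending sequences. -/
def isWellOrder (X : ℕ) : Fm :=
  isLinearOrder X ⋏
  ∼ₐ (.exS (
    isFunction 0 (fun t => t ≐ t) (inField (X + 1)) ⋏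
    .allN (.allN (.allN (
      pair ♯2 ♯1 ∊ 0 ⋏ pair (♯2 + 1) ♯0 ∊ 0 ⟹ₐ ltIn (X + 1) ♯0 ♯1)))))

/-! ### The orders `ω` and `ω(X)`, inside second-order arithmetic -/

/-- `X` is the order `ω`, i.e. the natural numbers with their usual order. -/
def isOmega (X : ℕ) : Fm :=
  .allN (♯0 ∊ X ⟺ₐ .exN (.exN (♯2 ≐ pair ♯1 ♯0 ⋏ .le ♯1 ♯0)))

/-- `c` is (the code of) a sequence `⟨x₀, …, xₙ₋₁⟩` with entries in `X` and `x₀ ≥ … ≥ xₙ₋₁`. -/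
def inOmegaPow (X : ℕ) (c : Tm) : Fm :=
  isSeq c ⋏
  .allN (.allN (hasEntry (c.lift 2) ♯1 ♯0 ⟹ₐ inField X ♯0)) ⋏
  .allN (.allN (.allN (
    hasEntry (c.lift 3) ♯2 ♯1 ⋏ hasEntry (c.lift 3) (♯2 + 1) ♯0 ⟹ₐ leIn X ♯0 ♯1)))

/-- Lexicographic comparison `c ≤ d`: either `l(c) ≤ l(d)` and `cᵢ = dᵢ` for all `i < l(c)`, or
there is a `j < min {l(c), l(d)}` with `cⱼ < dⱼ` in `X` and `cᵢ = dᵢ` for all `i < j`. -/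
def lexLe (X : ℕ) (c d : Tm) : Fm :=
  (.exN (.exN (hasLength (c.lift 2) ♯1 ⋏ hasLength (d.lift 2) ♯0 ⋏ .le ♯1 ♯0)) ⋏
    .allN (.allN (hasEntry (c.lift 2) ♯1 ♯0 ⟹ₐ hasEntry (d.lift 2) ♯1 ♯0))) ⋎
  .exN (.exN (.exN (
    hasEntry (c.lift 3) ♯2 ♯1 ⋏ hasEntry (d.lift 3) ♯2 ♯0 ⋏ ltIn X ♯1 ♯0 ⋏
    .allN (.allN (♯1 ≺ ♯4 ⟹ₐ
      (hasEntry (c.lift 5) ♯1 ♯0 ⟺ₐ hasEntry (d.lift 5) ♯1 ♯0))))))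

/-- `Y` is the order `ω(X)` of non-increasing finite sequences in `X`, compared
lexicographically. -/
def isOmegaPow (X Y : ℕ) : Fm :=
  .allN (♯0 ∊ Y ⟺ₐ .exN (.exN (
    ♯2 ≐ pair ♯1 ♯0 ⋏ inOmegaPow X ♯1 ⋏ inOmegaPow X ♯0 ⋏ lexLe X ♯1 ♯0)))

/-- The sentence "`ω(ω)` exists and has property `P`", where `P` is a formula about the order given
by a set variable. The set variables `1` and `0` are `ω` and `ω(ω)`. -/
def omegaOmegaSatisfies (P : ℕ → Fm) : Fm :=
  .exS (.exS (isOmega 1 ⋏ isOmegaPow 1 0 ⋏ P 0))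

end SOA

/-!
Let `f` be an embedding of an initial segment `I` of `ω ^ ω` into a proper initial segment of `I`.
Then `f` sends some sequence downwards, but not the empty one. Along the prefixes of that sequence
there is a first place at which this happens: `f p ≥ p` and `f (p * ⟨e⟩) < p * ⟨e⟩`. Comparison
with `p * ⟨e - 1, …, e - 1⟩` for sufficiently many entries `e - 1` gives another such place with
last entry `e - 1`. That such a place exists is a `Σ⁰₁` statement about `e`, so `RCA₀` proves by
induction that `e` reaches `0`, which is impossible. Since the proof calculus is complete, this
argument may be carried out in an arbitrary model.

On the other hand, in `ω ^ ω` there is a primitive recursive descending sequence that starts with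
`⟨k⟩` and lasts for `ack k k` steps, up to a summand `k`. In an ultrapower of the natural numbers
let `k` be infinite. A cut that contains `k` but not `ack k k` may be closed under all primitive
recursive functions. By the pigeonhole principle it can be chosen such that, among the least
witnesses for a bounded formula with parameters below an element of the cut, those in the cut are
bounded in it and the others have a lower bound outside of it. Then it satisfies `Σ⁰₁` induction.
With its `Δ⁰₁` definable sets it is a model of `RCA₀`, in which the sequence does not end.
-/

namespace SOA

/-! ### Semantics -/

/-- The sequence `x, v 0, v 1, …`: the assignment `v` in the scope of a quantifier whose variable,
of index `0`, has the value `x`. -/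
def scons {α : Type*} (x : α) (v : ℕ → α) : ℕ → α
  | 0 => x
  | i + 1 => v i

section scons

variable {α β : Type*}

@[simp] theorem scons_zero (x : α) (v : ℕ → α) : scons x v 0 = x := rfl
@[simp] theorem scons_succ (x : α) (v : ℕ → α) (i : ℕ) : scons x v (i + 1) = v i := rfl
@[simp] theorem scons_one (x : α) (v : ℕ → α) : scons x v 1 = v 0 := rfl
@[simp] theorem scons_two (x : α) (v : ℕ → α) : scons x v 2 = v 1 := rfl
@[simp] theorem scons_three (x : α) (v : ℕ → α) : scons x v 3 = v 2 := rfl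
@[simp] theorem scons_four (x : α) (v : ℕ → α) : scons x v 4 = v 3 := rfl

theorem comp_scons (f : α → β) (x : α) (v : ℕ → α) : f ∘ scons x v = scons (f x) (f ∘ v) := by
  funext i; cases i <;> rfl

end scons

/-- A strict upper bound for the indices of the variables in a term. -/
def Tm.bound : Tm → ℕ
  | .var i => i + 1
  | .zero => 0
  | .one => 0
  | .add s t => max s.bound t.bound
  | .mul s t => max s.bound t.bound

/-- A strict upper bound for the indices of the number variables in a formula. -/
def Fm.boundN : Fm → ℕ
  | .falsum => 0
  | .eq s t => max s.bound t.bound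
  | .lt s t => max s.bound t.bound
  | .mem t _ => t.bound
  | .imp φ ψ => max φ.boundN ψ.boundN
  | .allN φ => φ.boundN
  | .allS φ => φ.boundN

/-- A strict upper bound for the indices of the set variables in a formula. -/
def Fm.boundS : Fm → ℕ
  | .falsum => 0
  | .eq _ _ => 0
  | .lt _ _ => 0
  | .mem _ X => X + 1
  | .imp φ ψ => max φ.boundS ψ.boundS
  | .allN φ => φ.boundS
  | .allS φ => φ.boundS

section Terms

variable {N : Type*} [Zero N] [One N] [Add N] [Mul N]

/-- The value of a term under the assignment `v`. -/
def Tm.val (v : ℕ → N) : Tm → N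
  | .var i => v i
  | .zero => 0
  | .one => 1
  | .add s t => s.val v + t.val v
  | .mul s t => s.val v * t.val v

@[simp] theorem Tm.val_var (v : ℕ → N) (i : ℕ) : (♯i).val v = v i := rfl
@[simp] theorem Tm.val_zero (v : ℕ → N) : (0 : Tm).val v = 0 := rfl
@[simp] theorem Tm.val_one (v : ℕ → N) : (1 : Tm).val v = 1 := rfl
@[simp] theorem Tm.val_add (v : ℕ → N) (s t : Tm) : (s + t).val v = s.val v + t.val v := rfl
@[simp] theorem Tm.val_mul (v : ℕ → N) (s t : Tm) : (s * t).val v = s.val v * t.val v := rfl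

theorem Tm.val_subst (t : Tm) (σ : ℕ → Tm) (v : ℕ → N) :
    (t.subst σ).val v = t.val fun i => (σ i).val v := by
  induction t <;> simp_all [Tm.subst, Tm.val]

@[simp] theorem Tm.val_lift (t : Tm) (k : ℕ) (v : ℕ → N) :
    (t.lift k).val v = t.val fun i => v (i + k) := t.val_subst _ _

theorem Tm.val_congr (t : Tm) {v w : ℕ → N} (h : ∀ i < t.bound, v i = w i) :
    t.val v = t.val w := by
  induction t with
  | var i => exact h i (Nat.lt_succ_self i)
  | zero => rfl
  | one => rfl
  | add s t hs ht | mul s t hs ht =>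
    simp only [Tm.bound, lt_max_iff] at h
    simp only [Tm.val, hs fun i hi => h i (.inl hi), ht fun i hi => h i (.inr hi)]

theorem val_upN (σ : ℕ → Tm) (x : N) (v : ℕ → N) :
    (fun i => (upN σ i).val (scons x v)) = scons x fun i => (σ i).val v := by
  funext i; cases i <;> simp [upN]

end Terms

section Formulas

variable {N S : Type*} [Zero N] [One N] [Add N] [Mul N] [LT N] [Membership N S]

/-- Satisfaction in the structure with numbers `N` and sets `S`, under assignments to both sorts of
variables. -/
def Fm.Sat : Fm → (ℕ → N) → (ℕ → S) → Prop
  | .falsum, _, _ => False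
  | .eq s t, v, _ => s.val v = t.val v
  | .lt s t, v, _ => s.val v < t.val v
  | .mem t X, v, s => t.val v ∈ s X
  | .imp φ ψ, v, s => φ.Sat v s → ψ.Sat v s
  | .allN φ, v, s => ∀ x, φ.Sat (scons x v) s
  | .allS φ, v, s => ∀ X, φ.Sat v (scons X s)

section Sat

variable (v : ℕ → N) (s : ℕ → S) (φ ψ : Fm) (a b : Tm)

@[simp] theorem sat_falsum : Fm.falsum.Sat v s ↔ False := Iff.rfl
@[simp] theorem sat_eq : (a ≐ b).Sat v s ↔ a.val v = b.val v := Iff.rfl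
@[simp] theorem sat_lt : (a ≺ b).Sat v s ↔ a.val v < b.val v := Iff.rfl
@[simp] theorem sat_mem (X : ℕ) : (a ∊ X).Sat v s ↔ a.val v ∈ s X := Iff.rfl
@[simp] theorem sat_imp : (φ ⟹ₐ ψ).Sat v s ↔ (φ.Sat v s → ψ.Sat v s) := Iff.rfl
@[simp] theorem sat_allN : φ.allN.Sat v s ↔ ∀ x, φ.Sat (scons x v) s := Iff.rfl
@[simp] theorem sat_allS : φ.allS.Sat v s ↔ ∀ X, φ.Sat v (scons X s) := Iff.rfl
@[simp] theorem sat_neg : φ.neg.Sat v s ↔ ¬ φ.Sat v s := Iff.rfl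

@[simp] theorem sat_and : (φ ⋏ ψ).Sat v s ↔ φ.Sat v s ∧ ψ.Sat v s := by
  simp only [Fm.and, sat_neg, sat_imp, Classical.not_imp, not_not]

@[simp] theorem sat_or : (φ ⋎ ψ).Sat v s ↔ φ.Sat v s ∨ ψ.Sat v s := by
  simp only [Fm.or, sat_imp, sat_neg, or_iff_not_imp_left]

@[simp] theorem sat_iff : (φ ⟺ₐ ψ).Sat v s ↔ (φ.Sat v s ↔ ψ.Sat v s) := by
  simp only [Fm.iff, sat_and, sat_imp, iff_iff_implies_and_implies]

@[simp] theorem sat_exN : φ.exN.Sat v s ↔ ∃ x, φ.Sat (scons x v) s := by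
  simp only [Fm.exN, sat_neg, sat_allN, not_forall, not_not]

@[simp] theorem sat_exS : φ.exS.Sat v s ↔ ∃ X, φ.Sat v (scons X s) := by
  simp only [Fm.exS, sat_neg, sat_allS, not_forall, not_not]

@[simp] theorem sat_ballN :
    (Fm.ballN a φ).Sat v s ↔ ∀ x, x < a.val v → φ.Sat (scons x v) s := by
  simp only [Fm.ballN, sat_allN, sat_imp, sat_lt, Tm.val_var, scons_zero, Tm.val_lift, scons_succ]

end Sat

theorem scons_upS {α : Type*} (ρ : ℕ → ℕ) (x : α) (s : ℕ → α) :
    (fun i => scons x s (upS ρ i)) = scons x fun i => s (ρ i) := by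
  funext i; cases i <;> rfl

theorem Fm.sat_subst (φ : Fm) (σ : ℕ → Tm) (ρ : ℕ → ℕ) (v : ℕ → N) (s : ℕ → S) :
    (φ.subst σ ρ).Sat v s ↔ φ.Sat (fun i => (σ i).val v) (fun i => s (ρ i)) := by
  induction φ generalizing σ ρ v s with
  | falsum => rfl
  | eq | lt | mem => simp only [Fm.subst, Fm.Sat, Tm.val_subst]
  | imp φ ψ h₁ h₂ => simp only [Fm.subst, Fm.Sat, h₁, h₂]
  | allN φ ih => simp only [Fm.subst, Fm.Sat, ih, val_upN]
  | allS φ ih => simp only [Fm.subst, Fm.Sat, ih, scons_upS]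

theorem Fm.sat_liftN (φ : Fm) (x : N) (v : ℕ → N) (s : ℕ → S) :
    φ.liftN.Sat (scons x v) s ↔ φ.Sat v s := φ.sat_subst _ _ _ _

theorem Fm.sat_liftS (φ : Fm) (X : S) (v : ℕ → N) (s : ℕ → S) :
    φ.liftS.Sat v (scons X s) ↔ φ.Sat v s := φ.sat_subst _ _ _ _

theorem Fm.instN_eq (φ : Fm) (t : Tm) : φ.instN t = φ.subst (scons t .var) id := by
  unfold Fm.instN; congr 1

theorem Fm.instS_eq (φ : Fm) (X : ℕ) : φ.instS X = φ.subst .var (scons X id) := by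
  unfold Fm.instS; congr 1

theorem Fm.sat_instN (φ : Fm) (t : Tm) (v : ℕ → N) (s : ℕ → S) :
    (φ.instN t).Sat v s ↔ φ.Sat (scons (t.val v) v) s := by
  rw [Fm.instN_eq, Fm.sat_subst]
  exact iff_of_eq (congrArg (φ.Sat · s) (comp_scons (Tm.val v) t .var))

theorem Fm.sat_instS (φ : Fm) (X : ℕ) (v : ℕ → N) (s : ℕ → S) :
    (φ.instS X).Sat v s ↔ φ.Sat v (scons (s X) s) := by
  rw [Fm.instS_eq, Fm.sat_subst]
  exact iff_of_eq (congrArg (φ.Sat v) (comp_scons s X id))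

theorem Fm.sat_instSucc (φ : Fm) (x : N) (v : ℕ → N) (s : ℕ → S) :
    φ.instSucc.Sat (scons x v) s ↔ φ.Sat (scons (x + 1) v) s := by
  rw [Fm.instSucc, Fm.sat_subst]
  refine iff_of_eq (congrArg₂ _ ?_ rfl)
  funext i; cases i <;> rfl

theorem Fm.sat_congr (φ : Fm) {v w : ℕ → N} {s r : ℕ → S} (hN : ∀ i < φ.boundN, v i = w i)
    (hS : ∀ i < φ.boundS, s i = r i) : φ.Sat v s ↔ φ.Sat w r := by
  induction φ generalizing v w s r with
  | falsum => rfl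
  | eq a b | lt a b =>
    simp only [Fm.boundN, lt_max_iff] at hN
    simp only [Fm.Sat, a.val_congr fun i hi => hN i (.inl hi),
      b.val_congr fun i hi => hN i (.inr hi)]
  | mem a X => simp only [Fm.Sat, a.val_congr hN, hS X (Nat.lt_succ_self X)]
  | imp φ ψ h₁ h₂ =>
    simp only [Fm.boundN, Fm.boundS, lt_max_iff] at hN hS
    simp only [Fm.Sat, h₁ (fun i hi => hN i (.inl hi)) (fun i hi => hS i (.inl hi)),
      h₂ (fun i hi => hN i (.inr hi)) (fun i hi => hS i (.inr hi))]
  | allN φ ih =>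
    refine forall_congr' fun x => ih (fun i hi => ?_) hS
    cases i with
    | zero => rfl
    | succ i => exact hN i ((Nat.lt_succ_self i).trans hi)
  | allS φ ih =>
    refine forall_congr' fun x => ih hN (fun i hi => ?_)
    cases i with
    | zero => rfl
    | succ i => exact hS i ((Nat.lt_succ_self i).trans hi)

variable (N S) in
/-- The structure with numbers `N` and sets `S` is a model of the theory `T`, whose axioms are read
as universally quantified. -/
def Models (T : Set Fm) : Prop := ∀ φ ∈ T, ∀ (v : ℕ → N) (s : ℕ → S), φ.Sat v s

theorem Prf.sound {T : Set Fm} {Γ : List Fm} {φ : Fm} (h : Prf T Γ φ) (hT : Models N S T)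
    (v : ℕ → N) (s : ℕ → S) (hΓ : ∀ ψ ∈ Γ, ψ.Sat v s) : φ.Sat v s := by
  induction h generalizing v s with
  | ax h => exact hT _ h v s
  | hyp h => exact hΓ _ h
  | impI _ ih => exact fun hφ => ih v s (List.forall_mem_cons.2 ⟨hφ, hΓ⟩)
  | impE _ _ ih₁ ih₂ => exact ih₁ v s hΓ (ih₂ v s hΓ)
  | byContra _ ih => exact by_contra fun hφ => ih v s (List.forall_mem_cons.2 ⟨hφ, hΓ⟩)
  | allNI _ ih =>
    exact fun x => ih _ s (List.forall_mem_map.2 fun ψ hψ => (ψ.sat_liftN x v s).2 (hΓ ψ hψ))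
  | allNE t _ ih => exact (Fm.sat_instN _ _ _ _).2 (ih v s hΓ _)
  | allSI _ ih =>
    exact fun X => ih v _ (List.forall_mem_map.2 fun ψ hψ => (ψ.sat_liftS X v s).2 (hΓ ψ hψ))
  | allSE X _ ih => exact (Fm.sat_instS _ _ _ _).2 (ih v s hΓ _)
  | eqRefl t => rfl
  | eqSubst φ _ _ ih₁ ih₂ =>
    have hst := ih₁ v s hΓ
    have hφ := ih₂ v s hΓ
    rw [sat_eq] at hst
    rw [Fm.sat_instN] at hφ ⊢
    rwa [← hst]

end Formulas

/-! ### Substitution -/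

theorem Tm.subst_eq_val (t : Tm) (σ : ℕ → Tm) : t.subst σ = t.val σ := by
  induction t with
  | add s t hs ht | mul s t hs ht => rw [Tm.subst, hs, ht]; rfl
  | _ => rfl

theorem Tm.subst_subst (t : Tm) (σ τ : ℕ → Tm) :
    (t.subst σ).subst τ = t.subst fun i => (σ i).subst τ := by
  rw [Tm.subst_eq_val _ τ, Tm.val_subst, Tm.subst_eq_val t]
  simp only [Tm.subst_eq_val]

theorem Tm.subst_congr (t : Tm) {σ τ : ℕ → Tm} (h : ∀ i < t.bound, σ i = τ i) :
    t.subst σ = t.subst τ := by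
  simpa only [Tm.subst_eq_val] using t.val_congr h

theorem Tm.subst_var (t : Tm) : t.subst .var = t := by
  induction t <;> simp_all [Tm.subst]

theorem Tm.lift_one_subst_scons (t u : Tm) (σ : ℕ → Tm) :
    (t.lift 1).subst (scons u σ) = t.subst σ := t.subst_subst _ _

theorem upN_comp (σ τ : ℕ → Tm) :
    (fun i => (upN σ i).subst (upN τ)) = upN fun i => (σ i).subst τ := by
  funext i
  cases i with
  | zero => rfl
  | succ i => simp only [upN, Tm.lift, Tm.subst_subst, Tm.subst]

theorem upN_var : upN .var = .var := by
  funext i; cases i <;> rfl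

theorem upS_comp (ρ π : ℕ → ℕ) : upS π ∘ upS ρ = upS (π ∘ ρ) := by
  funext i; cases i <;> rfl

theorem upS_id : upS id = id := by
  funext i; cases i <;> rfl

namespace Fm

variable (φ : Fm) (σ : ℕ → Tm) (ρ : ℕ → ℕ)

theorem subst_subst (τ : ℕ → Tm) (π : ℕ → ℕ) :
    (φ.subst σ ρ).subst τ π = φ.subst (fun i => (σ i).subst τ) (π ∘ ρ) := by
  induction φ generalizing σ τ ρ π with
  | falsum => rfl
  | eq | lt | mem => simp only [Fm.subst, Tm.subst_subst, Function.comp_apply]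
  | imp φ ψ h₁ h₂ => simp only [Fm.subst, h₁, h₂]
  | allN φ ih => simp only [Fm.subst, ih, upN_comp]
  | allS φ ih => simp only [Fm.subst, ih, upS_comp]

theorem subst_id : φ.subst .var id = φ := by
  induction φ <;> simp_all [Fm.subst, Tm.subst_var, upN_var, upS_id]

theorem subst_congr {φ : Fm} {σ τ : ℕ → Tm} {ρ π : ℕ → ℕ} (hN : ∀ i < φ.boundN, σ i = τ i)
    (hS : ∀ i < φ.boundS, ρ i = π i) : φ.subst σ ρ = φ.subst τ π := by
  induction φ generalizing σ τ ρ π with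
  | falsum => rfl
  | eq a b | lt a b =>
    simp only [boundN, lt_max_iff] at hN
    simp only [Fm.subst, a.subst_congr fun i hi => hN i (.inl hi),
      b.subst_congr fun i hi => hN i (.inr hi)]
  | mem a X => simp only [Fm.subst, a.subst_congr hN, hS X (Nat.lt_succ_self X)]
  | imp φ ψ h₁ h₂ =>
    simp only [boundN, boundS, lt_max_iff] at hN hS
    simp only [Fm.subst, h₁ (fun i hi => hN i (.inl hi)) (fun i hi => hS i (.inl hi)),
      h₂ (fun i hi => hN i (.inr hi)) (fun i hi => hS i (.inr hi))]
  | allN φ ih =>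
    refine congrArg allN (ih (fun i hi => ?_) hS)
    cases i with
    | zero => rfl
    | succ i => simp only [upN, hN i ((Nat.lt_succ_self i).trans hi)]
  | allS φ ih =>
    refine congrArg allS (ih hN (fun i hi => ?_))
    cases i with
    | zero => rfl
    | succ i => simp only [upS, hS i ((Nat.lt_succ_self i).trans hi)]

theorem liftN_subst_upN : φ.liftN.subst (upN σ) ρ = (φ.subst σ ρ).liftN := by
  simp only [liftN, subst_subst]; rfl

theorem liftS_subst_upS : φ.liftS.subst σ (upS ρ) = (φ.subst σ ρ).liftS := by
  simp only [liftS, subst_subst, Tm.subst_var]; rfl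

theorem subst_upN_instN (t : Tm) : (φ.subst (upN σ) ρ).instN t = φ.subst (scons t σ) ρ := by
  rw [instN_eq, subst_subst]
  congr 1
  funext i
  cases i with
  | zero => rfl
  | succ i => simp only [upN, Tm.lift_one_subst_scons, Tm.subst_var, scons_succ]

theorem subst_upS_instS (X : ℕ) : (φ.subst σ (upS ρ)).instS X = φ.subst σ (scons X ρ) := by
  rw [instS_eq, subst_subst]
  simp only [Tm.subst_var]
  congr 1
  funext i
  cases i <;> rfl

theorem instN_subst (t : Tm) :
    (φ.instN t).subst σ ρ = (φ.subst (upN σ) ρ).instN (t.subst σ) := by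
  rw [subst_upN_instN, instN_eq, subst_subst]
  exact congrArg (φ.subst · ρ) (comp_scons (Tm.subst σ) t .var)

theorem instS_subst (X : ℕ) : (φ.instS X).subst σ ρ = (φ.subst σ (upS ρ)).instS (ρ X) := by
  rw [subst_upS_instS, instS_eq, subst_subst]
  exact congrArg (φ.subst σ) (comp_scons ρ X id)

end Fm

/-! ### Completeness of the deduction system -/

namespace Prf

variable {T : Set Fm} {Γ : List Fm} {φ : Fm}

theorem weaken {Δ : List Fm} (h : Prf T Γ φ) (hΓ : Γ ⊆ Δ) : Prf T Δ φ := by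
  induction h generalizing Δ with
  | ax h => exact .ax h
  | hyp h => exact .hyp (hΓ h)
  | impI _ ih => exact .impI (ih (List.cons_subset_cons _ hΓ))
  | impE _ _ ih₁ ih₂ => exact .impE (ih₁ hΓ) (ih₂ hΓ)
  | byContra _ ih => exact .byContra (ih (List.cons_subset_cons _ hΓ))
  | allNI _ ih => exact .allNI (ih (List.map_subset _ hΓ))
  | allNE t _ ih => exact .allNE t (ih hΓ)
  | allSI _ ih => exact .allSI (ih (List.map_subset _ hΓ))
  | allSE X _ ih => exact .allSE X (ih hΓ)
  | eqRefl t => exact .eqRefl t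
  | eqSubst φ _ _ ih₁ ih₂ => exact .eqSubst φ (ih₁ hΓ) (ih₂ hΓ)

theorem weaken_cons (ψ : Fm) (h : Prf T Γ φ) : Prf T (ψ :: Γ) φ :=
  h.weaken (List.subset_cons_self _ _)

theorem hyp_cons : Prf T (φ :: Γ) φ := .hyp List.mem_cons_self

theorem exfalso (h : Prf T Γ .falsum) : Prf T Γ φ := .byContra (h.weaken_cons _)

/- Only one variable can be instantiated at a time, and instantiation shifts the others; hence the
shift `i ↦ i - n` of the variables that are yet to be instantiated. -/
theorem subst_number_lt (h : ∀ Γ, Prf T Γ φ) (n : ℕ) (σ : ℕ → Tm) (Γ : List Fm) :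
    Prf T Γ (φ.subst (fun i => if i < n then σ i else ♯(i - n)) id) := by
  induction n generalizing σ Γ with
  | zero => simpa [Fm.subst_id] using h Γ
  | succ n ih =>
    have := Prf.allNE (σ n) (Prf.allNI (ih (fun i => (σ i).lift 1) (Γ.map Fm.liftN)))
    rw [Fm.instN_eq, Fm.subst_subst, Function.id_comp] at this
    convert this using 2
    funext i
    rcases lt_trichotomy i n with hi | rfl | hi
    · simp only [hi, hi.trans (Nat.lt_succ_self n), if_true, Tm.lift_one_subst_scons, Tm.subst_var]
    · simp [Tm.subst]
    · obtain ⟨j, rfl⟩ := Nat.exists_eq_add_of_lt hi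
      simp [Tm.subst, show ¬ n + j + 1 < n by omega, show n + j + 1 - n = j + 1 by omega]

theorem subst_set_lt (h : ∀ Γ, Prf T Γ φ) (n : ℕ) (ρ : ℕ → ℕ) (Γ : List Fm) :
    Prf T Γ (φ.subst .var (fun i => if i < n then ρ i else i - n)) := by
  induction n generalizing ρ Γ with
  | zero => simpa [Fm.subst_id, ← Function.id_def] using h Γ
  | succ n ih =>
    have := Prf.allSE (ρ n) (Prf.allSI (ih (fun i => ρ i + 1) (Γ.map Fm.liftS)))
    rw [Fm.instS_eq, Fm.subst_subst] at this
    simp only [Tm.subst_var] at this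
    convert this using 2
    funext i
    rcases lt_trichotomy i n with hi | rfl | hi
    · simp [hi, hi.trans (Nat.lt_succ_self n)]
    · simp
    · obtain ⟨j, rfl⟩ := Nat.exists_eq_add_of_lt hi
      simp [show ¬ n + j + 1 < n by omega, show n + j + 1 - n = j + 1 by omega]

theorem ax_subst (h : φ ∈ T) (σ : ℕ → Tm) (ρ : ℕ → ℕ) (Γ : List Fm) :
    Prf T Γ (φ.subst σ ρ) := by
  have hS := subst_set_lt (fun Γ => Prf.ax (Γ := Γ) h) φ.boundS ρ
  have hN := subst_number_lt hS φ.boundN σ Γ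
  rw [Fm.subst_subst] at hN
  rwa [Fm.subst_congr (τ := σ) (π := ρ)] at hN
  · exact fun i hi => if_pos hi
  · exact fun i hi => if_pos hi

theorem subst (h : Prf T Γ φ) (σ : ℕ → Tm) (ρ : ℕ → ℕ) :
    Prf T (Γ.map (Fm.subst σ ρ)) (φ.subst σ ρ) := by
  induction h generalizing σ ρ with
  | ax h => exact Prf.ax_subst h σ ρ _
  | hyp h => exact .hyp (List.mem_map_of_mem h)
  | impI _ ih => exact .impI (ih σ ρ)
  | impE _ _ ih₁ ih₂ => exact .impE (ih₁ σ ρ) (ih₂ σ ρ)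
  | byContra _ ih => exact .byContra (ih σ ρ)
  | allNI _ ih =>
    refine .allNI ?_
    simpa [Function.comp_def, Fm.liftN_subst_upN] using ih (upN σ) ρ
  | allNE t _ ih =>
    rw [Fm.instN_subst]
    exact .allNE _ (ih σ ρ)
  | allSI _ ih =>
    refine .allSI ?_
    simpa [Function.comp_def, Fm.liftS_subst_upS] using ih σ (upS ρ)
  | allSE X _ ih =>
    rw [Fm.instS_subst]
    exact .allSE _ (ih σ ρ)
  | eqRefl t => exact .eqRefl _
  | eqSubst φ _ _ ih₁ ih₂ =>
    rw [Fm.instN_subst]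
    refine .eqSubst _ (ih₁ σ ρ) ?_
    rw [← Fm.instN_subst]
    exact ih₂ σ ρ

theorem generalizeN {k : ℕ} (hΓ : ∀ ψ ∈ Γ, ψ.boundN ≤ k) (hφ : φ.boundN ≤ k)
    (h : Prf T Γ (φ.instN ♯k)) : Prf T Γ φ.allN := by
  have hsubst := h.subst (fun i => if i = k then ♯0 else ♯(i + 1)) id
  rw [Fm.instN_eq, Fm.subst_subst, Function.id_comp,
    Fm.subst_congr (τ := .var) (π := id) ?_ fun _ _ => rfl, Fm.subst_id] at hsubst
  · refine .allNI ?_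
    convert hsubst using 1
    refine List.map_congr_left fun ψ hψ => Fm.subst_congr (fun i hi => ?_) (fun _ _ => rfl)
    rw [if_neg (hi.trans_le (hΓ ψ hψ)).ne]
  · intro i hi
    cases i with
    | zero => simp [Tm.subst]
    | succ i => simp [Tm.subst, show i ≠ k by omega]

theorem generalizeS {k : ℕ} (hΓ : ∀ ψ ∈ Γ, ψ.boundS ≤ k) (hφ : φ.boundS ≤ k)
    (h : Prf T Γ (φ.instS k)) : Prf T Γ φ.allS := by
  have hsubst := h.subst .var (fun i => if i = k then 0 else i + 1)
  rw [Fm.instS_eq, Fm.subst_subst] at hsubst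
  simp only [Tm.subst_var] at hsubst
  rw [Fm.subst_congr (τ := .var) (π := id) (fun _ _ => rfl) ?_,
    Fm.subst_id] at hsubst
  · refine .allSI ?_
    convert hsubst using 1
    refine List.map_congr_left fun ψ hψ => Fm.subst_congr (fun _ _ => rfl) (fun i hi => ?_)
    rw [if_neg (hi.trans_le (hΓ ψ hψ)).ne]
  · intro i hi
    cases i with
    | zero => simp
    | succ i => simp [show i ≠ k by omega]

end Prf

section Countable

/-- A numerical code of a term, witnessing that there are only countably many. -/
def Tm.code : Tm → ℕ
  | .var i => Nat.pair 0 i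
  | .zero => Nat.pair 1 0
  | .one => Nat.pair 2 0
  | .add s t => Nat.pair 3 (Nat.pair s.code t.code)
  | .mul s t => Nat.pair 4 (Nat.pair s.code t.code)

theorem Tm.code_injective : Function.Injective Tm.code := fun s t h => by
  induction s generalizing t <;> cases t <;> grind [Tm.code, Nat.pair_eq_pair]

/-- A numerical code of a formula, witnessing that there are only countably many. -/
def Fm.code : Fm → ℕ
  | .falsum => Nat.pair 0 0
  | .eq s t => Nat.pair 1 (Nat.pair s.code t.code)
  | .lt s t => Nat.pair 2 (Nat.pair s.code t.code)
  | .mem t X => Nat.pair 3 (Nat.pair t.code X)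
  | .imp φ ψ => Nat.pair 4 (Nat.pair φ.code ψ.code)
  | .allN φ => Nat.pair 5 φ.code
  | .allS φ => Nat.pair 6 φ.code

theorem Fm.code_injective : Function.Injective Fm.code := fun φ ψ h => by
  induction φ generalizing ψ <;> cases ψ <;>
    grind [Fm.code, Nat.pair_eq_pair, Tm.code_injective.eq_iff]

instance : Countable Fm := Fm.code_injective.countable

instance : Nonempty Fm := ⟨.falsum⟩

end Countable

section Henkin

variable {T : Set Fm}

/-- The hypotheses `Γ` decide `φ`, with a counterexample if `φ` is a refuted universal formula. -/
def Decides (T : Set Fm) (Γ : List Fm) (φ : Fm) : Prop :=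
  Prf T Γ φ ∨ (Prf T Γ φ.neg ∧ (∀ θ, φ = .allN θ → ∃ t, Prf T Γ (θ.instN t).neg) ∧
    ∀ θ, φ = .allS θ → ∃ X, Prf T Γ (θ.instS X).neg)

theorem exists_forall_mem_le {α : Type*} (f : α → ℕ) (l : List α) : ∃ k, ∀ a ∈ l, f a ≤ k := by
  obtain ⟨k, hk⟩ := (l.finite_toSet.image f).bddAbove
  exact ⟨k, fun a ha => hk ⟨a, ha, rfl⟩⟩

theorem exists_decides {Γ : List Fm} (hΓ : ¬ Prf T Γ .falsum) (φ : Fm) :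
    ∃ Δ, Γ ⊆ Δ ∧ ¬ Prf T Δ .falsum ∧ Decides T Δ φ := by
  by_cases h : Prf T Γ φ
  · exact ⟨Γ, List.Subset.refl _, hΓ, .inl h⟩
  have hn : ¬ Prf T (φ.neg :: Γ) .falsum := fun h' => h (.byContra h')
  have hsub (ψ : Fm) : Γ ⊆ ψ :: φ.neg :: Γ := List.Subset.trans (List.subset_cons_self _ _)
    (List.subset_cons_self _ _)
  cases φ with
  | allN θ =>
    obtain ⟨k, hk⟩ := exists_forall_mem_le Fm.boundN (θ :: θ.allN.neg :: Γ)
    rw [List.forall_mem_cons] at hk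
    refine ⟨(θ.instN ♯k).neg :: θ.allN.neg :: Γ, hsub _, fun h' => hn ?_,
      .inr ⟨Prf.hyp_cons.weaken_cons _, ?_, by rintro _ ⟨⟩⟩⟩
    · exact .impE .hyp_cons (Prf.generalizeN hk.2 hk.1 (.byContra h'))
    · rintro _ ⟨⟩
      exact ⟨_, .hyp_cons⟩
  | allS θ =>
    obtain ⟨k, hk⟩ := exists_forall_mem_le Fm.boundS (θ :: θ.allS.neg :: Γ)
    rw [List.forall_mem_cons] at hk
    refine ⟨(θ.instS k).neg :: θ.allS.neg :: Γ, hsub _, fun h' => hn ?_,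
      .inr ⟨Prf.hyp_cons.weaken_cons _, by rintro _ ⟨⟩, ?_⟩⟩
    · exact .impE .hyp_cons (Prf.generalizeS hk.2 hk.1 (.byContra h'))
    · rintro _ ⟨⟩
      exact ⟨_, .hyp_cons⟩
  | _ =>
    refine ⟨_, List.subset_cons_self _ _, hn, .inr ⟨.hyp_cons, ?_, ?_⟩⟩ <;> rintro _ ⟨⟩

theorem exists_decidingChain {Γ : List Fm} (hΓ : ¬ Prf T Γ .falsum) :
    ∃ G : ℕ → List Fm, G 0 = Γ ∧ (∀ n, ¬ Prf T (G n) .falsum) ∧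
      (∀ m n, m ≤ n → G m ⊆ G n) ∧ ∀ φ, ∃ n, Decides T (G n) φ := by
  obtain ⟨enum, henum⟩ := exists_surjective_nat Fm
  choose step hsub hcons hdec using
    fun (Γ : {Γ : List Fm // ¬ Prf T Γ .falsum}) (φ : Fm) => exists_decides Γ.2 φ
  let G : ℕ → {Γ : List Fm // ¬ Prf T Γ .falsum} := fun n =>
    Nat.rec ⟨Γ, hΓ⟩ (fun n Δ => ⟨step Δ (enum n), hcons Δ (enum n)⟩) n
  refine ⟨fun n => (G n).1, rfl, fun n => (G n).2, fun m n h => ?_, fun φ => ?_⟩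
  · induction h with
    | refl => exact List.Subset.refl _
    | step _ ih => exact List.Subset.trans ih (hsub (G _) (enum _))
  · obtain ⟨n, rfl⟩ := henum φ
    exact ⟨n + 1, hdec (G n) (enum n)⟩

/-- `D` is a Henkin set: a deductively closed and complete set of formulas that contains all
substitution instances of the axioms `T` and, with every refuted universal formula, refutes one of
its instances. -/
structure IsHenkin (T : Set Fm) (D : Fm → Prop) : Prop where
  falsum : ¬ D .falsum
  imp (φ ψ : Fm) : D (.imp φ ψ) ↔ (D φ → D ψ)
  allN (φ : Fm) : D φ.allN ↔ ∀ t, D (φ.instN t)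
  allS (φ : Fm) : D φ.allS ↔ ∀ X, D (φ.instS X)
  eqRefl (t : Tm) : D (t ≐ t)
  eqSubst (φ : Fm) {s t : Tm} : D (s ≐ t) → D (φ.instN s) → D (φ.instN t)
  ax_subst {φ : Fm} (h : φ ∈ T) (σ : ℕ → Tm) (ρ : ℕ → ℕ) : D (φ.subst σ ρ)

theorem isHenkin_of_chain {G : ℕ → List Fm} (hcons : ∀ n, ¬ Prf T (G n) .falsum)
    (hmono : ∀ m n, m ≤ n → G m ⊆ G n) (hdec : ∀ φ, ∃ n, Decides T (G n) φ) :
    IsHenkin T fun φ => ∃ n, Prf T (G n) φ := by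
  have up {m n : ℕ} {φ : Fm} (h : m ≤ n) (hφ : Prf T (G m) φ) : Prf T (G n) φ :=
    hφ.weaken (hmono m n h)
  have mp {φ ψ : Fm} : (∃ n, Prf T (G n) (φ ⟹ₐ ψ)) → (∃ n, Prf T (G n) φ) →
      ∃ n, Prf T (G n) ψ := by
    rintro ⟨m, hm⟩ ⟨n, hn⟩
    exact ⟨max m n, .impE (up (le_max_left _ _) hm) (up (le_max_right _ _) hn)⟩
  have con : ¬ ∃ n, Prf T (G n) .falsum := fun ⟨n, hn⟩ => hcons n hn
  refine ⟨con, fun φ ψ => ⟨mp, fun h => ?_⟩,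
    fun φ => ⟨fun ⟨n, hn⟩ t => ⟨n, .allNE t hn⟩, fun h => ?_⟩,
    fun φ => ⟨fun ⟨n, hn⟩ X => ⟨n, .allSE X hn⟩, fun h => ?_⟩, fun t => ⟨0, .eqRefl t⟩, ?_,
    fun h σ ρ => ⟨0, .ax_subst h σ ρ _⟩⟩
  · obtain ⟨n, hn | ⟨hn, -⟩⟩ := hdec φ
    · obtain ⟨m, hm⟩ := h ⟨n, hn⟩
      exact ⟨m, .impI (hm.weaken_cons _)⟩
    · exact ⟨n, .impI (.exfalso (.impE (hn.weaken_cons _) .hyp_cons))⟩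
  · obtain ⟨n, hn | ⟨-, hn, -⟩⟩ := hdec φ.allN
    · exact ⟨n, hn⟩
    · obtain ⟨t, ht⟩ := hn φ rfl
      exact (con (mp ⟨n, ht⟩ (h t))).elim
  · obtain ⟨n, hn | ⟨-, -, hn⟩⟩ := hdec φ.allS
    · exact ⟨n, hn⟩
    · obtain ⟨X, hX⟩ := hn φ rfl
      exact (con (mp ⟨n, hX⟩ (h X))).elim
  · rintro φ s t ⟨m, hm⟩ ⟨n, hn⟩
    exact ⟨max m n, .eqSubst φ (up (le_max_left _ _) hm) (up (le_max_right _ _) hn)⟩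

theorem exists_isHenkin {Γ : List Fm} (hΓ : ¬ Prf T Γ .falsum) :
    ∃ D : Fm → Prop, IsHenkin T D ∧ ∀ φ ∈ Γ, D φ := by
  obtain ⟨G, rfl, hcons, hmono, hdec⟩ := exists_decidingChain hΓ
  exact ⟨_, isHenkin_of_chain hcons hmono hdec, fun φ hφ => ⟨0, .hyp hφ⟩⟩

namespace IsHenkin

variable {D : Fm → Prop} (hD : IsHenkin T D)

section congruence

include hD

theorem eq_symm {s t : Tm} (h : D (s ≐ t)) : D (t ≐ s) := by
  have := hD.eqSubst (♯0 ≐ s.lift 1) h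
  simp only [Fm.instN_eq, Fm.subst, Tm.subst, scons_zero, Tm.lift_one_subst_scons,
    Tm.subst_var] at this
  exact this (hD.eqRefl s)

theorem eq_trans {s t u : Tm} (h : D (s ≐ t)) (h' : D (t ≐ u)) : D (s ≐ u) := by
  have := hD.eqSubst (s.lift 1 ≐ ♯0) h'
  simp only [Fm.instN_eq, Fm.subst, Tm.subst, scons_zero, Tm.lift_one_subst_scons,
    Tm.subst_var] at this
  exact this h

theorem eq_subst (u : Tm) {s t : Tm} (h : D (s ≐ t)) :
    D (u.subst (scons s .var) ≐ u.subst (scons t .var)) := by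
  have := hD.eqSubst ((u.subst (scons s .var)).lift 1 ≐ u) h
  simp only [Fm.instN_eq, Fm.subst, Tm.lift_one_subst_scons, Tm.subst_var] at this
  exact this (hD.eqRefl _)

theorem eq_add {s t s' t' : Tm} (h : D (s ≐ t)) (h' : D (s' ≐ t')) :
    D (.add s s' ≐ .add t t') := by
  have h₁ := hD.eq_subst (.add ♯0 (s'.lift 1)) h
  have h₂ := hD.eq_subst (.add (t.lift 1) ♯0) h'
  simp only [Tm.subst, scons_zero, Tm.lift_one_subst_scons, Tm.subst_var] at h₁ h₂
  exact hD.eq_trans h₁ h₂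

theorem eq_mul {s t s' t' : Tm} (h : D (s ≐ t)) (h' : D (s' ≐ t')) :
    D (.mul s s' ≐ .mul t t') := by
  have h₁ := hD.eq_subst (.mul ♯0 (s'.lift 1)) h
  have h₂ := hD.eq_subst (.mul (t.lift 1) ♯0) h'
  simp only [Tm.subst, scons_zero, Tm.lift_one_subst_scons, Tm.subst_var] at h₁ h₂
  exact hD.eq_trans h₁ h₂

theorem lt_congr {s t s' t' : Tm} (h : D (s ≐ t)) (h' : D (s' ≐ t')) (hs : D (s ≺ s')) :
    D (t ≺ t') := by
  have h₁ := hD.eqSubst (♯0 ≺ s'.lift 1) h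
  have h₂ := hD.eqSubst (t.lift 1 ≺ ♯0) h'
  simp only [Fm.instN_eq, Fm.subst, Tm.subst, scons_zero, Tm.lift_one_subst_scons,
    Tm.subst_var] at h₁ h₂
  exact h₂ (h₁ hs)

theorem mem_congr {s t : Tm} (X : ℕ) (h : D (s ≐ t)) (hs : D (s ∊ X)) : D (t ∊ X) := by
  have := hD.eqSubst (♯0 ∊ X) h
  simp only [Fm.instN_eq, Fm.subst, Tm.subst, scons_zero, id] at this
  exact this hs

end congruence

/-- Equality of terms according to `D`. -/
def setoid : Setoid Tm where
  r s t := D (s ≐ t)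
  iseqv := ⟨hD.eqRefl, hD.eq_symm, hD.eq_trans⟩

/-- The numbers of the term model of `D`: terms up to provable equality. -/
def Num : Type := Quotient hD.setoid

/-- The sets of the term model of `D`: set variables, each with the members that `D` prescribes. -/
def Sets (_ : IsHenkin T D) : Type := ℕ

/-- The set denoted by a set variable. -/
def Sets.mk (X : ℕ) : hD.Sets := X

/-- The number denoted by a term. -/
def Num.mk (t : Tm) : hD.Num := Quotient.mk hD.setoid t

instance : Zero hD.Num := ⟨Num.mk hD .zero⟩
instance : One hD.Num := ⟨Num.mk hD .one⟩
instance : Add hD.Num := ⟨Quotient.map₂ .add fun _ _ h _ _ h' => hD.eq_add h h'⟩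
instance : Mul hD.Num := ⟨Quotient.map₂ .mul fun _ _ h _ _ h' => hD.eq_mul h h'⟩

instance : LT hD.Num := ⟨Quotient.lift₂ (fun s t => D (s ≺ t)) fun _ _ _ _ h h' =>
  propext ⟨hD.lt_congr h h', hD.lt_congr (hD.eq_symm h) (hD.eq_symm h')⟩⟩

instance : Membership hD.Num hD.Sets := ⟨fun X => Quotient.lift (fun t => D (t ∊ X)) fun _ _ h =>
  propext ⟨hD.mem_congr X h, hD.mem_congr X (hD.eq_symm h)⟩⟩

theorem val_mk (t : Tm) (σ : ℕ → Tm) : t.val (Num.mk hD ∘ σ) = Num.mk hD (t.subst σ) := by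
  induction t with
  | add s t hs ht | mul s t hs ht => rw [Tm.val, hs, ht]; rfl
  | _ => rfl

theorem sat_mk_iff (φ : Fm) (σ : ℕ → Tm) (ρ : ℕ → ℕ) :
    φ.Sat (Num.mk hD ∘ σ) (Sets.mk hD ∘ ρ) ↔ D (φ.subst σ ρ) := by
  induction φ generalizing σ ρ with
  | falsum => exact ⟨False.elim, hD.falsum⟩
  | eq s t =>
    rw [sat_eq, val_mk, val_mk]
    exact Quotient.eq (r := hD.setoid)
  | lt s t =>
    rw [sat_lt, val_mk, val_mk]
    rfl
  | mem t X =>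
    rw [sat_mem, val_mk]
    rfl
  | imp φ ψ h₁ h₂ =>
    rw [sat_imp, h₁, h₂]
    exact (hD.imp _ _).symm
  | allN φ ih =>
    simp only [sat_allN, Fm.subst, hD.allN, Fm.subst_upN_instN, ← ih, comp_scons]
    exact ⟨fun h t => h _, fun h => Quotient.ind h⟩
  | allS φ ih =>
    simp only [sat_allS, Fm.subst, hD.allS, Fm.subst_upS_instS, ← ih, comp_scons]
    exact Iff.rfl

theorem models : Models hD.Num hD.Sets T := fun φ hφ v s => by
  obtain ⟨σ, rfl⟩ : ∃ σ, v = Num.mk hD ∘ σ :=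
    ⟨fun i => (v i).out, funext fun i => (Quotient.out_eq (v i)).symm⟩
  exact (hD.sat_mk_iff φ σ s).2 (hD.ax_subst hφ σ s)

end IsHenkin

/-- The completeness theorem: if `T` does not prove `φ`, then the term model of a Henkin set that
contains `¬ φ` refutes `φ`. -/
theorem completeness {φ : Fm}
    (h : ∀ (N S : Type) [Zero N] [One N] [Add N] [Mul N] [LT N] [Membership N S],
      Models N S T → ∀ (v : ℕ → N) (s : ℕ → S), φ.Sat v s) : Proves T φ := by
  refine .byContra (by_contra fun hcon => ?_)
  obtain ⟨D, hD, hΓ⟩ := exists_isHenkin hcon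
  have hφ : D φ := by
    rw [← φ.subst_id]
    exact (hD.sat_mk_iff φ .var id).1 (h _ _ hD.models _ _)
  exact hD.falsum ((hD.imp φ .falsum).1 (hΓ φ.neg List.mem_cons_self) hφ)

end Henkin

/-! ### Definable predicates -/

theorem IsBounded.subst {φ : Fm} (h : IsBounded φ) (σ : ℕ → Tm) (ρ : ℕ → ℕ) :
    IsBounded (φ.subst σ ρ) := by
  induction h generalizing σ ρ with
  | falsum => exact .falsum
  | eq s t => exact .eq _ _
  | lt s t => exact .lt _ _
  | mem t X => exact .mem _ _
  | imp _ _ ih₁ ih₂ => exact .imp (ih₁ σ ρ) (ih₂ σ ρ)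
  | ballN t _ ih =>
    have := IsBounded.ballN (t.subst σ) (ih (upN σ) ρ)
    simpa only [Fm.ballN, Fm.subst, upN, Tm.subst, Tm.lift, Tm.subst_subst] using this

section Definability

variable {N S : Type*}

/-- The assignment obtained from `v` when the `i`-th variable stands for a parameter from `N` or
for an entry of `v`, as prescribed by `w i`. -/
def interp (w : ℕ → N ⊕ ℕ) (v : ℕ → N) (i : ℕ) : N := Sum.elim id v (w i)

section Terms

variable [Zero N] [One N] [Add N] [Mul N]

/-- Functions of an assignment that are given by a term with parameters. -/
class TermDef (f : (ℕ → N) → N) : Prop where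
  exists_term : ∃ (t : Tm) (w : ℕ → N ⊕ ℕ), ∀ v, f v = t.val (interp w v)

theorem TermDef.exists_terms (g : (ℕ → N) → ℕ → N) [hg : ∀ i, TermDef fun v => g v i] :
    ∃ (t : ℕ → Tm) (w : ℕ → N ⊕ ℕ), ∀ v, g v = fun i => (t i).val (interp w v) := by
  choose t w h using fun i => (hg i).exists_term
  refine ⟨fun i => (t i).subst fun j => ♯(Nat.pair i j), fun k => w k.unpair.1 k.unpair.2,
    fun v => funext fun i => ?_⟩
  simp only [h, Tm.val_subst, Tm.val_var, interp, Nat.unpair_pair]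
  rfl

instance TermDef.const (c : N) : TermDef fun _ => c := ⟨♯0, fun _ => .inl c, fun _ => rfl⟩

instance TermDef.var (i : ℕ) : TermDef fun v : ℕ → N => v i := ⟨♯0, fun _ => .inr i, fun _ => rfl⟩

instance TermDef.interp (w : ℕ → N ⊕ ℕ) (g : (ℕ → N) → ℕ → N) [∀ i, TermDef fun v => g v i]
    (i : ℕ) : TermDef fun v => interp w (g v) i := by
  rcases hi : w i with c | j <;> simp only [SOA.interp, hi, Sum.elim_inl, Sum.elim_inr] <;>
    infer_instance

instance TermDef.scons (f : (ℕ → N) → N) (g : (ℕ → N) → ℕ → N) [TermDef f]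
    [∀ i, TermDef fun v => g v i] (i : ℕ) : TermDef fun v => scons (f v) (g v) i := by
  cases i with
  | zero => exact inferInstanceAs (TermDef fun v => f v)
  | succ i => exact inferInstanceAs (TermDef fun v => g v i)

theorem TermDef.val (t : Tm) (g : (ℕ → N) → ℕ → N) [∀ i, TermDef fun v => g v i] :
    TermDef fun v => t.val (g v) := by
  obtain ⟨u, w, h⟩ := TermDef.exists_terms g
  exact ⟨t.subst u, w, fun v => by rw [h, Tm.val_subst]⟩

theorem TermDef.comp {f : (ℕ → N) → N} (hf : TermDef f) (g : (ℕ → N) → ℕ → N)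
    [∀ i, TermDef fun v => g v i] : TermDef fun v => f (g v) := by
  obtain ⟨t, w, h⟩ := hf
  simp only [h]
  exact TermDef.val t fun v => SOA.interp w (g v)

instance TermDef.add (f g : (ℕ → N) → N) [TermDef f] [TermDef g] : TermDef fun v => f v + g v :=
  TermDef.val (♯0 + ♯1) fun v => SOA.scons (f v) fun _ => g v

instance TermDef.mul (f g : (ℕ → N) → N) [TermDef f] [TermDef g] : TermDef fun v => f v * g v :=
  TermDef.val (♯0 * ♯1) fun v => SOA.scons (f v) fun _ => g v

end Terms

variable [Zero N] [One N] [Add N] [Mul N] [LT N] [Membership N S]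

variable (S) in
/-- Predicates of an assignment that are given by a bounded formula with parameters. -/
class BoundedDef (P : (ℕ → N) → Prop) : Prop where
  exists_formula :
    ∃ θ, IsBounded θ ∧ ∃ (w : ℕ → N ⊕ ℕ) (s : ℕ → S), ∀ v, P v ↔ θ.Sat (interp w v) s

variable (S) in
/-- Predicates of an assignment that are given by a `Σ⁰₁`-formula with parameters. -/
class SigmaDef (P : (ℕ → N) → Prop) : Prop where
  exists_bounded : ∃ Q : (ℕ → N) → Prop, BoundedDef S Q ∧ ∀ v, P v ↔ ∃ y, Q (scons y v)

theorem BoundedDef.congr {P Q : (ℕ → N) → Prop} (h : BoundedDef S P) (hPQ : ∀ v, Q v ↔ P v) :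
    BoundedDef S Q :=
  (funext fun v => propext (hPQ v) : Q = P) ▸ h

theorem SigmaDef.congr {P Q : (ℕ → N) → Prop} (h : SigmaDef S P) (hPQ : ∀ v, Q v ↔ P v) :
    SigmaDef S Q :=
  (funext fun v => propext (hPQ v) : Q = P) ▸ h

theorem IsBounded.boundedDef {θ : Fm} (hθ : IsBounded θ) (g : (ℕ → N) → ℕ → N) (s : ℕ → S)
    [∀ i, TermDef fun v => g v i] : BoundedDef S fun v => θ.Sat (g v) s := by
  obtain ⟨t, w, h⟩ := TermDef.exists_terms g
  exact ⟨θ.subst t id, hθ.subst _ _, w, s, fun v => by rw [h, Fm.sat_subst]; rfl⟩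

theorem BoundedDef.comp {P : (ℕ → N) → Prop} (hP : BoundedDef S P) (g : (ℕ → N) → ℕ → N)
    [∀ i, TermDef fun v => g v i] : BoundedDef S fun v => P (g v) := by
  obtain ⟨θ, hθ, w, s, h⟩ := hP
  exact (hθ.boundedDef (fun v => interp w (g v)) s).congr fun v => h (g v)

theorem SigmaDef.comp {P : (ℕ → N) → Prop} (hP : SigmaDef S P) (g : (ℕ → N) → ℕ → N)
    [hg : ∀ i, TermDef fun v => g v i] : SigmaDef S fun v => P (g v) := by
  obtain ⟨Q, hQ, h⟩ := hP
  have (i : ℕ) : TermDef fun v : ℕ → N => g (fun j => v (j + 1)) i := (hg i).comp _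
  exact ⟨fun v => Q (scons (v 0) (g fun j => v (j + 1))), hQ.comp _, fun v => h (g v)⟩

instance BoundedDef.mem (f : (ℕ → N) → N) [TermDef f] (X : S) : BoundedDef S fun v => f v ∈ X :=
  (IsBounded.mem ♯0 0).boundedDef (fun v _ => f v) fun _ => X

instance BoundedDef.imp (P Q : (ℕ → N) → Prop) [hP : BoundedDef S P] [hQ : BoundedDef S Q] :
    BoundedDef S fun v => P v → Q v := by
  obtain ⟨θ, hθ, w, s, h⟩ := hP
  obtain ⟨χ, hχ, w', s', h'⟩ := hQ
  let e := Equiv.natSumNatEquivNat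
  let g (v : ℕ → N) (i : ℕ) : N := Sum.elim (interp w v) (interp w' v) (e.symm i)
  have (i : ℕ) : TermDef fun v => g v i := by
    rcases hi : e.symm i with j | j <;> simp only [g, hi] <;>
      exact TermDef.interp _ (fun v => v) j
  have hbounded : IsBounded (θ.subst (fun i => ♯(e (.inl i))) (fun i => e (.inl i)) ⟹ₐ
    χ.subst (fun i => ♯(e (.inr i))) (fun i => e (.inr i))) := .imp (hθ.subst _ _) (hχ.subst _ _)
  refine (hbounded.boundedDef g fun i => Sum.elim s s' (e.symm i)).congr fun v => ?_
  simp only [h, h', sat_imp, Fm.sat_subst, Tm.val_var, g, Equiv.symm_apply_apply, Sum.elim_inl,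
    Sum.elim_inr]

section

variable [Nonempty S]

instance BoundedDef.eq (f g : (ℕ → N) → N) [TermDef f] [TermDef g] :
    BoundedDef S fun v => f v = g v :=
  (IsBounded.eq ♯0 ♯1).boundedDef (fun v => scons (f v) fun _ => g v) fun _ => Classical.arbitrary S

instance BoundedDef.lt (f g : (ℕ → N) → N) [TermDef f] [TermDef g] :
    BoundedDef S fun v => f v < g v :=
  (IsBounded.lt ♯0 ♯1).boundedDef (fun v => scons (f v) fun _ => g v) fun _ => Classical.arbitrary S

instance BoundedDef.false : BoundedDef S fun _ : ℕ → N => False :=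
  IsBounded.falsum.boundedDef (fun v => v) fun _ => Classical.arbitrary S

instance BoundedDef.not (P : (ℕ → N) → Prop) [BoundedDef S P] : BoundedDef S fun v => ¬ P v :=
  BoundedDef.imp P fun _ => False

instance BoundedDef.const (p : Prop) : BoundedDef S fun _ : ℕ → N => p := by
  by_cases h : p
  · exact (inferInstance : BoundedDef S fun _ : ℕ → N => ¬ False).congr fun _ => iff_of_true h id
  · exact BoundedDef.false.congr fun _ => iff_false_intro h

instance BoundedDef.or (P Q : (ℕ → N) → Prop) [BoundedDef S P] [BoundedDef S Q] :
    BoundedDef S fun v => P v ∨ Q v :=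
  (inferInstance : BoundedDef S fun v : ℕ → N => ¬ P v → Q v).congr fun _ => or_iff_not_imp_left

instance BoundedDef.and (P Q : (ℕ → N) → Prop) [BoundedDef S P] [BoundedDef S Q] :
    BoundedDef S fun v => P v ∧ Q v :=
  (inferInstance : BoundedDef S fun v : ℕ → N => ¬ (P v → ¬ Q v)).congr fun _ =>
    by rw [Classical.not_imp, not_not]

instance BoundedDef.iff (P Q : (ℕ → N) → Prop) [BoundedDef S P] [BoundedDef S Q] :
    BoundedDef S fun v => P v ↔ Q v :=
  (inferInstance : BoundedDef S fun v : ℕ → N => (P v → Q v) ∧ (Q v → P v)).congr fun _ =>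
    iff_iff_implies_and_implies

instance BoundedDef.ball (f : (ℕ → N) → N) (Q : N → (ℕ → N) → Prop) [TermDef f]
    [hQ : BoundedDef S fun v => Q (v 0) fun i => v (i + 1)] :
    BoundedDef S fun v => ∀ x, x < f v → Q x v := by
  classical
  obtain ⟨θ, hθ, w, s, h⟩ := hQ
  let σ (i : ℕ) : Tm := if w i = .inr 0 then ♯0 else ♯(i + 2)
  let g (v : ℕ → N) : ℕ → N := scons (f v) (interp w (scons (f v) v))
  refine ((IsBounded.ballN ♯0 (hθ.subst σ id)).boundedDef g s).congr fun v => ?_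
  simp only [sat_ballN, Fm.sat_subst]
  refine forall₂_congr fun x _ => (h (scons x v)).trans (iff_of_eq (congrArg₂ _ ?_ rfl))
  funext i
  rcases hi : w i with c | _ | j <;> simp [σ, g, interp, hi]

instance BoundedDef.bex (f : (ℕ → N) → N) (Q : N → (ℕ → N) → Prop) [TermDef f]
    [BoundedDef S fun v => Q (v 0) fun i => v (i + 1)] :
    BoundedDef S fun v => ∃ x, x < f v ∧ Q x v :=
  (inferInstance : BoundedDef S fun v : ℕ → N => ¬ ∀ x, x < f v → ¬ Q x v).congr fun _ => by
    simp only [not_forall, not_not, exists_prop]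

instance SigmaDef.of_boundedDef (P : (ℕ → N) → Prop) [h : BoundedDef S P] : SigmaDef S P :=
  ⟨fun v => P fun i => v i.succ, h.comp _, fun v => ⟨fun h => ⟨v 0, h⟩, fun ⟨_, h⟩ => h⟩⟩

instance SigmaDef.exists_boundedDef (Q : N → (ℕ → N) → Prop)
    [h : BoundedDef S fun v => Q (v 0) fun i => v (i + 1)] : SigmaDef S fun v => ∃ x, Q x v :=
  ⟨_, h, fun _ => Iff.rfl⟩

instance SigmaDef.or (P Q : (ℕ → N) → Prop) [hP : SigmaDef S P] [hQ : SigmaDef S Q] :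
    SigmaDef S fun v => P v ∨ Q v := by
  obtain ⟨P', hP', h⟩ := hP
  obtain ⟨Q', hQ', h'⟩ := hQ
  refine ⟨fun v => P' v ∨ Q' v, inferInstance, fun v => ?_⟩
  rw [h, h', exists_or]

end

/-! ### Models of `RCA₀` as ordered semirings -/

variable (N S) in
/-- All axioms of `RCA₀` hold in the structure with numbers `N` and sets `S`. -/
abbrev IsModel : Prop := Models N S RCA₀

theorem BoundedDef.exists_formula_two {P : (ℕ → N) → Prop} (hP : BoundedDef S P) :
    ∃ θ, IsBounded θ ∧ ∃ (e : ℕ → N) (s : ℕ → S),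
      ∀ x y, θ.Sat (scons x (scons y e)) s ↔ P (scons x (scons y fun _ => 0)) := by
  obtain ⟨θ, hθ, w, s, h⟩ := hP
  let σ (i : ℕ) : Tm := match w i with
    | .inr 0 => ♯0
    | .inr 1 => ♯1
    | _ => ♯(i + 2)
  refine ⟨θ.subst σ id, hθ.subst _ _, interp w fun _ => 0, s, fun x y => ?_⟩
  rw [Fm.sat_subst]
  refine (iff_of_eq (congrArg₂ _ ?_ rfl)).trans (h (scons x (scons y fun _ => 0))).symm
  funext i
  rcases hi : w i with c | _ | _ | j <;> simp [σ, interp, hi]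

theorem IsModel.induction (H : IsModel N S) {P : N → Prop} (hP : SigmaDef S fun v => P (v 0))
    (zero : P 0) (succ : ∀ x, P x → P (x + 1)) (x : N) : P x := by
  obtain ⟨Q, hQ, h⟩ := hP
  obtain ⟨θ, hθ, e, s, hs⟩ := hQ.exists_formula_two
  have sat_exN_iff (y : N) : θ.exN.Sat (scons y e) s ↔ P y := by
    rw [sat_exN]
    exact (exists_congr fun x => hs x y).trans (h (scons y fun _ => 0)).symm
  have := H _ (.induction ⟨θ, hθ, rfl⟩) e s
  simp only [SOA.induction, sat_imp, sat_and, sat_allN, Fm.sat_instN, Fm.sat_instSucc, sat_exN_iff,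
    Tm.val_zero] at this
  exact this ⟨zero, succ⟩ x

theorem IsModel.comprehension (H : IsModel N S) {P : N → Prop}
    (hP : BoundedDef S fun v => P (v 0)) : ∃ X : S, ∀ x, x ∈ X ↔ P x := by
  obtain ⟨θ, hθ, e, s, hs⟩ := (hP.comp fun v i => v i.succ).exists_formula_two
  have := H _ (.comprehension ⟨θ, hθ, rfl⟩ ⟨θ, hθ, rfl⟩) e s
  simpa [SOA.comprehension, Fm.sat_liftS, hs] using this

end Definability

namespace IsModel

variable {N S : Type*} [Zero N] [One N] [Add N] [Mul N] [LT N] [Membership N S] [Nonempty S]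
  (H : IsModel N S)
include H

theorem add_zero (x : N) : x + 0 = x := by
  simpa using H _ .add_zero (fun _ => x) fun _ => Classical.arbitrary S

theorem mul_zero (x : N) : x * 0 = 0 := by
  simpa using H _ .mul_zero (fun _ => x) fun _ => Classical.arbitrary S

theorem succ_ne_zero (x : N) : x + 1 ≠ 0 := by
  simpa using H _ .succ_ne_zero (fun _ => x) fun _ => Classical.arbitrary S

theorem succ_inj {x y : N} : x + 1 = y + 1 → x = y := by
  simpa using H _ .succ_inj (scons x fun _ => y) fun _ => Classical.arbitrary S

theorem add_succ (x y : N) : x + (y + 1) = x + y + 1 := by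
  simpa using H _ .add_succ (scons x fun _ => y) fun _ => Classical.arbitrary S

theorem mul_succ (x y : N) : x * (y + 1) = x * y + x := by
  simpa using H _ .mul_succ (scons x fun _ => y) fun _ => Classical.arbitrary S

theorem not_lt_zero (x : N) : ¬ x < 0 := by
  simpa using H _ .not_lt_zero (fun _ => x) fun _ => Classical.arbitrary S

theorem lt_succ (x y : N) : x < y + 1 ↔ x < y ∨ x = y := by
  simpa using H _ .lt_succ (scons x fun _ => y) fun _ => Classical.arbitrary S

theorem zero_add (x : N) : 0 + x = x := by
  induction x using H.induction with
  | hP => infer_instance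
  | zero => exact H.add_zero 0
  | succ x ih => rw [H.add_succ, ih]

theorem succ_add (x y : N) : x + 1 + y = x + y + 1 := by
  induction y using H.induction with
  | hP => infer_instance
  | zero => rw [H.add_zero, H.add_zero]
  | succ y ih => rw [H.add_succ, ih, H.add_succ]

theorem add_comm (x y : N) : x + y = y + x := by
  induction y using H.induction with
  | hP => infer_instance
  | zero => rw [H.add_zero, H.zero_add]
  | succ y ih => rw [H.add_succ, ih, H.succ_add]

theorem add_assoc (x y z : N) : x + y + z = x + (y + z) := by
  induction z using H.induction with
  | hP => infer_instance
  | zero => rw [H.add_zero, H.add_zero]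
  | succ z ih => rw [H.add_succ, ih, H.add_succ, H.add_succ]

theorem zero_mul (x : N) : 0 * x = 0 := by
  induction x using H.induction with
  | hP => infer_instance
  | zero => exact H.mul_zero 0
  | succ x ih => rw [H.mul_succ, ih, H.add_zero]

theorem succ_mul (x y : N) : (x + 1) * y = x * y + y := by
  induction y using H.induction with
  | hP => infer_instance
  | zero => rw [H.mul_zero, H.mul_zero, H.add_zero]
  | succ y ih =>
    rw [H.mul_succ, ih, H.mul_succ, H.add_assoc, H.add_assoc, ← H.add_assoc y, H.add_comm y x,
      H.add_assoc x]

theorem mul_comm (x y : N) : x * y = y * x := by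
  induction y using H.induction with
  | hP => infer_instance
  | zero => rw [H.mul_zero, H.zero_mul]
  | succ y ih => rw [H.mul_succ, ih, H.succ_mul]

theorem mul_add (x y z : N) : x * (y + z) = x * y + x * z := by
  induction z using H.induction with
  | hP => infer_instance
  | zero => rw [H.add_zero, H.mul_zero, H.add_zero]
  | succ z ih => rw [H.add_succ, H.mul_succ, ih, H.mul_succ, H.add_assoc]

theorem mul_assoc (x y z : N) : x * y * z = x * (y * z) := by
  induction z using H.induction with
  | hP => infer_instance
  | zero => rw [H.mul_zero, H.mul_zero, H.mul_zero]
  | succ z ih => rw [H.mul_succ, ih, H.mul_succ, H.mul_add]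

theorem mul_one (x : N) : x * 1 = x := by
  rw [← H.zero_add 1, H.mul_succ, H.mul_zero, H.zero_add]

theorem add_right_cancel {x y : N} (z : N) : x + z = y + z → x = y := by
  induction z using H.induction with
  | hP => infer_instance
  | zero => rw [H.add_zero, H.add_zero]; exact id
  | succ z ih => rw [H.add_succ, H.add_succ]; exact fun h => ih (H.succ_inj h)

theorem add_left_cancel {x y : N} (z : N) (h : z + x = z + y) : x = y :=
  H.add_right_cancel z (by rwa [H.add_comm x, H.add_comm y])

theorem eq_zero_or_succ (x : N) : x = 0 ∨ ∃ y, x = y + 1 := by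
  induction x using H.induction with
  | hP => infer_instance
  | zero => exact .inl rfl
  | succ x => exact .inr ⟨x, rfl⟩

theorem lt_add_succ (x z : N) : x < x + z + 1 := by
  induction z using H.induction with
  | hP => infer_instance
  | zero => rw [H.add_zero, H.lt_succ]; exact .inr rfl
  | succ z ih => rw [← H.add_succ x z] at ih; exact (H.lt_succ _ _).2 (.inl ih)

theorem lt_iff (x y : N) : x < y ↔ ∃ z, y = x + z + 1 := by
  refine ⟨fun h => ?_, fun ⟨z, hz⟩ => hz ▸ H.lt_add_succ x z⟩
  have : ¬ x < y ∨ ∃ z, y = x + z + 1 := by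
    clear h
    induction y using H.induction with
    | hP => infer_instance
    | zero => exact .inl (H.not_lt_zero x)
    | succ y ih =>
      by_cases h : x < y + 1
      · rcases (H.lt_succ _ _).1 h with h | rfl
        · obtain ⟨z, rfl⟩ := ih.resolve_left (not_not.2 h)
          exact .inr ⟨z + 1, by rw [H.add_succ]⟩
        · exact .inr ⟨0, by rw [H.add_zero]⟩
      · exact .inl h
  exact this.resolve_left (not_not.2 h)

theorem exists_add_total (x y : N) : (∃ z, y = x + z) ∨ ∃ z, x = y + z := by
  induction y using H.induction with
  | hP => infer_instance
  | zero => exact .inr ⟨x, (H.zero_add x).symm⟩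
  | succ y ih =>
    rcases ih with ⟨z, rfl⟩ | ⟨z, rfl⟩
    · exact .inl ⟨z + 1, by rw [H.add_succ]⟩
    · rcases H.eq_zero_or_succ z with rfl | ⟨z, rfl⟩
      · exact .inl ⟨1, by rw [H.add_zero]⟩
      · exact .inr ⟨z, by rw [H.add_succ, H.succ_add]⟩

/-- The numbers of a model as a semiring. -/
abbrev commSemiring : CommSemiring N where
  add_assoc := H.add_assoc
  zero_add := H.zero_add
  add_zero := H.add_zero
  add_comm := H.add_comm
  left_distrib := H.mul_add
  right_distrib x y z := by rw [H.mul_comm, H.mul_add, H.mul_comm z, H.mul_comm z]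
  zero_mul := H.zero_mul
  mul_zero := H.mul_zero
  mul_assoc := H.mul_assoc
  one_mul x := by rw [H.mul_comm, H.mul_one]
  mul_one := H.mul_one
  mul_comm := H.mul_comm
  nsmul := nsmulRec

theorem eq_zero_of_eq_add_add {x z w : N} (h : x = x + z + w) : z = 0 := by
  have := H.add_left_cancel x (x := 0) (y := z + w) (by rw [H.add_zero, ← H.add_assoc]; exact h)
  rcases H.eq_zero_or_succ w with rfl | ⟨w, rfl⟩
  · rw [H.add_zero] at this
    exact this.symm
  · rw [H.add_succ] at this
    exact (H.succ_ne_zero _ this.symm).elim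

/-- The numbers of a model as a linear order. -/
noncomputable abbrev linearOrder : LinearOrder N where
  le x y := ∃ z, y = x + z
  lt := (· < ·)
  le_refl x := ⟨0, (H.add_zero x).symm⟩
  le_trans := by
    rintro x _ _ ⟨z, rfl⟩ ⟨w, rfl⟩
    exact ⟨z + w, H.add_assoc _ _ _⟩
  lt_iff_le_not_ge x y := by
    rw [H.lt_iff]
    constructor
    · rintro ⟨z, rfl⟩
      refine ⟨⟨z + 1, by rw [H.add_succ]⟩, fun ⟨w, hw⟩ => H.succ_ne_zero z ?_⟩
      rw [← H.add_succ] at hw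
      exact H.eq_zero_of_eq_add_add hw
    · rintro ⟨⟨z, rfl⟩, h⟩
      rcases H.eq_zero_or_succ z with rfl | ⟨z, rfl⟩
      · exact (h ⟨0, by rw [H.add_zero, H.add_zero]⟩).elim
      · exact ⟨z, by rw [H.add_succ]⟩
  le_antisymm := by
    rintro x _ ⟨z, rfl⟩ ⟨w, hw⟩
    rw [H.eq_zero_of_eq_add_add hw, H.add_zero]
  le_total := H.exists_add_total
  toDecidableLE := Classical.decRel _

theorem isStrictOrderedRing :
    letI := H.commSemiring
    letI := H.linearOrder
    IsStrictOrderedRing N := by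
  let _ := H.commSemiring
  let _ := H.linearOrder
  have mul_lt (a b c : N) (hc : 0 < c) (h : a < b) : c * a < c * b := by
    obtain ⟨z, rfl⟩ := (H.lt_iff _ _).1 h
    obtain ⟨c, rfl⟩ := (H.lt_iff _ _).1 hc
    exact (H.lt_iff _ _).2 ⟨(0 + c + 1) * z + c, by ring⟩
  exact {
    add_le_add_left := by
      rintro a _ ⟨z, rfl⟩ c
      exact ⟨z, by ring⟩
    le_of_add_le_add_left := by
      rintro a b c ⟨z, hz⟩
      exact ⟨z, H.add_left_cancel a (by rw [hz, H.add_assoc])⟩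
    zero_le_one := ⟨1, (H.zero_add 1).symm⟩
    exists_pair_ne := ⟨0 + 1, 0, H.succ_ne_zero 0⟩
    mul_lt_mul_of_pos_left := fun a ha b c h => mul_lt _ _ _ ha h
    mul_lt_mul_of_pos_right := fun a ha b c h => by
      simpa only [H.mul_comm _ a] using mul_lt _ _ _ ha h }

theorem canonicallyOrderedAdd :
    letI := H.commSemiring
    letI := H.linearOrder
    CanonicallyOrderedAdd N := by
  let _ := H.commSemiring
  let _ := H.linearOrder
  exact {
    exists_add_of_le := id
    le_self_add := fun a b => ⟨b, rfl⟩
    le_add_self := fun a b => ⟨b, H.add_comm _ _⟩ }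

/-- The successor function of a model. -/
noncomputable abbrev succAddOrder :
    letI := H.linearOrder
    SuccAddOrder N :=
  letI := H.commSemiring
  letI := H.linearOrder
  haveI := H.isStrictOrderedRing
  haveI := H.canonicallyOrderedAdd
  { SuccOrder.ofSuccLeIff (fun x : N => x + 1) fun {a b} => by
      rw [show a < b ↔ _ from H.lt_iff a b]
      exact exists_congr fun z => by rw [H.add_assoc, H.add_comm 1, H.add_assoc] with
    succ_eq_add_one := fun _ => rfl }

end IsModel

/-- Models of `RCA₀` whose numbers are presented as an ordered semiring. -/
class RCAModel (N S : Type*) [CommSemiring N] [LinearOrder N] [Membership N S] : Prop where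
  isModel : IsModel N S

section Ordered

variable {N S : Type*} [CommSemiring N] [LinearOrder N] [IsStrictOrderedRing N]
  [CanonicallyOrderedAdd N] [SuccAddOrder N] [Membership N S]

/-! ### Consequences of `Σ⁰₁`-induction -/

section Definability

variable [Nonempty S]

section

omit [CanonicallyOrderedAdd N]

instance BoundedDef.le (f g : (ℕ → N) → N) [TermDef f] [TermDef g] :
    BoundedDef S fun v => f v ≤ g v :=
  (inferInstance : BoundedDef S fun v => f v < g v + 1).congr fun _ => Order.lt_add_one_iff.symm

instance BoundedDef.ball_le (f : (ℕ → N) → N) (Q : N → (ℕ → N) → Prop) [TermDef f]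
    [BoundedDef S fun v => Q (v 0) fun i => v (i + 1)] :
    BoundedDef S fun v => ∀ x, x ≤ f v → Q x v :=
  (inferInstance : BoundedDef S fun v => ∀ x, x < f v + 1 → Q x v).congr fun _ => by
    simp only [Order.lt_add_one_iff]

instance BoundedDef.bex_le (f : (ℕ → N) → N) (Q : N → (ℕ → N) → Prop) [TermDef f]
    [BoundedDef S fun v => Q (v 0) fun i => v (i + 1)] :
    BoundedDef S fun v => ∃ x, x ≤ f v ∧ Q x v :=
  (inferInstance : BoundedDef S fun v => ∃ x, x < f v + 1 ∧ Q x v).congr fun _ => by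
    simp only [Order.lt_add_one_iff]

end

instance SigmaDef.exists (Q : N → (ℕ → N) → Prop)
    [h : SigmaDef S fun v => Q (v 0) fun i => v (i + 1)] : SigmaDef S fun v => ∃ x, Q x v := by
  obtain ⟨R, hR, h⟩ := h
  have : BoundedDef S fun v => R (scons (v 0) (scons (v 1) fun i => v (i + 3))) := hR.comp _
  refine ⟨fun v => ∃ x, x < v 0 ∧ ∃ y, y < v 0 ∧ R (scons y (scons x fun i => v (i + 1))),
    inferInstance, fun v => ?_⟩
  have hQ (x : N) : Q x v ↔ ∃ y, R (scons y (scons x v)) := h (scons x v)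
  simp only [hQ]
  constructor
  · rintro ⟨x, y, hxy⟩
    exact ⟨x + y + 1, x, Order.lt_add_one_iff.2 le_self_add, y, Order.lt_add_one_iff.2 le_add_self,
      hxy⟩
  · rintro ⟨_, x, _, y, _, hxy⟩
    exact ⟨x, y, hxy⟩

instance SigmaDef.and (P Q : (ℕ → N) → Prop) [hP : SigmaDef S P] [hQ : SigmaDef S Q] :
    SigmaDef S fun v => P v ∧ Q v := by
  obtain ⟨P', hP', h⟩ := hP
  obtain ⟨Q', hQ', h'⟩ := hQ
  have : BoundedDef S fun v => P' (scons (v 1) fun i => v (i + 2)) := hP'.comp _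
  have : BoundedDef S fun v => Q' (scons (v 0) fun i => v (i + 2)) := hQ'.comp _
  refine (inferInstance : SigmaDef S fun v => ∃ y, ∃ y', P' (scons y v) ∧ Q' (scons y' v)).congr
    fun v => ?_
  rw [h, h', exists_and_exists_comm]

instance SigmaDef.imp (P Q : (ℕ → N) → Prop) [BoundedDef S P] [SigmaDef S Q] :
    SigmaDef S fun v => P v → Q v :=
  (inferInstance : SigmaDef S fun v => ¬ P v ∨ Q v).congr fun _ => imp_iff_not_or

end Definability

namespace RCAModel

variable [RCAModel N S]

section

omit [IsStrictOrderedRing N] [CanonicallyOrderedAdd N] [SuccAddOrder N]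

variable (S) in
theorem induction {P : N → Prop} (hP : SigmaDef S fun v => P (v 0)) (zero : P 0)
    (succ : ∀ x, P x → P (x + 1)) (x : N) : P x :=
  (isModel : IsModel N S).induction hP zero succ x

variable (S) in
theorem comprehension {P : N → Prop} (hP : BoundedDef S fun v => P (v 0)) :
    ∃ X : S, ∀ x, x ∈ X ↔ P x :=
  (isModel : IsModel N S).comprehension hP

end

variable [Nonempty S]

variable (S) in
omit [CanonicallyOrderedAdd N] in
theorem induction_le {P : N → Prop} (hP : SigmaDef S fun v => P (v 0)) (n : N) (zero : P 0)
    (succ : ∀ x < n, P x → P (x + 1)) : P n := by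
  suffices ∀ x, x ≤ n → P x from this n le_rfl
  refine induction S inferInstance (fun _ => zero) fun x ih hx => ?_
  have hx := Order.add_one_le_iff.1 hx
  exact succ x hx (ih hx.le)

variable (S) in
theorem exists_least {P : N → Prop} (hP : BoundedDef S fun v => P (v 0)) {x : N} (hx : P x) :
    ∃ m, P m ∧ ∀ y < m, ¬ P y := by
  by_contra! h
  have (i : ℕ) : BoundedDef S fun v => P (v i) := hP.comp fun v _ => v i
  have none_below : ∀ n y, y < n → ¬ P y := by
    refine induction S inferInstance (by simp) fun n ih y hy hPy => ?_
    obtain ⟨z, hz, hPz⟩ := h y hPy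
    exact ih z (hz.trans_le (Order.lt_add_one_iff.1 hy)) hPz
  exact none_below (x + 1) x (Order.lt_add_one_iff.2 le_rfl) hx

variable (S) in
theorem bounded_collection {R : N → N → Prop} (hR : BoundedDef S fun v => R (v 0) (v 1)) (n : N)
    (h : ∀ x < n, ∃ y, R x y) : ∃ b, ∀ x, x < n → ∃ y, y < b ∧ R x y := by
  have (i j : ℕ) : BoundedDef S fun v => R (v i) (v j) :=
    hR.comp fun v => scons (v i) fun _ => v j
  refine induction_le S (P := fun n => ∃ b, ∀ x, x < n → ∃ y, y < b ∧ R x y) inferInstance n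
    ⟨0, by simp⟩ fun x hx ⟨b, hb⟩ => ?_
  obtain ⟨y, hy⟩ := h x hx
  refine ⟨b + y + 1, fun z hz => ?_⟩
  rcases (Order.lt_add_one_iff.1 hz).lt_or_eq with hz | rfl
  · obtain ⟨y', hy', hR⟩ := hb z hz
    exact ⟨y', hy'.trans_le (le_self_add.trans le_self_add), hR⟩
  · exact ⟨y, Order.lt_add_one_iff.2 le_add_self, hy⟩

end RCAModel

instance SigmaDef.ball [Nonempty S] [RCAModel N S] (f : (ℕ → N) → N) (Q : N → (ℕ → N) → Prop)
    [hf : TermDef f] [h : SigmaDef S fun v => Q (v 0) fun i => v (i + 1)] :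
    SigmaDef S fun v => ∀ x, x < f v → Q x v := by
  obtain ⟨R, hR, h⟩ := h
  have : BoundedDef S fun v => R (scons (v 0) (scons (v 1) fun i => v (i + 3))) := hR.comp _
  have : TermDef fun v : ℕ → N => f fun i => v (i + 1) := hf.comp _
  refine ⟨fun v => ∀ x, x < f (fun i => v (i + 1)) → ∃ y, y < v 0 ∧
    R (scons y (scons x fun i => v (i + 1))), inferInstance, fun v => ?_⟩
  have hQ (x : N) : Q x v ↔ ∃ y, R (scons y (scons x v)) := h (scons x v)
  simp only [hQ]
  constructor
  · have : BoundedDef S fun u : ℕ → N => R (scons (u 1) (scons (u 0) v)) := hR.comp _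
    exact RCAModel.bounded_collection S (R := fun x y => R (scons y (scons x v))) this (f v)
  · rintro ⟨b, hb⟩ x hx
    obtain ⟨y, -, hy⟩ := hb x hx
    exact ⟨y, hy⟩

variable (S) in
theorem RCAModel.collection [Nonempty S] [RCAModel N S] {R : N → N → Prop}
    (hR : SigmaDef S fun v => R (v 0) (v 1)) (n : N) (h : ∀ x < n, ∃ y, R x y) :
    ∃ b, ∀ x < n, ∃ y < b, R x y := by
  obtain ⟨T, hT, hR⟩ := hR
  have hR (x y : N) : R x y ↔ ∃ z, T (scons z (scons x fun _ => y)) := hR (scons x fun _ => y)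
  have (i j k : ℕ) : BoundedDef S fun v => T (scons (v i) (scons (v j) fun _ => v k)) := hT.comp _
  obtain ⟨b, hb⟩ := RCAModel.bounded_collection S
    (R := fun x p => ∃ y, y < p ∧ ∃ z, z < p ∧ T (scons z (scons x fun _ => y)))
    inferInstance n fun x hx => by
      obtain ⟨y, hy⟩ := h x hx
      obtain ⟨z, hz⟩ := (hR x y).1 hy
      exact ⟨y + z + 1, y, Order.lt_add_one_iff.2 le_self_add, z,
        Order.lt_add_one_iff.2 le_add_self, hz⟩
  refine ⟨b, fun x hx => ?_⟩
  obtain ⟨p, hp, y, hy, z, -, hz⟩ := hb x hx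
  exact ⟨y, hy.trans hp, (hR x y).2 ⟨z, hz⟩⟩

/-! ### Division with remainder -/

/-- `x` is the remainder of `n` modulo `d`. -/
def IsRemainder {N : Type*} [Add N] [Mul N] [LT N] (n d x : N) : Prop :=
  x < d ∧ ∃ q, n = q * d + x

theorem mul_add_lt_mul {d q r q' : N} (hq : q < q') (hr : r < d) : q * d + r < q' * d :=
  calc q * d + r < q * d + d := by gcongr
    _ = (q + 1) * d := by ring
    _ ≤ q' * d := mul_le_mul_left (Order.add_one_le_iff.2 hq) d

theorem IsRemainder.unique {n d x y : N} (h : IsRemainder n d x) (h' : IsRemainder n d y) :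
    x = y := by
  obtain ⟨hx, q, rfl⟩ := h
  obtain ⟨hy, q', h⟩ := h'
  rcases lt_trichotomy q q' with hq | rfl | hq
  · exact absurd h ((mul_add_lt_mul hq hx).trans_le le_self_add).ne
  · exact add_left_cancel h
  · exact absurd h ((mul_add_lt_mul hq hy).trans_le le_self_add).ne'

omit [IsStrictOrderedRing N] [SuccAddOrder N] in
theorem IsRemainder.le {n d x : N} (h : IsRemainder n d x) : x ≤ n := by
  obtain ⟨-, q, rfl⟩ := h
  exact le_add_self

instance BoundedDef.isRemainder [Nonempty S] (f g k : (ℕ → N) → N) [TermDef f] [TermDef g]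
    [TermDef k] : BoundedDef S fun v => IsRemainder (f v) (g v) (k v) := by
  have : BoundedDef S fun v : ℕ → N => IsRemainder (v 0) (v 1) (v 2) :=
    (inferInstance : BoundedDef S fun v =>
      v 2 < v 1 ∧ ∃ q, q ≤ v 0 ∧ v 0 = q * v 1 + v 2).congr fun v => and_congr_right fun h => by
        refine exists_congr fun q => (and_iff_right_of_imp fun hq => ?_).symm
        rw [hq]
        exact (le_mul_of_one_le_right' (Order.one_le_iff_pos.2 (pos_of_gt h))).trans le_self_add
  exact this.comp fun v => scons (f v) (scons (g v) fun _ => k v)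

theorem exists_isRemainder (S : Type*) [Membership N S] [Nonempty S] [RCAModel N S] (n : N) {d : N}
    (hd : 0 < d) : ∃ x, IsRemainder n d x := by
  refine RCAModel.induction S (P := fun n => ∃ x, IsRemainder n d x) inferInstance
    ⟨0, hd, 0, by rw [zero_mul, zero_add]⟩ ?_ n
  rintro _ ⟨x, hx, q, rfl⟩
  rcases (Order.add_one_le_iff.2 hx).lt_or_eq with h | h
  · exact ⟨x + 1, h, q, add_assoc _ _ _⟩
  · exact ⟨0, hd, q + 1, by rw [add_assoc, h, add_zero, add_mul, one_mul]⟩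

/-! ### Pairs -/

/-- The pairing function `pair` on the numbers of a model. -/
def numPair {N : Type*} [Add N] [Mul N] (x y : N) : N := (x + y) * (x + y) + x

theorem val_pair {N : Type*} [Zero N] [One N] [Add N] [Mul N] (s t : Tm) (v : ℕ → N) :
    (pair s t).val v = numPair (s.val v) (t.val v) := rfl

instance TermDef.numPair {N : Type*} [Zero N] [One N] [Add N] [Mul N] (f g : (ℕ → N) → N)
    [TermDef f] [TermDef g] : TermDef fun v => numPair (f v) (g v) :=
  inferInstanceAs (TermDef fun v => (f v + g v) * (f v + g v) + f v)

section

omit [IsStrictOrderedRing N] [SuccAddOrder N]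

theorem le_numPair_left (x y : N) : x ≤ numPair x y := le_add_self

end

theorem le_numPair_right (x y : N) : y ≤ numPair x y := by
  rcases eq_or_ne y 0 with rfl | h
  · exact zero_le
  calc y ≤ x + y := le_add_self
    _ ≤ (x + y) * (x + y) :=
      le_mul_of_one_le_left' (Order.one_le_iff_pos.2 (pos_iff_ne_zero.2 (by simp [h])))
    _ ≤ numPair x y := le_self_add

theorem numPair_lt_numPair {x y x' y' : N} (h : x + y < x' + y') :
    numPair x y < numPair x' y' :=
  calc numPair x y < numPair x y + (x + 2 * y + 1) := lt_add_of_pos_right _ (by positivity)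
    _ = (x + y + 1) * (x + y + 1) := by unfold numPair; ring
    _ ≤ (x' + y') * (x' + y') :=
      mul_le_mul' (Order.add_one_le_iff.2 h) (Order.add_one_le_iff.2 h)
    _ ≤ numPair x' y' := le_self_add

theorem numPair_inj {x y x' y' : N} : numPair x y = numPair x' y' ↔ x = x' ∧ y = y' := by
  refine ⟨fun h => ?_, fun ⟨hx, hy⟩ => by rw [hx, hy]⟩
  have hsum : x + y = x' + y' := by
    rcases lt_trichotomy (x + y) (x' + y') with h' | h' | h'
    · exact absurd h (numPair_lt_numPair h').ne
    · exact h'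
    · exact absurd h (numPair_lt_numPair h').ne'
  have hx : x = x' := by
    unfold numPair at h
    rw [hsum] at h
    exact add_left_cancel h
  exact ⟨hx, add_left_cancel (hx ▸ hsum)⟩

end Ordered

/-! ### Codes of finite sequences -/

section Sequences

variable {N S : Type*} [CommSemiring N] [LinearOrder N] [IsStrictOrderedRing N]
  [CanonicallyOrderedAdd N] [SuccAddOrder N] [Membership N S]

/-- The moduli of Gödel's `β`-function. -/
def modulus {N : Type*} [CommSemiring N] (m i : N) : N := m * (i + 1) + 1

/-- `c` represents a sequence of length `l`. -/
def HasLength {N : Type*} [CommSemiring N] (c l : N) : Prop :=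
  ∃ m n, c = numPair l (numPair m n)

/-- `x` is the `i`-th entry of the sequence represented by `c`. -/
def HasEntry {N : Type*} [CommSemiring N] [LT N] (c i x : N) : Prop :=
  ∃ l m n, c = numPair l (numPair m n) ∧ i < l ∧ IsRemainder n (modulus m i) x

/-- `c` and `d` represent the same sequence. -/
def SameSeq {N : Type*} [CommSemiring N] [LT N] (c d : N) : Prop :=
  (∀ l, HasLength c l ↔ HasLength d l) ∧ ∀ i x, HasEntry c i x ↔ HasEntry d i x

/-- `c` is the least number that represents some sequence. -/
def IsSeq {N : Type*} [CommSemiring N] [LT N] (c : N) : Prop :=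
  (∃ l, HasLength c l) ∧ ∀ d < c, ¬ SameSeq c d

instance TermDef.modulus {N : Type*} [CommSemiring N] (f g : (ℕ → N) → N) [TermDef f]
    [TermDef g] : TermDef fun v => modulus (f v) (g v) :=
  inferInstanceAs (TermDef fun v => f v * (g v + 1) + 1)

section

omit [IsStrictOrderedRing N] [SuccAddOrder N]

theorem modulus_pos (m i : N) [Nontrivial N] : 0 < modulus m i :=
  zero_lt_one.trans_le le_add_self

theorem HasLength.le {c l : N} (h : HasLength c l) : l ≤ c := by
  obtain ⟨m, n, rfl⟩ := h
  exact le_numPair_left _ _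

end

theorem HasLength.unique {c l l' : N} (h : HasLength c l) (h' : HasLength c l') : l = l' := by
  obtain ⟨m, n, rfl⟩ := h
  obtain ⟨m', n', h⟩ := h'
  exact (numPair_inj.1 h).1

namespace HasEntry

section

omit [IsStrictOrderedRing N] [CanonicallyOrderedAdd N] [SuccAddOrder N]

theorem exists_length {c i x : N} (h : HasEntry c i x) : ∃ l, HasLength c l ∧ i < l := by
  obtain ⟨l, m, n, hc, hi, -⟩ := h
  exact ⟨l, ⟨m, n, hc⟩, hi⟩

end

theorem lt_length {c l i x : N} (h : HasEntry c i x) (hl : HasLength c l) : i < l := by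
  obtain ⟨l', hl', hi⟩ := h.exists_length
  rwa [hl.unique hl']

omit [IsStrictOrderedRing N] [SuccAddOrder N] in
theorem index_le {c i x : N} (h : HasEntry c i x) : i ≤ c := by
  obtain ⟨l, hl, hi⟩ := h.exists_length
  exact hi.le.trans hl.le

theorem entry_le {c i x : N} (h : HasEntry c i x) : x ≤ c := by
  obtain ⟨l, m, n, rfl, -, hx⟩ := h
  exact hx.le.trans ((le_numPair_right _ _).trans (le_numPair_right _ _))

theorem unique {c i x y : N} (h : HasEntry c i x) (h' : HasEntry c i y) : x = y := by
  obtain ⟨l, m, n, rfl, -, hx⟩ := h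
  obtain ⟨l', m', n', h, -, hy⟩ := h'
  obtain ⟨-, rfl, rfl⟩ := by simpa only [numPair_inj] using h
  exact hx.unique hy

end HasEntry

namespace SameSeq

variable {N : Type*} [CommSemiring N] [LT N]

theorem refl (c : N) : SameSeq c c := ⟨fun _ => Iff.rfl, fun _ _ => Iff.rfl⟩

theorem symm {c d : N} (h : SameSeq c d) : SameSeq d c :=
  ⟨fun l => (h.1 l).symm, fun i x => (h.2 i x).symm⟩

theorem trans {c d e : N} (h : SameSeq c d) (h' : SameSeq d e) : SameSeq c e :=
  ⟨fun l => (h.1 l).trans (h'.1 l), fun i x => (h.2 i x).trans (h'.2 i x)⟩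

end SameSeq

omit [IsStrictOrderedRing N] [CanonicallyOrderedAdd N] [SuccAddOrder N] in
theorem IsSeq.eq_of_sameSeq {c d : N} (hc : IsSeq c) (hd : IsSeq d) (h : SameSeq c d) : c = d :=
  le_antisymm (not_lt.1 fun hlt => hc.2 d hlt h) (not_lt.1 fun hlt => hd.2 c hlt h.symm)

section Definability

variable [Nonempty S]

instance BoundedDef.hasLength (f g : (ℕ → N) → N) [TermDef f] [TermDef g] :
    BoundedDef S fun v => HasLength (f v) (g v) := by
  have : BoundedDef S fun v : ℕ → N => HasLength (v 0) (v 1) :=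
    (inferInstance : BoundedDef S fun v => ∃ m, m ≤ v 0 ∧ ∃ n, n ≤ v 0 ∧
      v 0 = numPair (v 1) (numPair m n)).congr fun v => by
        refine exists_congr fun m => ⟨?_, fun ⟨_, n, _, h⟩ => ⟨n, h⟩⟩
        rintro ⟨n, h⟩
        have hp : numPair m n ≤ v 0 := h ▸ le_numPair_right _ _
        exact ⟨(le_numPair_left _ _).trans hp, n, (le_numPair_right _ _).trans hp, h⟩
  exact this.comp fun v => scons (f v) fun _ => g v

instance BoundedDef.hasEntry (f g k : (ℕ → N) → N) [TermDef f] [TermDef g] [TermDef k] :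
    BoundedDef S fun v => HasEntry (f v) (g v) (k v) := by
  have : BoundedDef S fun v : ℕ → N => HasEntry (v 0) (v 1) (v 2) :=
    (inferInstance : BoundedDef S fun v => ∃ l, l ≤ v 0 ∧ ∃ m, m ≤ v 0 ∧ ∃ n, n ≤ v 0 ∧
      (v 0 = numPair l (numPair m n) ∧ v 1 < l ∧ IsRemainder n (modulus m (v 1)) (v 2))).congr
        fun v => by
        refine ⟨?_, fun ⟨l, _, m, _, n, _, h⟩ => ⟨l, m, n, h⟩⟩
        rintro ⟨l, m, n, h, hx⟩
        have hp : numPair m n ≤ v 0 := h ▸ le_numPair_right _ _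
        exact ⟨l, h ▸ le_numPair_left _ _, m, (le_numPair_left _ _).trans hp, n,
          (le_numPair_right _ _).trans hp, h, hx⟩
  exact this.comp fun v => scons (f v) (scons (g v) fun _ => k v)

theorem sameSeq_iff {c d b : N} (hc : c ≤ b) (hd : d ≤ b) : SameSeq c d ↔
    (∀ l, l ≤ b → (HasLength c l ↔ HasLength d l)) ∧
      ∀ i, i ≤ b → ∀ x, x ≤ b → (HasEntry c i x ↔ HasEntry d i x) := by
  refine ⟨fun h => ⟨fun l _ => h.1 l, fun i _ x _ => h.2 i x⟩, fun ⟨hlen, hent⟩ =>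
    ⟨fun l => ⟨fun h => ?_, fun h => ?_⟩, fun i x => ⟨fun h => ?_, fun h => ?_⟩⟩⟩
  · exact (hlen l (h.le.trans hc)).1 h
  · exact (hlen l (h.le.trans hd)).2 h
  · exact (hent i (h.index_le.trans hc) x (h.entry_le.trans hc)).1 h
  · exact (hent i (h.index_le.trans hd) x (h.entry_le.trans hd)).2 h

instance BoundedDef.sameSeq (f g : (ℕ → N) → N) [TermDef f] [TermDef g] :
    BoundedDef S fun v => SameSeq (f v) (g v) := by
  have : BoundedDef S fun v : ℕ → N => SameSeq (v 0) (v 1) :=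
    (inferInstance : BoundedDef S fun v =>
      (∀ l, l ≤ v 0 + v 1 → (HasLength (v 0) l ↔ HasLength (v 1) l)) ∧
      ∀ i, i ≤ v 0 + v 1 → ∀ x, x ≤ v 0 + v 1 → (HasEntry (v 0) i x ↔ HasEntry (v 1) i x)).congr
        fun _ => sameSeq_iff le_self_add le_add_self
  exact this.comp fun v => scons (f v) fun _ => g v

instance BoundedDef.isSeq (f : (ℕ → N) → N) [TermDef f] : BoundedDef S fun v => IsSeq (f v) := by
  have : BoundedDef S fun v : ℕ → N => IsSeq (v 0) :=
    (inferInstance : BoundedDef S fun v =>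
      (∃ l, l ≤ v 0 ∧ HasLength (v 0) l) ∧ ∀ d, d < v 0 → ¬ SameSeq (v 0) d).congr fun _ =>
        and_congr_left' (exists_congr fun _ => (and_iff_right_of_imp HasLength.le).symm)
  exact this.comp fun v _ => f v

end Definability

section Existence

/-- `a` is a unit modulo `d`. The equation avoids the subtractions of a Bézout identity. -/
def InvertibleMod {N : Type*} [CommSemiring N] (a d : N) : Prop := ∃ u w, u * a = w * d + 1

namespace InvertibleMod

variable {N : Type*} [CommSemiring N] [IsRightCancelAdd N]

theorem mul {a b d : N} (ha : InvertibleMod a d) (hb : InvertibleMod b d) :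
    InvertibleMod (a * b) d := by
  obtain ⟨u, w, h⟩ := ha
  obtain ⟨u', w', h'⟩ := hb
  exact ⟨u * u', w * w' * d + w + w', by linear_combination (u' * b) * h + (w * d + 1) * h'⟩

theorem exists_add_mul {a e : N} (ha : InvertibleMod a (e + 1)) (n x : N) :
    ∃ z q, n + a * z = q * (e + 1) + x := by
  obtain ⟨u, w, h⟩ := ha
  exact ⟨u * (x + n * e), n + w * (x + n * e), by linear_combination (x + n * e) * h⟩

end InvertibleMod

theorem invertibleMod_modulus {m j t : N} (hm : 0 < m) (h : t + 1 ∣ m) :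
    InvertibleMod (modulus m j) (modulus m (j + t + 1)) := by
  obtain ⟨s, hs⟩ := h
  obtain ⟨X, hX⟩ : ∃ X, X = m * (j + t + 2) := ⟨_, rfl⟩
  have hd : modulus m (j + t + 1) = X + 1 := by rw [hX, modulus]; ring
  have hX_pos : 1 ≤ X := hX ▸ one_le_mul (Order.one_le_iff_pos.2 hm)
    (one_le_two.trans le_add_self)
  obtain ⟨Y, hY⟩ := exists_add_of_le hX_pos
  have square : X * X = Y * (X + 1) + 1 := by linear_combination (X + 1) * hY
  have product : (j + t + 2) * modulus m j = (t + 1) + (j + 1) * (X + 1) := by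
    rw [hX, modulus]
    ring
  rw [hd]
  exact ⟨X * s * (j + t + 2) * (j + t + 2), Y + X * s * (j + t + 2) * (j + 1), by
    linear_combination X * s * (j + t + 2) * product + X * (j + t + 2) * hs.symm + X * hX.symm +
      square⟩

variable [Nonempty S]

instance SigmaDef.dvd (f g : (ℕ → N) → N) [TermDef f] [TermDef g] :
    SigmaDef S fun v => f v ∣ g v := by
  have : SigmaDef S fun v : ℕ → N => ∃ s, v 1 = v 0 * s := inferInstance
  exact this.comp fun v => scons (f v) fun _ => g v

instance SigmaDef.invertibleMod (f g : (ℕ → N) → N) [TermDef f] [TermDef g] :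
    SigmaDef S fun v => InvertibleMod (f v) (g v) := by
  have : SigmaDef S fun v : ℕ → N => ∃ u w, u * v 0 = w * v 1 + 1 := inferInstance
  exact this.comp fun v => scons (f v) fun _ => g v

variable [RCAModel N S]

variable (S)
include S

theorem exists_common_multiple (n : N) : ∃ m : N, 0 < m ∧ ∀ t, t < n → t + 1 ∣ m := by
  refine RCAModel.induction S (P := fun n => ∃ m, 0 < m ∧ ∀ t, t < n → t + 1 ∣ m)
    inferInstance ⟨1, zero_lt_one, by simp⟩ ?_ n
  rintro n ⟨m, hm, h⟩
  refine ⟨m * (n + 1), by positivity, fun t ht => ?_⟩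
  rcases (Order.lt_add_one_iff.1 ht).lt_or_eq with ht | rfl
  · exact (h t ht).mul_right _
  · exact dvd_mul_left _ _

theorem exists_partial_product {l m : N} (hm : 0 < m) (hdvd : ∀ t, t < l → t + 1 ∣ m) (j : N) :
    ∃ a, (∀ i, i < j → modulus m i ∣ a) ∧
      ∀ k, k < l → j ≤ k → InvertibleMod a (modulus m k) := by
  refine RCAModel.induction S (P := fun j => ∃ a, (∀ i, i < j → modulus m i ∣ a) ∧
      ∀ k, k < l → j ≤ k → InvertibleMod a (modulus m k)) inferInstance
    ⟨1, by simp, fun k _ _ => ⟨1, 0, by simp⟩⟩ ?_ j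
  rintro j ⟨a, ha, hinv⟩
  refine ⟨a * modulus m j, fun i hi => ?_, fun k hk hjk => ?_⟩
  · rcases (Order.lt_add_one_iff.1 hi).lt_or_eq with hi | rfl
    · exact (ha i hi).mul_right _
    · exact dvd_mul_left _ _
  · refine (hinv k hk (Order.add_one_le_iff.1 hjk).le).mul ?_
    obtain ⟨t, rfl⟩ := exists_add_of_le hjk
    have := invertibleMod_modulus (j := j) hm (hdvd t (lt_of_le_of_lt le_add_self hk))
    rwa [add_right_comm] at this

theorem exists_simultaneous_remainders {R : N → N → Prop} (hR : SigmaDef S fun v => R (v 0) (v 1))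
    {l m : N} (hm : 0 < m) (hdvd : ∀ t, t < l → t + 1 ∣ m) (h : ∀ i < l, ∃ x ≤ m, R i x) :
    ∃ n, ∀ i < l, ∃ x, IsRemainder n (modulus m i) x ∧ R i x := by
  have (i j : ℕ) : SigmaDef S fun v => R (v i) (v j) := hR.comp fun v => scons (v i) fun _ => v j
  refine RCAModel.induction_le S
    (P := fun j => ∃ n, ∀ i, i < j → ∃ x, IsRemainder n (modulus m i) x ∧ R i x) inferInstance l
    ⟨0, by simp⟩ ?_
  rintro j hj ⟨n, hn⟩
  obtain ⟨x, hxm, hx⟩ := h j hj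
  obtain ⟨a, ha, hinv⟩ := exists_partial_product S hm hdvd j
  obtain ⟨z, q, hz⟩ := (hinv j hj le_rfl).exists_add_mul n x
  refine ⟨n + a * z, fun i hi => ?_⟩
  rcases (Order.lt_add_one_iff.1 hi).lt_or_eq with hi | rfl
  · obtain ⟨y, ⟨hlt, q', rfl⟩, hy⟩ := hn i hi
    obtain ⟨b, rfl⟩ := ha i hi
    exact ⟨y, ⟨hlt, q' + b * z, by ring⟩, hy⟩
  · exact ⟨x, ⟨Order.lt_add_one_iff.2 (hxm.trans (le_mul_of_one_le_right' le_add_self)), q, hz⟩, hx⟩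

theorem HasLength.exists_hasEntry {c l : N} (h : HasLength c l) {i : N} (hi : i < l) :
    ∃ x, HasEntry c i x := by
  obtain ⟨m, n, rfl⟩ := h
  obtain ⟨x, hx⟩ := exists_isRemainder S n (modulus_pos m i)
  exact ⟨x, l, m, n, rfl, hi, hx⟩

theorem HasLength.exists_isSeq {c l : N} (h : HasLength c l) : ∃ d, IsSeq d ∧ SameSeq c d := by
  obtain ⟨d, hd, hmin⟩ := RCAModel.exists_least S (P := fun d => SameSeq c d) inferInstance
    (SameSeq.refl c)
  exact ⟨d, ⟨⟨l, (hd.1 l).1 h⟩, fun e he h => hmin e he (hd.trans h)⟩, hd⟩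

theorem exists_seq {R : N → N → Prop} (hR : SigmaDef S fun v => R (v 0) (v 1)) (l : N)
    (h : ∀ i < l, ∃ x, R i x) :
    ∃ c, IsSeq c ∧ HasLength c l ∧ ∀ i < l, ∃ x, HasEntry c i x ∧ R i x := by
  obtain ⟨b, hb⟩ := RCAModel.collection S hR l h
  obtain ⟨m, hm, hdvd⟩ := exists_common_multiple S l
  have hbm : b ≤ m * (b + 1) :=
    le_self_add.trans (le_mul_of_one_le_left' (Order.one_le_iff_pos.2 hm))
  obtain ⟨n, hn⟩ := exists_simultaneous_remainders S hR (m := m * (b + 1)) (by positivity)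
    (fun t ht => (hdvd t ht).mul_right _) fun i hi => by
      obtain ⟨x, hxb, hx⟩ := hb i hi
      exact ⟨x, hxb.le.trans hbm, hx⟩
  have hlen : HasLength (numPair l (numPair (m * (b + 1)) n)) l := ⟨_, _, rfl⟩
  obtain ⟨c, hc, hlen', hent⟩ := hlen.exists_isSeq S
  refine ⟨c, hc, (hlen' l).1 hlen, fun i hi => ?_⟩
  obtain ⟨x, hrem, hx⟩ := hn i hi
  exact ⟨x, (hent i x).1 ⟨l, _, n, rfl, hi, hrem⟩, hx⟩

end Existence

end Sequences

/-! ### The order `ω(ω)` in a model -/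

section Sat

/-- `c` is the code of a non-increasing sequence. -/
def InOmegaPow {N : Type*} [CommSemiring N] [LinearOrder N] (c : N) : Prop :=
  IsSeq c ∧ ∀ i x y, HasEntry c i x → HasEntry c (i + 1) y → y ≤ x

/-- The lexicographic comparison of the sequences with codes `c` and `d`, in the form in which the
formula `lexLe` states it. -/
def LexLe {N : Type*} [CommSemiring N] [LinearOrder N] (c d : N) : Prop :=
  ((∃ l l', HasLength c l ∧ HasLength d l' ∧ l ≤ l') ∧ ∀ i x, HasEntry c i x → HasEntry d i x) ∨
    ∃ j x y, HasEntry c j x ∧ HasEntry d j y ∧ x < y ∧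
      ∀ i z, i < j → (HasEntry c i z ↔ HasEntry d i z)

variable {N S : Type*} [CommSemiring N] [LinearOrder N] [Membership N S]

variable (N) in
/-- The set `X` is the usual order on the numbers. -/
def IsOmega (X : S) : Prop := ∀ z : N, z ∈ X ↔ ∃ x y : N, z = numPair x y ∧ x ≤ y

variable (N) in
/-- The set `Y` is the order `ω(ω)`. -/
def IsOmegaPow (Y : S) : Prop :=
  ∀ z : N, z ∈ Y ↔ ∃ c d, z = numPair c d ∧ InOmegaPow c ∧ InOmegaPow d ∧ LexLe c d

section

variable (v : ℕ → N) (s : ℕ → S)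

@[simp] theorem sat_le (a b : Tm) : (Fm.le a b).Sat v s ↔ a.val v ≤ b.val v := by
  simp only [Fm.le, sat_or, sat_lt, sat_eq, le_iff_lt_or_eq]

@[simp] theorem sat_hasLength (c l : Tm) :
    (hasLength c l).Sat v s ↔ HasLength (c.val v) (l.val v) := by
  simp [hasLength, HasLength, val_pair]

@[simp] theorem sat_hasEntry (c i x : Tm) :
    (hasEntry c i x).Sat v s ↔ HasEntry (c.val v) (i.val v) (x.val v) := by
  simp [hasEntry, HasEntry, IsRemainder, modulus, val_pair]

@[simp] theorem sat_sameSeq (c d : Tm) :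
    (sameSeq c d).Sat v s ↔ SameSeq (c.val v) (d.val v) := by
  simp [sameSeq, SameSeq]

@[simp] theorem sat_isSeq (c : Tm) : (isSeq c).Sat v s ↔ IsSeq (c.val v) := by
  simp [isSeq, IsSeq]

@[simp] theorem sat_inField (X : ℕ) (t : Tm) :
    (inField X t).Sat v s ↔ numPair (t.val v) (t.val v) ∈ s X := Iff.rfl

@[simp] theorem sat_leIn (X : ℕ) (a b : Tm) :
    (leIn X a b).Sat v s ↔ numPair (a.val v) (b.val v) ∈ s X := Iff.rfl

@[simp] theorem sat_ltIn (X : ℕ) (a b : Tm) :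
    (ltIn X a b).Sat v s ↔ numPair (a.val v) (b.val v) ∈ s X ∧ a.val v ≠ b.val v := by
  simp [ltIn]

theorem sat_isOmega (X : ℕ) : (isOmega X).Sat v s ↔ IsOmega N (s X) := by
  simp [isOmega, IsOmega, val_pair]

end

variable [IsStrictOrderedRing N] [CanonicallyOrderedAdd N] [SuccAddOrder N]

theorem IsOmega.numPair_mem_iff {X : S} (hX : IsOmega N X) (x y : N) :
    numPair x y ∈ X ↔ x ≤ y := by
  rw [hX]
  refine ⟨?_, fun h => ⟨x, y, rfl, h⟩⟩
  rintro ⟨x', y', h, hle⟩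
  obtain ⟨rfl, rfl⟩ := numPair_inj.1 h
  exact hle

variable (v : ℕ → N) (s : ℕ → S)

theorem sat_inOmegaPow {X : ℕ} (hX : IsOmega N (s X)) (c : Tm) :
    (inOmegaPow X c).Sat v s ↔ InOmegaPow (c.val v) := by
  simp [inOmegaPow, InOmegaPow, hX.numPair_mem_iff]

theorem sat_lexLe {X : ℕ} (hX : IsOmega N (s X)) (c d : Tm) :
    (lexLe X c d).Sat v s ↔ LexLe (c.val v) (d.val v) := by
  simp [lexLe, LexLe, hX.numPair_mem_iff, lt_iff_le_and_ne]

theorem sat_isOmegaPow {X Y : ℕ} (hX : IsOmega N (s X)) :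
    (isOmegaPow X Y).Sat v s ↔ IsOmegaPow N (s Y) := by
  simp [isOmegaPow, IsOmegaPow, sat_inOmegaPow _ _ hX, sat_lexLe _ _ hX, val_pair]

end Sat

/-! ### Sequences as functions, ordered lexicographically -/

section Entries

variable {N S : Type*} [CommSemiring N] [LinearOrder N]

open Classical in
/-- The successor of the `i`-th entry of the sequence with code `c`, or `0` if there is none. -/
noncomputable def entrySucc (c i : N) : N := if h : ∃ x, HasEntry c i x then h.choose + 1 else 0

/-- The sequence with code `c` as a function, where missing entries count as smaller than all
numbers: then Mathlib's lexicographic order of functions is that of `ω(ω)`. -/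
noncomputable def entries (c : N) : Lex (N → N) := toLex (entrySucc c)

theorem entrySucc_eq_zero {c i : N} (h : ∀ x, ¬ HasEntry c i x) : entrySucc c i = 0 :=
  dif_neg fun ⟨x, hx⟩ => h x hx

variable [IsStrictOrderedRing N] [CanonicallyOrderedAdd N] [SuccAddOrder N]

theorem HasEntry.entrySucc_eq {c i x : N} (h : HasEntry c i x) : entrySucc c i = x + 1 := by
  have h' : ∃ x, HasEntry c i x := ⟨x, h⟩
  rw [entrySucc, dif_pos h', h'.choose_spec.unique h]

omit [IsStrictOrderedRing N] [CanonicallyOrderedAdd N] [SuccAddOrder N] in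
theorem exists_hasEntry_of_entrySucc_pos {c i : N} (h : 0 < entrySucc c i) :
    ∃ x, HasEntry c i x := by
  by_contra! h'
  exact h.ne' (entrySucc_eq_zero h')

theorem entrySucc_eq_add_one_iff {c i x : N} : entrySucc c i = x + 1 ↔ HasEntry c i x := by
  refine ⟨fun h => ?_, HasEntry.entrySucc_eq⟩
  obtain ⟨y, hy⟩ := exists_hasEntry_of_entrySucc_pos (h ▸ (Order.lt_add_one_iff.2 zero_le))
  rwa [← add_right_cancel (hy.entrySucc_eq.symm.trans h)]

theorem entrySucc_eq_iff {c d i j : N} :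
    entrySucc c i = entrySucc d j ↔ ∀ x, HasEntry c i x ↔ HasEntry d j x := by
  refine ⟨fun h x => by rw [← entrySucc_eq_add_one_iff, h, entrySucc_eq_add_one_iff],
    fun h => ?_⟩
  by_cases hc : ∃ x, HasEntry c i x
  · obtain ⟨x, hx⟩ := hc
    rw [hx.entrySucc_eq, ((h x).1 hx).entrySucc_eq]
  · push Not at hc
    rw [entrySucc_eq_zero hc, entrySucc_eq_zero fun x hx => hc x ((h x).2 hx)]

theorem HasLength.entrySucc_eq_zero {c l i : N} (h : HasLength c l) (hi : l ≤ i) :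
    entrySucc c i = 0 :=
  SOA.entrySucc_eq_zero fun _ hx => hi.not_gt (hx.lt_length h)

theorem HasLength.lt_of_entrySucc_ne_zero {c l i : N} (h : HasLength c l)
    (hi : entrySucc c i ≠ 0) : i < l :=
  not_le.1 fun hle => hi (h.entrySucc_eq_zero hle)

variable [Membership N S] [Nonempty S]

instance BoundedDef.entrySucc_eq (f g k l : (ℕ → N) → N) [TermDef f] [TermDef g] [TermDef k]
    [TermDef l] : BoundedDef S fun v => entrySucc (f v) (g v) = entrySucc (k v) (l v) := by
  have : BoundedDef S fun v : ℕ → N => entrySucc (v 0) (v 1) = entrySucc (v 2) (v 3) := by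
    refine (inferInstance : BoundedDef S fun v => ∀ x, x ≤ v 0 + v 2 →
      (HasEntry (v 0) (v 1) x ↔ HasEntry (v 2) (v 3) x)).congr fun v => ?_
    refine entrySucc_eq_iff.trans ⟨fun h x _ => h x, fun h x => ⟨fun hx => ?_, fun hx => ?_⟩⟩
    · exact (h x (hx.entry_le.trans le_self_add)).1 hx
    · exact (h x (hx.entry_le.trans le_add_self)).2 hx
  exact this.comp fun v => scons (f v) (scons (g v) (scons (k v) fun _ => l v))

instance BoundedDef.inOmegaPow (f : (ℕ → N) → N) [TermDef f] :
    BoundedDef S fun v => InOmegaPow (f v) := by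
  have : BoundedDef S fun v : ℕ → N => InOmegaPow (v 0) :=
    (inferInstance : BoundedDef S fun v => IsSeq (v 0) ∧
      ∀ i, i ≤ v 0 → ∀ x, x ≤ v 0 → ∀ y, y ≤ v 0 → HasEntry (v 0) i x →
        HasEntry (v 0) (i + 1) y → y ≤ x).congr fun v =>
      and_congr_right fun _ => ⟨fun h i _ x _ y _ => h i x y, fun h i x y hx hy =>
        h i hx.index_le x hx.entry_le y hy.entry_le hx hy⟩
  exact this.comp fun v _ => f v

instance BoundedDef.lexLe (f g : (ℕ → N) → N) [TermDef f] [TermDef g] :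
    BoundedDef S fun v => LexLe (f v) (g v) := by
  have : BoundedDef S fun v : ℕ → N => LexLe (v 0) (v 1) := by
    refine (inferInstance : BoundedDef S fun v =>
      ((∃ l, l ≤ v 0 ∧ ∃ l', l' ≤ v 1 ∧ (HasLength (v 0) l ∧ HasLength (v 1) l' ∧ l ≤ l')) ∧
        ∀ i, i ≤ v 0 → ∀ x, x ≤ v 0 → HasEntry (v 0) i x → HasEntry (v 1) i x) ∨
      ∃ j, j ≤ v 0 ∧ ∃ x, x ≤ v 0 ∧ ∃ y, y ≤ v 1 ∧ (HasEntry (v 0) j x ∧ HasEntry (v 1) j y ∧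
        x < y ∧ ∀ i, i < j → entrySucc (v 0) i = entrySucc (v 1) i)).congr fun v => ?_
    refine or_congr (and_congr ⟨?_, ?_⟩ ⟨fun h i _ x _ => h i x, fun h i x hx =>
      h i hx.index_le x hx.entry_le hx⟩) ⟨?_, ?_⟩
    · rintro ⟨l, l', h, h', hl⟩
      exact ⟨l, h.le, l', h'.le, h, h', hl⟩
    · rintro ⟨l, -, l', -, h⟩
      exact ⟨l, l', h⟩
    · rintro ⟨j, x, y, hx, hy, hxy, h⟩
      exact ⟨j, hx.index_le, x, hx.entry_le, y, hy.entry_le, hx, hy, hxy,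
        fun i hi => entrySucc_eq_iff.2 fun z => h i z hi⟩
    · rintro ⟨j, -, x, -, y, -, hx, hy, hxy, h⟩
      exact ⟨j, x, y, hx, hy, hxy, fun i z hi => entrySucc_eq_iff.1 (h i hi) z⟩
  exact this.comp fun v => scons (f v) fun _ => g v

variable [RCAModel N S]

section

variable (N S)

theorem exists_isOmega : ∃ X : S, IsOmega N X := by
  refine RCAModel.comprehension S (P := fun z => ∃ x y : N, z = numPair x y ∧ x ≤ y)
    ((inferInstance : BoundedDef S fun v => ∃ x, x ≤ v 0 ∧ ∃ y, y ≤ v 0 ∧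
      (v 0 = numPair x y ∧ x ≤ y)).congr fun v => ⟨?_, ?_⟩)
  · rintro ⟨x, y, h, hxy⟩
    exact ⟨x, h ▸ le_numPair_left _ _, y, h ▸ le_numPair_right _ _, h, hxy⟩
  · rintro ⟨x, -, y, -, h⟩
    exact ⟨x, y, h⟩

theorem exists_isOmegaPow : ∃ Y : S, IsOmegaPow N Y := by
  refine RCAModel.comprehension S
    (P := fun z => ∃ x y : N, z = numPair x y ∧ InOmegaPow x ∧ InOmegaPow y ∧ LexLe x y)
    ((inferInstance : BoundedDef S fun v => ∃ x, x ≤ v 0 ∧ ∃ y, y ≤ v 0 ∧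
      (v 0 = numPair x y ∧ InOmegaPow x ∧ InOmegaPow y ∧ LexLe x y)).congr fun v => ⟨?_, ?_⟩)
  · rintro ⟨x, y, h, hxy⟩
    exact ⟨x, h ▸ le_numPair_left _ _, y, h ▸ le_numPair_right _ _, h, hxy⟩
  · rintro ⟨x, -, y, -, h⟩
    exact ⟨x, y, h⟩

end

variable (S)
include S

theorem HasLength.entrySucc_pos {c l i : N} (h : HasLength c l) (hi : i < l) :
    0 < entrySucc c i := by
  obtain ⟨x, hx⟩ := h.exists_hasEntry S hi
  exact hx.entrySucc_eq ▸ Order.lt_add_one_iff.2 zero_le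

theorem HasLength.le_of_entrySucc_eq {c d l l' : N} (hc : HasLength c l) (hd : HasLength d l')
    (h : ∀ i, entrySucc c i = entrySucc d i) : l ≤ l' := by
  by_contra! hlt
  exact (hc.entrySucc_pos S hlt).ne' ((h l').trans (hd.entrySucc_eq_zero le_rfl))

theorem IsSeq.entries_inj {c d : N} (hc : IsSeq c) (hd : IsSeq d) :
    entries c = entries d ↔ c = d := by
  refine ⟨fun h => ?_, congrArg entries⟩
  replace h (i : N) : entrySucc c i = entrySucc d i := congrFun (toLex_inj.1 h) i
  refine hc.eq_of_sameSeq hd ⟨fun l => ?_, fun i => entrySucc_eq_iff.1 (h i)⟩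
  obtain ⟨k, hk⟩ := hc.1
  obtain ⟨k', hk'⟩ := hd.1
  obtain rfl : k = k' := le_antisymm (hk.le_of_entrySucc_eq S hk' h)
    (hk'.le_of_entrySucc_eq S hk fun i => (h i).symm)
  exact ⟨fun hl => hl.unique hk ▸ hk', fun hl => hl.unique hk' ▸ hk⟩

theorem entries_lt_or_lt_of_ne {c d : N} (h : entries c ≠ entries d) :
    entries c < entries d ∨ entries d < entries c := by
  obtain ⟨i, hi⟩ : ∃ i, ¬ entrySucc c i = entrySucc d i := by
    by_contra! h'
    exact h (congrArg toLex (funext h'))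
  obtain ⟨j, hj, hlt⟩ := RCAModel.exists_least S
    (P := fun i => ¬ entrySucc c i = entrySucc d i) inferInstance hi
  simp only [not_not] at hlt
  exact (lt_or_gt_of_ne hj).imp (fun h => ⟨j, hlt, h⟩) fun h => ⟨j, fun i hi => (hlt i hi).symm, h⟩

theorem not_entries_le_iff {c d : N} : ¬ entries c ≤ entries d ↔ entries d < entries c := by
  refine ⟨fun h => ?_, fun h => h.not_ge⟩
  exact (entries_lt_or_lt_of_ne S fun he => h he.le).resolve_left fun h' => h h'.le

theorem LexLe.entries_le {c d : N} (h : LexLe c d) : entries c ≤ entries d := by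
  rcases h with ⟨⟨l, l', hl, hl', hle⟩, h⟩ | ⟨j, x, y, hx, hy, hxy, h⟩
  · have agree : ∀ i < l, entrySucc c i = entrySucc d i := fun i hi => by
      obtain ⟨x, hx⟩ := hl.exists_hasEntry S hi
      rw [hx.entrySucc_eq, (h i x hx).entrySucc_eq]
    rcases hle.lt_or_eq with hlt | rfl
    · refine le_of_lt ⟨l, agree, ?_⟩
      exact (hl.entrySucc_eq_zero le_rfl).trans_lt (hl'.entrySucc_pos S hlt)
    · refine le_of_eq (congrArg toLex (funext fun i => ?_))
      rcases lt_or_ge i l with hi | hi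
      · exact agree i hi
      · rw [hl.entrySucc_eq_zero hi, hl'.entrySucc_eq_zero hi]
  · refine le_of_lt ⟨j, fun i hi => entrySucc_eq_iff.2 fun z => h i z hi, ?_⟩
    calc entrySucc c j = x + 1 := hx.entrySucc_eq
      _ < y + 1 := add_lt_add_left hxy 1
      _ = entrySucc d j := hy.entrySucc_eq.symm

theorem lexLe_iff {c d : N} (hc : IsSeq c) (hd : IsSeq d) :
    LexLe c d ↔ entries c ≤ entries d := by
  refine ⟨LexLe.entries_le S, fun h => ?_⟩
  obtain ⟨l, hl⟩ := hc.1
  obtain ⟨l', hl'⟩ := hd.1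
  rcases h.eq_or_lt with h | ⟨j, h, hj⟩
  · obtain rfl := (hc.entries_inj S hd).1 h
    exact .inl ⟨⟨l, l, hl, hl, le_rfl⟩, fun _ _ h => h⟩
  · obtain ⟨y, hy⟩ := exists_hasEntry_of_entrySucc_pos (pos_of_gt hj)
    rcases (zero_le (a := entrySucc c j)).eq_or_lt with h0 | h0
    · have hlj : l ≤ j := not_lt.1 fun hlt => (hl.entrySucc_pos S hlt).ne h0
      refine .inl ⟨⟨l, l', hl, hl', hlj.trans (hy.lt_length hl').le⟩, fun i x hx => ?_⟩
      exact (entrySucc_eq_iff.1 (h i ((hx.lt_length hl).trans_le hlj)) x).1 hx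
    · obtain ⟨x, hx⟩ := exists_hasEntry_of_entrySucc_pos h0
      replace hj : x + 1 < y + 1 := by rwa [← hx.entrySucc_eq, ← hy.entrySucc_eq]
      exact .inr ⟨j, x, y, hx, hy, lt_of_add_lt_add_right hj,
        fun i z hi => entrySucc_eq_iff.1 (h i hi) z⟩

theorem inOmegaPow_iff {c : N} :
    InOmegaPow c ↔ IsSeq c ∧ ∀ i, entrySucc c (i + 1) ≤ entrySucc c i := by
  refine and_congr_right fun _ => ⟨fun h i => ?_, fun h i x y hx hy => ?_⟩
  · rcases (zero_le (a := entrySucc c (i + 1))).eq_or_lt with h0 | h0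
    · exact h0 ▸ zero_le
    · obtain ⟨y, hy⟩ := exists_hasEntry_of_entrySucc_pos h0
      obtain ⟨l, hl, hil⟩ := hy.exists_length
      obtain ⟨x, hx⟩ := hl.exists_hasEntry S ((Order.lt_add_one_iff.2 le_rfl).trans hil)
      rw [hx.entrySucc_eq, hy.entrySucc_eq]
      exact add_le_add_left (h i x y hx hy) 1
  · refine le_of_add_le_add_right (a := 1) ?_
    rw [← hx.entrySucc_eq, ← hy.entrySucc_eq]
    exact h i

end Entries

section OmegaPow

variable {N S : Type*} [CommSemiring N] [LinearOrder N] [IsStrictOrderedRing N]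
  [CanonicallyOrderedAdd N] [SuccAddOrder N] [Membership N S] [Nonempty S] [RCAModel N S]

namespace IsOmegaPow

variable {Y : S}

theorem mem_iff (hY : IsOmegaPow N Y) {x y : N} :
    numPair x y ∈ Y ↔ InOmegaPow x ∧ InOmegaPow y ∧ entries x ≤ entries y := by
  rw [hY]
  constructor
  · rintro ⟨x', y', h, hx, hy, hle⟩
    obtain ⟨rfl, rfl⟩ := numPair_inj.1 h
    exact ⟨hx, hy, (lexLe_iff S hx.1 hy.1).1 hle⟩
  · rintro ⟨hx, hy, hle⟩
    exact ⟨x, y, rfl, hx, hy, (lexLe_iff S hx.1 hy.1).2 hle⟩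

theorem mem_diag_iff (hY : IsOmegaPow N Y) {x : N} : numPair x x ∈ Y ↔ InOmegaPow x := by
  rw [hY.mem_iff]
  exact ⟨fun h => h.1, fun h => ⟨h, h, le_rfl⟩⟩

theorem mem_and_ne_iff (hY : IsOmegaPow N Y) {x y : N} :
    numPair x y ∈ Y ∧ x ≠ y ↔ InOmegaPow x ∧ InOmegaPow y ∧ entries x < entries y := by
  rw [hY.mem_iff, and_assoc, and_assoc]
  refine and_congr_right fun hx => and_congr_right fun hy => ?_
  exact (and_congr_right' (hx.1.entries_inj S hy.1).not.symm).trans lt_iff_le_and_ne.symm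

theorem not_mem_iff (hY : IsOmegaPow N Y) {x y : N} (hx : InOmegaPow x) (hy : InOmegaPow y) :
    numPair x y ∉ Y ↔ entries y < entries x := by
  simp only [hY.mem_iff, hx, hy, true_and, not_entries_le_iff S]

theorem sat_isLinearOrder {X : ℕ} {s : ℕ → S} (hY : IsOmegaPow N (s X)) (v : ℕ → N) :
    (isLinearOrder X).Sat v s := by
  simp only [isLinearOrder, sat_and, sat_allN, sat_exN, sat_imp, sat_or, sat_eq, sat_mem, sat_leIn,
    sat_inField, val_pair, Tm.val_var, scons_zero, scons_one, scons_two, hY.mem_iff]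
  refine ⟨fun z hz => ?_, ?_, ?_, ?_, ?_⟩
  · obtain ⟨x, y, h, -⟩ := (hY z).1 hz
    exact ⟨x, y, h⟩
  · rintro x y ⟨hx, hy, -⟩
    exact ⟨⟨hx, hx, le_rfl⟩, hy, hy, le_rfl⟩
  · rintro x y z ⟨⟨hx, -, hxy⟩, -, hz, hyz⟩
    exact ⟨hx, hz, hxy.trans hyz⟩
  · rintro x y ⟨⟨hx, hy, hxy⟩, -, -, hyx⟩
    exact (hx.1.entries_inj S hy.1).1 (hxy.antisymm hyx)
  · rintro x y ⟨⟨hx, -⟩, hy, -⟩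
    by_contra! h
    exact ((not_entries_le_iff S).1 (h.1 hx hy)).asymm ((not_entries_le_iff S).1 (h.2 hy hx))

end IsOmegaPow

end OmegaPow

/-! ### Prefixes and padding -/

section Prefix

variable {N S : Type*} [CommSemiring N] [LinearOrder N] [IsStrictOrderedRing N]
  [CanonicallyOrderedAdd N] [SuccAddOrder N]

/-- `s` is the code of the sequence that consists of the first `j` entries of `w`. -/
def IsPrefix {N : Type*} [CommSemiring N] [LinearOrder N] (w j s : N) : Prop :=
  IsSeq s ∧ HasLength s j ∧ ∀ i, i < j → entrySucc s i = entrySucc w i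

/-- `w` is the code of the sequence that consists of the first `l` entries of `s` and of `m` copies
of `e`. -/
structure IsPadded {N : Type*} [CommSemiring N] [LinearOrder N] (s l e m w : N) : Prop where
  isSeq : IsSeq w
  hasLength : HasLength w (l + m)
  entrySucc_eq : ∀ i < l, entrySucc w i = entrySucc s i
  entrySucc_eq_add_one : ∀ i, l ≤ i → i < l + m → entrySucc w i = e + 1

instance BoundedDef.isPrefix [Membership N S] [Nonempty S] (f g k : (ℕ → N) → N)
    [TermDef f] [TermDef g] [TermDef k] : BoundedDef S fun v => IsPrefix (f v) (g v) (k v) := by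
  have : BoundedDef S fun v : ℕ → N => IsPrefix (v 0) (v 1) (v 2) :=
    (inferInstance : BoundedDef S fun v => IsSeq (v 2) ∧ HasLength (v 2) (v 1) ∧
      ∀ i, i < v 1 → entrySucc (v 2) i = entrySucc (v 0) i)
  exact this.comp fun v => scons (f v) (scons (g v) fun _ => k v)

namespace IsPrefix

omit [IsStrictOrderedRing N] [CanonicallyOrderedAdd N] [SuccAddOrder N] in
theorem refl {w n : N} (h : IsSeq w) (hn : HasLength w n) : IsPrefix w n w :=
  ⟨h, hn, fun _ _ => rfl⟩

omit [IsStrictOrderedRing N] [CanonicallyOrderedAdd N] [SuccAddOrder N] in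
theorem of_isPrefix {w j k s p : N} (hs : IsPrefix w j s) (hp : IsPrefix w k p) (hk : k ≤ j) :
    IsPrefix s k p :=
  ⟨hp.1, hp.2.1, fun i hi => by rw [hp.2.2 i hi, hs.2.2 i (hi.trans_le hk)]⟩

variable [Membership N S] [Nonempty S] [RCAModel N S]

variable (S)
include S

theorem exists_of_le {w n j : N} (hw : HasLength w n) (hj : j ≤ n) : ∃ s, IsPrefix w j s := by
  obtain ⟨s, hs, hl, h⟩ := exists_seq S (R := fun i x => HasEntry w i x) inferInstance j
    fun i hi => hw.exists_hasEntry S (hi.trans_le hj)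
  refine ⟨s, hs, hl, fun i hi => ?_⟩
  obtain ⟨x, hx, hx'⟩ := h i hi
  rw [hx.entrySucc_eq, hx'.entrySucc_eq]

theorem unique {w j s s' : N} (h : IsPrefix w j s) (h' : IsPrefix w j s') : s = s' := by
  refine (h.1.entries_inj S h'.1).1 (congrArg toLex (funext fun i => ?_))
  rcases lt_or_ge i j with hi | hi
  · rw [h.2.2 i hi, h'.2.2 i hi]
  · rw [h.2.1.entrySucc_eq_zero hi, h'.2.1.entrySucc_eq_zero hi]

theorem inOmegaPow {w j s : N} (h : IsPrefix w j s) (hw : InOmegaPow w) : InOmegaPow s := by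
  rw [inOmegaPow_iff S] at *
  refine ⟨h.1, fun i => ?_⟩
  rcases lt_or_ge (i + 1) j with hi | hi
  · rw [h.2.2 _ hi, h.2.2 _ ((Order.lt_add_one_iff.2 le_rfl).trans hi)]
    exact hw.2 i
  · exact (h.2.1.entrySucc_eq_zero hi).trans_le zero_le

theorem entries_lt {w n j s : N} (h : IsPrefix w j s) (hn : HasLength w n) (hj : j < n) :
    entries s < entries w :=
  ⟨j, h.2.2, (h.2.1.entrySucc_eq_zero le_rfl).trans_lt (hn.entrySucc_pos S hj)⟩

/-- There is nothing strictly between `p` and `p * ⟨0⟩`. -/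
theorem entries_le_of_lt {p s t l : N} (hp : IsPrefix s l p) (hs : HasLength s (l + 1))
    (hsl : entrySucc s l = 1) (ht : IsSeq t) (h : entries t < entries s) :
    entries t ≤ entries p := by
  obtain ⟨k, hk, hlt⟩ := h
  change entrySucc t k < entrySucc s k at hlt
  rcases (Order.lt_add_one_iff.1 (hs.lt_of_entrySucc_ne_zero (pos_of_gt hlt).ne')).lt_or_eq
    with hkl | rfl
  · exact le_of_lt ⟨k, fun i hi => (hk i hi).trans (hp.2.2 i (hi.trans hkl)).symm,
      hlt.trans_eq (hp.2.2 k hkl).symm⟩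
  · obtain ⟨n, hn⟩ := ht.1
    have hnk : n ≤ k := by
      by_contra! hlt'
      exact (hn.entrySucc_pos S hlt').ne' (Order.lt_one_iff.1 (hsl ▸ hlt))
    refine le_of_eq (congrArg toLex (funext fun i => ?_))
    rcases lt_or_ge i k with hi | hi
    · exact (hk i hi).trans (hp.2.2 i hi).symm
    · rw [hn.entrySucc_eq_zero (hnk.trans hi), hp.2.1.entrySucc_eq_zero hi]

end IsPrefix

namespace IsPadded

variable [Membership N S] [Nonempty S] [RCAModel N S]

variable (S)

include S in
theorem exists_of_le {s n l : N} (hs : HasLength s n) (hl : l ≤ n) (e m : N) :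
    ∃ w, IsPadded s l e m w := by
  obtain ⟨w, hw, hwl, h⟩ := exists_seq S
    (R := fun i x => i < l ∧ HasEntry s i x ∨ l ≤ i ∧ x = e) inferInstance (l + m) fun i _ => by
      rcases lt_or_ge i l with hi | hi
      · obtain ⟨x, hx⟩ := hs.exists_hasEntry S (hi.trans_le hl)
        exact ⟨x, .inl ⟨hi, hx⟩⟩
      · exact ⟨e, .inr ⟨hi, rfl⟩⟩
  refine ⟨w, hw, hwl, fun i hi => ?_, fun i hi hi' => ?_⟩
  · obtain ⟨x, hx, ⟨-, h⟩ | ⟨h, -⟩⟩ := h i (hi.trans_le le_self_add)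
    · rw [hx.entrySucc_eq, h.entrySucc_eq]
    · exact (h.not_gt hi).elim
  · obtain ⟨x, hx, ⟨h, -⟩ | ⟨-, rfl⟩⟩ := h i hi'
    · exact (hi.not_gt h).elim
    · exact hx.entrySucc_eq

variable {s l e m w : N}

omit [Membership N S] [Nonempty S] [RCAModel N S] in
theorem entrySucc_le (hw : IsPadded s l e m w) {i : N} (hi : l ≤ i) : entrySucc w i ≤ e + 1 := by
  rcases lt_or_ge i (l + m) with hm | hm
  · exact (hw.entrySucc_eq_add_one i hi hm).le
  · exact (hw.hasLength.entrySucc_eq_zero hm).trans_le zero_le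

omit [Membership N S] [Nonempty S] [RCAModel N S] in
theorem entries_lt (hw : IsPadded s l e m w) (hsl : entrySucc s l = e + 1 + 1) :
    entries w < entries s := by
  refine ⟨l, hw.entrySucc_eq, ?_⟩
  calc entrySucc w l ≤ e + 1 := hw.entrySucc_le le_rfl
    _ < e + 1 + 1 := Order.lt_add_one_iff.2 le_rfl
    _ = entrySucc s l := hsl.symm

include S

theorem inOmegaPow (hw : IsPadded s l e m w) (hs : InOmegaPow s)
    (hsl : entrySucc s l = e + 1 + 1) : InOmegaPow w := by
  refine (inOmegaPow_iff S).2 ⟨hw.isSeq, fun i => ?_⟩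
  have hsi := ((inOmegaPow_iff S).1 hs).2 i
  have hi_lt : i < i + 1 := Order.lt_add_one_iff.2 le_rfl
  rcases lt_trichotomy (i + 1) l with hil | rfl | hil
  · rw [hw.entrySucc_eq _ hil, hw.entrySucc_eq i (hi_lt.trans hil)]
    exact hsi
  · rw [hw.entrySucc_eq i hi_lt]
    exact (hw.entrySucc_le le_rfl).trans (le_self_add.trans (hsl.symm.trans_le hsi))
  · rcases lt_or_ge (i + 1) (l + m) with hm | hm
    · rw [hw.entrySucc_eq_add_one i (Order.lt_add_one_iff.1 hil) (hi_lt.trans hm)]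
      exact hw.entrySucc_le hil.le
    · exact (hw.hasLength.entrySucc_eq_zero hm).trans_le zero_le

theorem entries_lt_of_agree {y n : N} (hw : IsPadded s l e m w) (hy : InOmegaPow y)
    (hn : HasLength y n) (hnm : n < l + m) (agree : ∀ i < l, entrySucc y i = entrySucc s i)
    (hyl : entrySucc y l ≤ e + 1) : entries y < entries w := by
  have hne : entries y ≠ entries w := fun h =>
    hnm.ne (hn.unique ((hy.1.entries_inj S hw.isSeq).1 h ▸ hw.hasLength))
  rcases entries_lt_or_lt_of_ne S hne with h | ⟨j, hj, hlt⟩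
  · exact h
  · change entrySucc w j < entrySucc y j at hlt
    have hjm : j < l + m := (hn.lt_of_entrySucc_ne_zero (pos_of_gt hlt).ne').trans hnm
    refine absurd hlt (not_lt.2 ?_)
    rcases lt_trichotomy j l with hjl | rfl | hjl
    · rw [hw.entrySucc_eq j hjl, agree j hjl]
    · rwa [hw.entrySucc_eq_add_one j le_rfl hjm]
    · obtain ⟨i, rfl⟩ := exists_add_of_le (Order.one_le_iff_pos.2 (pos_of_gt hjl))
      rw [add_comm] at hjl hjm hj ⊢
      have hi : i < i + 1 := Order.lt_add_one_iff.2 le_rfl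
      calc entrySucc y (i + 1) ≤ entrySucc y i := ((inOmegaPow_iff S).1 hy).2 i
        _ = entrySucc w i := (hj i hi).symm
        _ = e + 1 := hw.entrySucc_eq_add_one i (Order.lt_add_one_iff.1 hjl) (hi.trans hjm)
        _ = entrySucc w (i + 1) := (hw.entrySucc_eq_add_one _ hjl.le hjm).symm

theorem entries_lt_of_lt {y n : N} (hw : IsPadded s l e m w) (hs : HasLength s (l + 1))
    (hsl : entrySucc s l = e + 1 + 1) (hy : InOmegaPow y) (hn : HasLength y n) (hnm : n < l + m)
    (h : entries y < entries s) : entries y < entries w := by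
  obtain ⟨k, hk, hlt⟩ := h
  change entrySucc y k < entrySucc s k at hlt
  rcases (Order.lt_add_one_iff.1 (hs.lt_of_entrySucc_ne_zero (pos_of_gt hlt).ne')).lt_or_eq
    with hkl | rfl
  · exact ⟨k, fun i hi => (hk i hi).trans (hw.entrySucc_eq i (hi.trans hkl)).symm,
      hlt.trans_eq (hw.entrySucc_eq k hkl).symm⟩
  · exact hw.entries_lt_of_agree S hy hn hnm hk (Order.lt_add_one_iff.1 (hsl ▸ hlt))

end IsPadded

end Prefix

/-! ### The order `ω(ω)` is a weak well order -/

section WeakWellOrder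

variable {N S : Type*} [CommSemiring N] [LinearOrder N] [Membership N S]

variable (N) in
/-- The sets `I`, `J`, `F` witness that `Y` is not a weak well order: `F` is an embedding of the
initial segment `I` into the initial segment `J ⊊ I`. -/
structure IsCollapse (Y I J F : S) : Prop where
  mem_diag : ∀ x : N, x ∈ I → numPair x x ∈ Y
  mem_of_lt : ∀ x y : N, x ∈ I → numPair y x ∈ Y → y ≠ x → y ∈ I
  mem_range_of_lt : ∀ x y : N, x ∈ J → numPair y x ∈ Y → y ≠ x → y ∈ J
  subset : ∀ x : N, x ∈ J → x ∈ I
  proper : ∃ x : N, x ∈ I ∧ x ∉ J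
  mapsTo : ∀ x y : N, numPair x y ∈ F → x ∈ I ∧ y ∈ J
  total : ∀ x : N, x ∈ I → ∃ y, numPair x y ∈ F
  unique : ∀ x y z : N, numPair x y ∈ F → numPair x z ∈ F → y = z
  strictMono : ∀ x y x' y' : N, numPair x y ∈ F → numPair x' y' ∈ F → numPair x x' ∈ Y → x ≠ x' →
    numPair y y' ∈ Y ∧ y ≠ y'

/-- The map `F` does not send `p` downwards in `Y`. -/
def Rises (Y F : S) (p : N) : Prop := ∃ y, numPair p y ∈ F ∧ numPair p y ∈ Y

/-- The map `F` sends `s` downwards in the linear order `Y`. -/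
def Drops (Y F : S) (s : N) : Prop := ∃ z, numPair s z ∈ F ∧ numPair s z ∉ Y

/-- The map `F` sends some `p * ⟨e⟩` downwards, but not `p`. -/
def DropsAt (Y I F : S) (e : N) : Prop :=
  ∃ s l p, s ∈ I ∧ HasLength s (l + 1) ∧ HasEntry s l e ∧ IsPrefix s l p ∧ Rises Y F p ∧ Drops Y F s

variable [IsStrictOrderedRing N] [CanonicallyOrderedAdd N] [SuccAddOrder N]

theorem sat_isWeakWellOrder {v : ℕ → N} {s : ℕ → S} {Y : ℕ} (hY : (isLinearOrder Y).Sat v s)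
    (h : ∀ I J F, ¬ IsCollapse N (s Y) I J F) : (isWeakWellOrder Y).Sat v s := by
  refine (sat_and _ _ _ _).2 ⟨hY, ?_⟩
  simp only [sat_neg, sat_exS]
  rintro ⟨I, J, F, hcollapse⟩
  simp only [isInitialSegment, isProperSubset, isEmbedding, isFunction, sat_and, sat_allN, sat_imp,
    sat_mem, scons_succ, scons_zero, Tm.val_var, sat_inField, sat_ltIn, ne_eq, and_imp, sat_exN,
    sat_neg, sat_eq, val_pair] at hcollapse
  obtain ⟨⟨mem_diag, lower⟩, ⟨-, lower'⟩, ⟨subset, proper⟩, ⟨maps, total, unique⟩, mono⟩ :=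
    hcollapse
  refine h I J F ⟨mem_diag, fun x y => lower y x, fun x y => lower' y x, subset, proper,
    fun x y hxy => ?_, total, unique, fun x y x' y' => mono x y x' y'⟩
  obtain ⟨x', y', hpair, hmem⟩ := maps _ hxy
  obtain ⟨rfl, rfl⟩ := numPair_inj.1 hpair
  exact hmem

variable [Nonempty S]

instance SigmaDef.rises (Y F : S) (f : (ℕ → N) → N) [TermDef f] :
    SigmaDef S fun v => Rises Y F (f v) := by
  have : SigmaDef S fun v : ℕ → N => ∃ y, numPair (v 0) y ∈ F ∧ numPair (v 0) y ∈ Y := inferInstance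
  exact this.comp fun v _ => f v

instance SigmaDef.drops (Y F : S) (f : (ℕ → N) → N) [TermDef f] :
    SigmaDef S fun v => Drops Y F (f v) := by
  have : SigmaDef S fun v : ℕ → N => ∃ y, numPair (v 0) y ∈ F ∧ ¬ numPair (v 0) y ∈ Y :=
    inferInstance
  exact this.comp fun v _ => f v

instance SigmaDef.dropsAt (Y I F : S) (f : (ℕ → N) → N) [TermDef f] :
    SigmaDef S fun v => DropsAt Y I F (f v) := by
  have : SigmaDef S fun v : ℕ → N => ∃ s l p, s ∈ I ∧ HasLength s (l + 1) ∧ HasEntry s l (v 0) ∧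
      IsPrefix s l p ∧ Rises Y F p ∧ Drops Y F s := inferInstance
  exact this.comp fun v _ => f v

variable [RCAModel N S] {Y I J F : S} (hY : IsOmegaPow N Y) (h : IsCollapse N Y I J F)

namespace IsCollapse

include h

omit [LinearOrder N] [IsStrictOrderedRing N] [CanonicallyOrderedAdd N] [SuccAddOrder N]
  [Nonempty S] [RCAModel N S] in
theorem rises_of_not_drops {x : N} (hx : x ∈ I) (hd : ¬ Drops Y F x) : Rises Y F x := by
  obtain ⟨y, hy⟩ := h.total x hx
  exact ⟨y, hy, not_not.1 fun hn => hd ⟨y, hy, hn⟩⟩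

omit [LinearOrder N] [IsStrictOrderedRing N] [CanonicallyOrderedAdd N] [SuccAddOrder N]
  [Nonempty S] [RCAModel N S] in
theorem not_rises_of_drops {x : N} (hd : Drops Y F x) : ¬ Rises Y F x := by
  rintro ⟨y, hy, hle⟩
  obtain ⟨z, hz, hlt⟩ := hd
  exact hlt (h.unique x y z hy hz ▸ hle)

include hY

theorem inOmegaPow {x : N} (hx : x ∈ I) : InOmegaPow x := hY.mem_diag_iff.1 (h.mem_diag x hx)

theorem inOmegaPow_image {x y : N} (hxy : numPair x y ∈ F) : InOmegaPow y :=
  h.inOmegaPow hY (h.subset y (h.mapsTo x y hxy).2)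

theorem mem_of_isPrefix {w n j s : N} (hw : w ∈ I) (hn : HasLength w n) (hj : j ≤ n)
    (hs : IsPrefix w j s) : s ∈ I := by
  have hwω := h.inOmegaPow hY hw
  rcases hj.eq_or_lt with rfl | hj
  · exact hs.unique S (.refl hwω.1 hn) ▸ hw
  · obtain ⟨hle, hne⟩ := hY.mem_and_ne_iff.2 ⟨hs.inOmegaPow S hwω, hwω, hs.entries_lt S hn hj⟩
    exact h.mem_of_lt w s hw hle hne

theorem exists_successive_prefixes {w n j₀ : N} (hw : w ∈ I) (hn : HasLength w n) (hj₀ : j₀ ≤ n)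
    (h₀ : ∃ p, IsPrefix w j₀ p ∧ Rises Y F p) (hd : Drops Y F w) :
    ∃ j, j₀ ≤ j ∧ j < n ∧
      ∃ p s, IsPrefix w j p ∧ IsPrefix w (j + 1) s ∧ Rises Y F p ∧ Drops Y F s := by
  by_contra! hcon
  obtain ⟨k, rfl⟩ := exists_add_of_le hj₀
  obtain ⟨p, hp, hr⟩ : ∃ p, IsPrefix w (j₀ + k) p ∧ Rises Y F p := by
    refine RCAModel.induction_le S (P := fun k => ∃ p, IsPrefix w (j₀ + k) p ∧ Rises Y F p)
      inferInstance k (by simpa only [add_zero] using h₀) ?_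
    rintro i hi ⟨p, hp, hr⟩
    have hi' : j₀ + i < j₀ + k := by gcongr
    have hle : j₀ + i + 1 ≤ j₀ + k := Order.add_one_le_iff.2 hi'
    obtain ⟨s, hs⟩ := IsPrefix.exists_of_le S hn hle
    exact ⟨s, add_assoc j₀ i 1 ▸ hs, h.rises_of_not_drops (h.mem_of_isPrefix hY hw hn hle hs)
      (hcon _ le_self_add hi' p s hp hs hr)⟩
  obtain rfl := hp.unique S (.refl (h.inOmegaPow hY hw).1 hn)
  exact h.not_rises_of_drops hd hr

theorem exists_dropsAt_entry {w n j₀ : N} (hw : w ∈ I) (hn : HasLength w n) (hj₀ : j₀ ≤ n)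
    (h₀ : ∃ p, IsPrefix w j₀ p ∧ Rises Y F p) (hd : Drops Y F w) :
    ∃ j e, j₀ ≤ j ∧ j < n ∧ HasEntry w j e ∧ DropsAt Y I F e := by
  obtain ⟨j, hj, hjn, p, s, hp, hs, hr, hds⟩ := h.exists_successive_prefixes hY hw hn hj₀ h₀ hd
  obtain ⟨e, he⟩ := hn.exists_hasEntry S hjn
  have hj_lt : j < j + 1 := Order.lt_add_one_iff.2 le_rfl
  have hsI := h.mem_of_isPrefix hY hw hn (Order.add_one_le_iff.2 hjn) hs
  exact ⟨j, e, hj, hjn, he, s, j, p, hsI, hs.2.1, (entrySucc_eq_iff.1 (hs.2.2 j hj_lt) e).2 he,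
    hs.of_isPrefix hp hj_lt.le, hr, hds⟩

theorem exists_dropsAt : ∃ e, DropsAt Y I F e := by
  obtain ⟨w, hwI, hwJ⟩ := h.proper
  have hw := h.inOmegaPow hY hwI
  obtain ⟨n, hn⟩ := hw.1.1
  have hdrop : Drops Y F w := by
    obtain ⟨y, hy⟩ := h.total w hwI
    have hyJ := (h.mapsTo w y hy).2
    refine ⟨y, hy, fun hle => hwJ ?_⟩
    exact h.mem_range_of_lt y w hyJ hle fun heq => hwJ (heq ▸ hyJ)
  obtain ⟨p, hp⟩ := IsPrefix.exists_of_le S hn (zero_le : 0 ≤ n)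
  have hrise : Rises Y F p := by
    refine h.rises_of_not_drops (h.mem_of_isPrefix hY hwI hn zero_le hp) ?_
    rintro ⟨y, hy, hlt⟩
    obtain ⟨j, -, hj⟩ := (hY.not_mem_iff (hp.inOmegaPow S hw) (h.inOmegaPow_image hY hy)).1 hlt
    change entrySucc y j < entrySucc p j at hj
    exact (pos_of_gt hj).ne' (hp.2.1.entrySucc_eq_zero zero_le)
  obtain ⟨j, e, -, -, -, he⟩ :=
    h.exists_dropsAt_entry hY hwI hn zero_le ⟨p, hp, hrise⟩ hdrop
  exact ⟨e, he⟩

/-- Since `f(p) < f(p * ⟨0⟩)`, a drop at `0` would make `f(p * ⟨0⟩)` lie strictly between `p` and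
`p * ⟨0⟩`. -/
theorem not_dropsAt_zero : ¬ DropsAt Y I F (0 : N) := by
  rintro ⟨s, l, p, hsI, hs, hsl, hp, ⟨y, hpF, hpY⟩, z, hsF, hsY⟩
  have hsω := h.inOmegaPow hY hsI
  have hzω := h.inOmegaPow_image hY hsF
  have hps : entries p < entries s := hp.entries_lt S hs (Order.lt_add_one_iff.2 le_rfl)
  obtain ⟨hle, hne⟩ := hY.mem_and_ne_iff.2 ⟨hp.inOmegaPow S hsω, hsω, hps⟩
  have hyz := (hY.mem_and_ne_iff.1 (h.strictMono p y s z hpF hsF hle hne)).2.2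
  have hpy := (hY.mem_iff.1 hpY).2.2
  have hzp := hp.entries_le_of_lt S hs (by rw [hsl.entrySucc_eq, zero_add]) hzω.1
    ((hY.not_mem_iff hsω hzω).1 hsY)
  exact (hpy.trans_lt hyz).not_ge hzp

/-- If `f(p * ⟨e + 1⟩) < p * ⟨e + 1⟩`, then `f(p * ⟨e + 1⟩)` lies below `w = p * ⟨e, …, e⟩` with
sufficiently many copies of `e`. So `f` sends `w` downwards, and the drop occurs at some copy. -/
theorem dropsAt_of_add_one {e : N} (he : DropsAt Y I F (e + 1)) : DropsAt Y I F e := by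
  obtain ⟨s, l, p, hsI, hs, hsl, hp, hrise, z, hsF, hsY⟩ := he
  replace hsl := hsl.entrySucc_eq
  have hsω := h.inOmegaPow hY hsI
  have hzω := h.inOmegaPow_image hY hsF
  have hzs := (hY.not_mem_iff hsω hzω).1 hsY
  obtain ⟨n, hn⟩ := hzω.1.1
  have hn_lt : n < n + 1 := Order.lt_add_one_iff.2 le_rfl
  obtain ⟨w, hw⟩ := IsPadded.exists_of_le S hs (l := l) le_self_add e (n + 1)
  have hwω := hw.inOmegaPow S hsω hsl
  obtain ⟨hle, hne⟩ := hY.mem_and_ne_iff.2 ⟨hwω, hsω, hw.entries_lt hsl⟩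
  have hwI := h.mem_of_lt s w hsI hle hne
  have hdrop : Drops Y F w := by
    obtain ⟨u, hu⟩ := h.total w hwI
    have huz := (hY.mem_and_ne_iff.1 (h.strictMono w u s z hu hsF hle hne)).2.2
    have hzw := hw.entries_lt_of_lt S hs hsl hzω hn (hn_lt.trans_le le_add_self) hzs
    exact ⟨u, hu, (hY.not_mem_iff hwω (h.inOmegaPow_image hY hu)).2 (huz.trans hzw)⟩
  have hpw : IsPrefix w l p :=
    ⟨hp.1, hp.2.1, fun i hi => (hp.2.2 i hi).trans (hw.entrySucc_eq i hi).symm⟩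
  obtain ⟨j, e', hj, hjn, he', hd⟩ := h.exists_dropsAt_entry hY hwI hw.hasLength le_self_add
    ⟨p, hpw, hrise⟩ hdrop
  rwa [add_right_cancel (he'.entrySucc_eq.symm.trans (hw.entrySucc_eq_add_one j hj hjn))] at hd

theorem false : False := by
  obtain ⟨e, he⟩ := h.exists_dropsAt hY
  obtain ⟨j, hj, hd⟩ : ∃ j, j + e = e ∧ DropsAt Y I F j := by
    refine RCAModel.induction_le S (P := fun i => ∃ j, j + i = e ∧ DropsAt Y I F j) inferInstance e
      ⟨e, add_zero e, he⟩ ?_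
    rintro i hi ⟨j, hj, hd⟩
    rcases eq_or_ne j 0 with rfl | h0
    · exact (hi.ne (by rwa [zero_add] at hj)).elim
    · obtain ⟨j, rfl⟩ := exists_add_of_le (Order.one_le_iff_pos.2 (pos_iff_ne_zero.2 h0))
      rw [add_comm 1 j] at hj hd
      exact ⟨j, by rw [← hj]; ring, h.dropsAt_of_add_one hY hd⟩
  obtain rfl : j = 0 := by simpa only [add_eq_right] using hj
  exact h.not_dropsAt_zero hY hd

end IsCollapse

variable (N S) in
theorem sat_weakWellOrder (v : ℕ → N) (s : ℕ → S) :
    (omegaOmegaSatisfies isWeakWellOrder).Sat v s := by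
  obtain ⟨X, hX⟩ := exists_isOmega N S
  obtain ⟨Y, hY⟩ := exists_isOmegaPow N S
  simp only [omegaOmegaSatisfies, sat_exS, sat_and, sat_isOmega]
  exact ⟨X, Y, hX, (sat_isOmegaPow _ _ hX).2 hY,
    sat_isWeakWellOrder (IsOmegaPow.sat_isLinearOrder hY v) fun I J F h => h.false hY⟩

end WeakWellOrder

theorem proves_weakWellOrder : Proves RCA₀ (omegaOmegaSatisfies isWeakWellOrder) := by
  refine completeness fun N S _ _ _ _ _ _ hT v s => ?_
  have : Nonempty S := ⟨s 0⟩
  have H : IsModel N S := hT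
  let := H.commSemiring
  let := H.linearOrder
  have := H.isStrictOrderedRing
  have := H.canonicallyOrderedAdd
  let := H.succAddOrder
  have : RCAModel N S := ⟨H⟩
  exact sat_weakWellOrder N S v s

/-! ### Descending sequences inside a model -/

section Descending

variable {N S : Type*} [CommSemiring N] [LinearOrder N]

/-- The sequences `⟨e i 0, …, e i (len i - 1)⟩` for `i : N` are non-increasing and form an infinite
descending sequence with respect to the lexicographic order. -/
structure IsDescending (len : N → N) (e : N → N → N) : Prop where
  antitone : ∀ i j, j + 1 < len i → e i (j + 1) ≤ e i j
  lex_lt : ∀ i, (len (i + 1) < len i ∧ ∀ j < len (i + 1), e i j = e (i + 1) j) ∨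
    ∃ j, j < len i ∧ j < len (i + 1) ∧ e (i + 1) j < e i j ∧ ∀ k < j, e i k = e (i + 1) k

variable [Membership N S]

/-- `c` is the code of a sequence whose length `l` satisfies `(i, l) ∈ Λ` and whose entries `x` at
`j` satisfy `((i, j), x) ∈ E`. -/
def Describes (Λ E : S) (i c : N) : Prop :=
  IsSeq c ∧ ∃ l, l ≤ c ∧ (HasLength c l ∧ numPair i l ∈ Λ ∧
    ∀ j, j < l → ∀ x, x ≤ c → HasEntry c j x → numPair (numPair i j) x ∈ E)

theorem exists_of_sat_isWellOrder {v : ℕ → N} {s : ℕ → S} {Y : ℕ} (h : (isWellOrder Y).Sat v s)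
    {F : S} (maps : ∀ z, z ∈ F → ∃ x y : N, z = numPair x y ∧ numPair y y ∈ s Y)
    (total : ∀ x : N, ∃ y, numPair x y ∈ F)
    (unique : ∀ x y z : N, numPair x y ∈ F → numPair x z ∈ F → y = z) :
    ∃ x y z : N, numPair x y ∈ F ∧ numPair (x + 1) z ∈ F ∧ ¬ (numPair z y ∈ s Y ∧ z ≠ y) := by
  obtain ⟨-, h⟩ := (sat_and _ _ _ _).1 h
  by_contra! hdesc
  refine (sat_neg _ _ _).1 h ((sat_exS _ _ _).2 ⟨F, ?_⟩)
  simp only [isFunction, sat_and, sat_allN, sat_imp, sat_mem, sat_eq, sat_exN, sat_inField,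
    scons_zero, sat_ltIn, scons_succ, Tm.val_var, val_pair, ne_eq, and_imp,
    true_and, true_imp_iff]
  exact ⟨⟨maps, total, unique⟩, fun x y z hy hz => hdesc x y z hy hz⟩

theorem Describes.hasLength {len : N → N} {Λ E : S} (hΛ : ∀ i l, numPair i l ∈ Λ ↔ l = len i)
    {i c : N} (hc : Describes Λ E i c) : HasLength c (len i) := by
  obtain ⟨-, l, -, hl, hil, -⟩ := hc
  exact (hΛ i l).1 hil ▸ hl

variable [IsStrictOrderedRing N] [CanonicallyOrderedAdd N] [SuccAddOrder N] [Nonempty S]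

instance BoundedDef.describes (Λ E : S) (f g : (ℕ → N) → N) [TermDef f] [TermDef g] :
    BoundedDef S fun v => Describes Λ E (f v) (g v) := by
  have : BoundedDef S fun v : ℕ → N => Describes Λ E (v 0) (v 1) :=
    (inferInstance : BoundedDef S fun v => IsSeq (v 1) ∧ ∃ l, l ≤ v 1 ∧ (HasLength (v 1) l ∧
      numPair (v 0) l ∈ Λ ∧
      ∀ j, j < l → ∀ x, x ≤ v 1 → HasEntry (v 1) j x → numPair (numPair (v 0) j) x ∈ E))
  exact this.comp fun v => scons (f v) fun _ => g v

variable [RCAModel N S] {len : N → N} {e : N → N → N} {Λ E : S}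
  (hΛ : ∀ i l, numPair i l ∈ Λ ↔ l = len i)
  (hE : ∀ i j x, numPair (numPair i j) x ∈ E ↔ x = e i j)

section

variable {i c : N} (hc : Describes Λ E i c)

include hc hΛ hE

theorem Describes.entrySucc_eq {j : N} (hj : j < len i) : entrySucc c j = e i j + 1 := by
  obtain ⟨-, l, -, hl, hil, h⟩ := hc
  obtain rfl := (hΛ i l).1 hil
  obtain ⟨x, hx⟩ := hl.exists_hasEntry S hj
  rw [hx.entrySucc_eq, (hE i j x).1 (h j hj x hx.entry_le hx)]

theorem Describes.inOmegaPow (h : IsDescending len e) : InOmegaPow c := by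
  refine (inOmegaPow_iff S).2 ⟨hc.1, fun j => ?_⟩
  rcases lt_or_ge (j + 1) (len i) with hj | hj
  · rw [hc.entrySucc_eq hΛ hE hj,
      hc.entrySucc_eq hΛ hE ((Order.lt_add_one_iff.2 le_rfl).trans hj)]
    gcongr
    exact h.antitone i j hj
  · exact ((hc.hasLength hΛ).entrySucc_eq_zero hj).trans_le zero_le

theorem Describes.unique {d : N} (hd : Describes Λ E i d) : c = d := by
  refine (hc.1.entries_inj S hd.1).1 (congrArg toLex (funext fun j => ?_))
  rcases lt_or_ge j (len i) with hj | hj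
  · rw [hc.entrySucc_eq hΛ hE hj, hd.entrySucc_eq hΛ hE hj]
  · rw [(hc.hasLength hΛ).entrySucc_eq_zero hj, (hd.hasLength hΛ).entrySucc_eq_zero hj]

theorem Describes.entries_lt (h : IsDescending len e) {d : N} (hd : Describes Λ E (i + 1) d) :
    entries d < entries c := by
  rcases h.lex_lt i with ⟨hlt, hagree⟩ | ⟨j, hj, hj', hlt, hagree⟩
  · refine ⟨len (i + 1), fun j hj => ?_, ?_⟩
    · change entrySucc d j = entrySucc c j
      rw [hd.entrySucc_eq hΛ hE hj, hc.entrySucc_eq hΛ hE (hj.trans hlt), hagree j hj]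
    · exact ((hd.hasLength hΛ).entrySucc_eq_zero le_rfl).trans_lt
        ((hc.hasLength hΛ).entrySucc_pos S hlt)
  · refine ⟨j, fun k hk => ?_, ?_⟩
    · change entrySucc d k = entrySucc c k
      rw [hd.entrySucc_eq hΛ hE (hk.trans hj'), hc.entrySucc_eq hΛ hE (hk.trans hj), hagree k hk]
    · change entrySucc d j < entrySucc c j
      rw [hd.entrySucc_eq hΛ hE hj', hc.entrySucc_eq hΛ hE hj]
      gcongr

end

include hΛ hE

theorem exists_describes (i : N) : ∃ c, Describes Λ E i c := by
  obtain ⟨c, hc, hl, h⟩ := exists_seq S (R := fun j x => numPair (numPair i j) x ∈ E)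
    inferInstance (len i) fun j _ => ⟨e i j, (hE _ _ _).2 rfl⟩
  refine ⟨c, hc, len i, hl.le, hl, (hΛ _ _).2 rfl, fun j hj x _ hx => ?_⟩
  obtain ⟨y, hy, hyE⟩ := h j hj
  rwa [hx.unique hy]

omit hΛ hE in
variable (Λ E) in
theorem exists_mem_iff_describes : ∃ F : S, ∀ z : N, z ∈ F ↔ ∃ i c, z = numPair i c ∧
    Describes Λ E i c := by
  obtain ⟨F, hF⟩ := RCAModel.comprehension S (P := fun z : N => ∃ i, i ≤ z ∧ ∃ c, c ≤ z ∧
    (z = numPair i c ∧ Describes Λ E i c)) inferInstance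
  refine ⟨F, fun z => (hF z).trans ⟨fun ⟨i, _, c, _, h⟩ => ⟨i, c, h⟩, fun ⟨i, c, h, hc⟩ => ?_⟩⟩
  exact ⟨i, h ▸ le_numPair_left i c, c, h ▸ le_numPair_right i c, h, hc⟩

theorem not_sat_isWellOrder (h : IsDescending len e) {v : ℕ → N} {s : ℕ → S} {Y : ℕ}
    (hY : IsOmegaPow N (s Y)) : ¬ (isWellOrder Y).Sat v s := by
  intro hwo
  obtain ⟨F, hF⟩ := exists_mem_iff_describes (N := N) Λ E
  have hF' (i c : N) : numPair i c ∈ F ↔ Describes Λ E i c := by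
    refine (hF _).trans ⟨fun ⟨i', c', heq, hc⟩ => ?_, fun hc => ⟨i, c, rfl, hc⟩⟩
    obtain ⟨rfl, rfl⟩ := numPair_inj.1 heq
    exact hc
  obtain ⟨i, c, d, hc, hd, hcd⟩ := exists_of_sat_isWellOrder hwo (F := F)
    (fun z hz => by
      obtain ⟨i, c, heq, hc⟩ := (hF z).1 hz
      exact ⟨i, c, heq, hY.mem_diag_iff.2 (hc.inOmegaPow hΛ hE h)⟩)
    (fun i => (exists_describes hΛ hE i).imp fun c hc => (hF' i c).2 hc)
    (fun i c d hc hd => ((hF' i c).1 hc).unique hΛ hE ((hF' i d).1 hd))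
  rw [hF'] at hc hd
  exact hcd (hY.mem_and_ne_iff.2
    ⟨hd.inOmegaPow hΛ hE h, hc.inOmegaPow hΛ hE h, hc.entries_lt hΛ hE h hd⟩)

theorem not_sat_omegaOmega_isWellOrder (h : IsDescending len e) (v : ℕ → N) (s : ℕ → S) :
    ¬ (omegaOmegaSatisfies isWellOrder).Sat v s := by
  simp only [omegaOmegaSatisfies, sat_exS, sat_and, sat_isOmega, not_exists]
  rintro X Y ⟨hX, hY, hwo⟩
  exact not_sat_isWellOrder hΛ hE h ((sat_isOmegaPow _ _ hX).1 hY) hwo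

end Descending

/-! ### Slow descents in `ω ^ ω` -/

/-- One step of a descent through non-increasing sequences of natural numbers: a last entry `0` is
dropped, and a last entry `e + 1` is replaced by `x + 1` copies of `e`. Sequences are listed from
the last entry to the first. -/
def descend (x : ℕ) : List ℕ → List ℕ
  | [] => []
  | 0 :: τ => τ
  | (e + 1) :: τ => List.replicate (x + 1) e ++ τ

/-- The sequence that is reached from `σ` by `i` steps of `descend`, where the counter starts with
the value `x` and is increased by one in each step. -/
def descent (x : ℕ) (σ : List ℕ) : ℕ → List ℕ
  | 0 => σ
  | i + 1 => descend (x + i) (descent x σ i)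

/-- When the descent is at a sequence that ends in `σ` and the counter has the value `x`, then the
entries of `σ` have disappeared only when the counter has reached `f x`. -/
def ClearsAfter (σ : List ℕ) (f : ℕ → ℕ) : Prop :=
  ∀ τ x, ∃ n, descent x (σ ++ τ) n = τ ∧ f x ≤ x + n ∧
    ∀ i < n, τ.length < (descent x (σ ++ τ) i).length

theorem descent_add (x : ℕ) (σ : List ℕ) (i j : ℕ) :
    descent x σ (i + j) = descent (x + i) (descent x σ i) j := by
  induction j with
  | zero => rfl
  | succ j ih => rw [← add_assoc, descent, ih, descent, add_assoc]

theorem ClearsAfter.nil : ClearsAfter [] id :=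
  fun _ _ => ⟨0, rfl, le_rfl, fun i hi => (Nat.not_lt_zero i hi).elim⟩

theorem ClearsAfter.append {σ τ : List ℕ} {f g : ℕ → ℕ} (hσ : ClearsAfter σ f)
    (hτ : ClearsAfter τ g) (hg : Monotone g) : ClearsAfter (σ ++ τ) (g ∘ f) := by
  intro ρ x
  obtain ⟨n, hn, hfn, hlen⟩ := hσ (τ ++ ρ) x
  obtain ⟨m, hm, hgm, hlen'⟩ := hτ ρ (x + n)
  rw [List.append_assoc]
  refine ⟨n + m, by rw [descent_add, hn, hm], ?_, fun i hi => ?_⟩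
  · exact (hg hfn).trans (hgm.trans_eq (add_assoc x n m))
  · rcases lt_or_ge i n with hin | hin
    · exact (List.length_append ▸ Nat.le_add_left ..).trans_lt (hlen i hin)
    · obtain ⟨j, rfl⟩ := Nat.exists_eq_add_of_le hin
      rw [descent_add, hn]
      exact hlen' j (by omega)

theorem ClearsAfter.replicate {e : ℕ} {f : ℕ → ℕ} (h : ClearsAfter [e] f) (hf : Monotone f)
    (m : ℕ) : ClearsAfter (List.replicate m e) f^[m] := by
  induction m with
  | zero => exact .nil
  | succ m ih => exact h.append ih (hf.iterate m)

theorem ack_succ_eq_iterate (e m : ℕ) : ack (e + 1) m = (ack e)^[m + 1] 1 := by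
  induction m with
  | zero => rw [ack_succ_zero, zero_add, Function.iterate_one]
  | succ m ih => rw [ack_succ_succ, ih, ← Function.iterate_succ_apply' (ack e)]

theorem clearsAfter_singleton_ack (e : ℕ) : ClearsAfter [e] (ack e) := by
  induction e with
  | zero =>
    refine fun τ x => ⟨1, rfl, (ack_zero x).le, fun i hi => ?_⟩
    rw [Nat.lt_one_iff.1 hi]
    exact Nat.lt_succ_self τ.length
  | succ e ih =>
    intro τ x
    obtain ⟨n, hn, hle, hlen⟩ := ih.replicate (ack_mono_right e) (x + 1) τ (x + 1)
    have first_step (i : ℕ) : descent x ((e + 1) :: τ) (1 + i) =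
      descent (x + 1) (List.replicate (x + 1) e ++ τ) i := descent_add _ _ 1 i
    refine ⟨1 + n, (first_step n).trans hn, ?_, fun i hi => ?_⟩
    · rw [← add_assoc, ack_succ_eq_iterate]
      exact ((ack_mono_right e).iterate _ (Nat.le_add_left 1 x)).trans hle
    · rcases i with _ | i
      · exact Nat.lt_succ_self τ.length
      · rw [add_comm i 1]
        exact (hlen i (by omega)).trans_eq (congrArg List.length (first_step i).symm)

theorem descent_ne_nil {e x i : ℕ} (h : x + i < ack e x) : descent x [e] i ≠ [] := by
  obtain ⟨n, -, hle, hlen⟩ := clearsAfter_singleton_ack e [] x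
  exact List.ne_nil_of_length_pos (hlen i (by omega))

theorem descend_mem_le {b : ℕ} (x : ℕ) {σ : List ℕ} (h : ∀ y ∈ σ, y ≤ b) :
    ∀ y ∈ descend x σ, y ≤ b := by
  rcases σ with _ | ⟨_ | e, τ⟩
  · exact h
  · exact fun y hy => h y (List.mem_cons_of_mem _ hy)
  · intro y hy
    rcases List.mem_append.1 hy with hy | hy
    · rw [List.eq_of_mem_replicate hy]
      exact (Nat.le_succ e).trans (h _ List.mem_cons_self)
    · exact h y (List.mem_cons_of_mem _ hy)

theorem descent_mem_le {b : ℕ} (x : ℕ) {σ : List ℕ} (h : ∀ y ∈ σ, y ≤ b) (i : ℕ) :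
    ∀ y ∈ descent x σ i, y ≤ b := by
  induction i with
  | zero => exact h
  | succ i ih => exact descend_mem_le _ ih

theorem descend_pairwise_le (x : ℕ) {σ : List ℕ} (h : σ.Pairwise (· ≤ ·)) :
    (descend x σ).Pairwise (· ≤ ·) := by
  rcases σ with _ | ⟨_ | e, τ⟩
  · exact h
  · exact h.of_cons
  · obtain ⟨hle, hτ⟩ := List.pairwise_cons.1 h
    refine List.pairwise_append.2 ⟨List.pairwise_replicate.2 (.inr le_rfl), hτ, fun y hy z hz => ?_⟩
    rw [List.eq_of_mem_replicate hy]
    exact (Nat.le_succ e).trans (hle z hz)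

theorem descent_pairwise_le (x : ℕ) {σ : List ℕ} (h : σ.Pairwise (· ≤ ·)) (i : ℕ) :
    (descent x σ i).Pairwise (· ≤ ·) := by
  induction i with
  | zero => exact h
  | succ i ih => exact descend_pairwise_le _ ih

theorem length_descend_le (x : ℕ) (σ : List ℕ) : (descend x σ).length ≤ σ.length + x := by
  rcases σ with _ | ⟨_ | e, τ⟩
  · exact Nat.zero_le _
  · exact (Nat.le_succ _).trans (Nat.le_add_right _ _)
  · rw [descend, List.length_append, List.length_replicate, List.length_cons]
    omega

theorem length_descent_le (x : ℕ) (σ : List ℕ) (i : ℕ) :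
    (descent x σ i).length ≤ σ.length + i * (x + i) := by
  induction i with
  | zero => exact Nat.le_add_right _ _
  | succ i ih =>
    have := length_descend_le (x + i) (descent x σ i)
    rw [descent]
    nlinarith

/-- The `j`-th entry of a sequence that is listed from the last entry to the first, or `0` if there
is no such entry. -/
def revEntry (σ : List ℕ) (j : ℕ) : ℕ := σ.reverse.getD j 0

theorem revEntry_append (σ τ : List ℕ) {j : ℕ} (hj : j < τ.length) :
    revEntry (σ ++ τ) j = revEntry τ j := by
  rw [revEntry, revEntry, List.reverse_append]
  exact List.getD_append _ _ _ _ (by rwa [List.length_reverse])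

theorem revEntry_cons_of_lt (e : ℕ) (τ : List ℕ) {j : ℕ} (hj : j < τ.length) :
    revEntry (e :: τ) j = revEntry τ j :=
  revEntry_append [e] τ hj

theorem revEntry_cons_length (e : ℕ) (τ : List ℕ) : revEntry (e :: τ) τ.length = e := by
  rw [revEntry, List.reverse_cons, List.getD_append_right _ _ _ _ (List.length_reverse).le,
    List.length_reverse, Nat.sub_self, List.getD_cons_zero]

theorem revEntry_le {b : ℕ} {σ : List ℕ} (h : ∀ y ∈ σ, y ≤ b) (j : ℕ) : revEntry σ j ≤ b := by
  rcases lt_or_ge j σ.reverse.length with hj | hj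
  · rw [revEntry, List.getD_eq_getElem _ _ hj]
    exact h _ (List.mem_reverse.1 (List.getElem_mem hj))
  · rw [revEntry, List.getD_eq_default _ _ hj]
    exact Nat.zero_le b

theorem revEntry_add_one_le {σ : List ℕ} (h : σ.Pairwise (· ≤ ·)) {j : ℕ}
    (hj : j + 1 < σ.length) : revEntry σ (j + 1) ≤ revEntry σ j := by
  rw [← List.length_reverse] at hj
  rw [revEntry, revEntry, List.getD_eq_getElem _ _ hj, List.getD_eq_getElem _ _ (by omega)]
  exact List.pairwise_iff_getElem.1 (List.pairwise_reverse.2 h) j (j + 1) _ _ (Nat.lt_succ_self j)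

theorem descend_lex_lt (x : ℕ) {σ : List ℕ} (h : σ ≠ []) :
    ((descend x σ).length < σ.length ∧
      ∀ j < (descend x σ).length, revEntry σ j = revEntry (descend x σ) j) ∨
    ∃ j, j < σ.length ∧ j < (descend x σ).length ∧ revEntry (descend x σ) j < revEntry σ j ∧
      ∀ i < j, revEntry σ i = revEntry (descend x σ) i := by
  rcases σ with _ | ⟨_ | e, τ⟩
  · exact (h rfl).elim
  · exact .inl ⟨Nat.lt_succ_self _, fun j hj => revEntry_cons_of_lt 0 τ hj⟩
  · have hdescend : descend x ((e + 1) :: τ) = List.replicate x e ++ (e :: τ) := by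
      rw [descend, List.replicate_succ', List.append_assoc, List.singleton_append]
    have hτ : τ.length < (e :: τ).length := Nat.lt_succ_self _
    rw [hdescend]
    refine .inr ⟨τ.length, hτ, hτ.trans_le (List.length_append ▸ Nat.le_add_left ..), ?_,
      fun i hi => ?_⟩
    · rw [revEntry_append _ _ hτ, revEntry_cons_length, revEntry_cons_length]
      exact Nat.lt_succ_self e
    · rw [revEntry_append _ _ (hi.trans hτ), revEntry_cons_of_lt _ τ hi, revEntry_cons_of_lt _ τ hi]

/-! ### Nested intervals that avoid the values of given functions -/

/-- The `a + 2` intervals between consecutive values `ack (r + 1) (a + j)` are disjoint, so that one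
of them contains none of the `a + 1` values `G p`. -/
theorem exists_ack_interval (r a : ℕ) (G : ℕ → ℕ) :
    ∃ j < a + 2, ∀ p ≤ a, ¬ (ack (r + 1) (a + j) < G p ∧ G p < ack (r + 1) (a + j + 1)) := by
  by_contra! h
  choose! p hpa hlt hgt using h
  obtain ⟨i, hi, j, hj, hij, heq⟩ := Finset.exists_ne_map_eq_of_card_lt_of_maps_to
    (s := Finset.range (a + 2)) (t := Finset.range (a + 1))
    (by rw [Finset.card_range, Finset.card_range]; omega) (f := p) fun i hi => by
      rw [Finset.coe_range] at hi ⊢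
      exact Nat.lt_succ_of_le (hpa i hi)
  wlog hlt' : i < j generalizing i j
  · exact this j hj i hi hij.symm heq.symm (by omega)
  have hGi := hgt i (Finset.mem_range.1 hi)
  have hGj := hlt j (Finset.mem_range.1 hj)
  have hmono : ack (r + 1) (a + i + 1) ≤ ack (r + 1) (a + j) := ack_mono_right _ (by omega)
  rw [heq] at hGi
  exact (hGi.trans_le hmono).asymm hGj

theorem exists_subinterval {r : ℕ} (hr : 1 ≤ r) {a b : ℕ} (hab : ack (r + 3) a ≤ b)
    (G : ℕ → ℕ) : ∃ a' b', ack (r + 1) a ≤ a' ∧ ack r a' ≤ b' ∧ b' ≤ b ∧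
      ∀ p ≤ a, ¬ (a' < G p ∧ G p < b') := by
  obtain ⟨j, hj, hG⟩ := exists_ack_interval r a G
  refine ⟨_, _, ack_mono_right _ (Nat.le_add_right a j), (ack_succ_succ _ _).ge, ?_, hG⟩
  calc ack (r + 1) (a + j + 1) ≤ ack (r + 1) (ack 2 a) := ack_mono_right _ (by rw [ack_two]; omega)
    _ ≤ ack (max (r + 1) 2 + 2) a := (ack_ack_lt_ack_max_add_two _ _ _).le
    _ = ack (r + 3) a := by rw [max_eq_left (by omega)]
    _ ≤ b := hab

theorem exists_nested_intervals (k : ℕ) (G : ℕ → ℕ → ℕ) : ∃ a b : ℕ → ℕ,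
    a 0 = k ∧ b 0 = ack k k ∧ ∀ n, 3 * (n + 1) < k →
      ack (k - 3 * (n + 1)) (a n) ≤ a (n + 1) ∧ b (n + 1) ≤ b n ∧ a n < b n ∧
      ∀ p ≤ a n, ¬ (a (n + 1) < G n p ∧ G n p < b (n + 1)) := by
  have hstep (n : ℕ) (I : ℕ × ℕ) : ∃ I' : ℕ × ℕ, 3 * (n + 1) < k → ack (k - 3 * n) I.1 ≤ I.2 →
      ack (k - 3 * (n + 1) + 1) I.1 ≤ I'.1 ∧ ack (k - 3 * (n + 1)) I'.1 ≤ I'.2 ∧ I'.2 ≤ I.2 ∧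
      ∀ p ≤ I.1, ¬ (I'.1 < G n p ∧ G n p < I'.2) := by
    by_cases h : 3 * (n + 1) < k ∧ ack (k - 3 * n) I.1 ≤ I.2
    · obtain ⟨hk, hI⟩ := h
      rw [show k - 3 * n = k - 3 * (n + 1) + 3 by omega] at hI
      obtain ⟨a', b', h⟩ := exists_subinterval (by omega) hI (G n)
      exact ⟨(a', b'), fun _ _ => h⟩
    · exact ⟨I, fun hk hI => (h ⟨hk, hI⟩).elim⟩
  choose next hnext using hstep
  let I : ℕ → ℕ × ℕ := Nat.rec (k, ack k k) next
  have hI (n : ℕ) (hn : 3 * n < k) : ack (k - 3 * n) (I n).1 ≤ (I n).2 := by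
    induction n with
    | zero => exact le_rfl
    | succ n ih => exact (hnext n (I n) hn (ih (by omega))).2.1
  refine ⟨fun n => (I n).1, fun n => (I n).2, rfl, rfl, fun n hn => ?_⟩
  obtain ⟨ha, -, hb, hG⟩ := hnext n (I n) hn (hI n (by omega))
  exact ⟨(ack_mono_left _ (Nat.le_succ _)).trans ha, hb,
    (lt_ack_right _ _).trans_le (hI n (by omega)), hG⟩

/-! ### Codes of sets of natural numbers -/

open Filter

/-- The `i`-th entry of the infinite sequence coded by a number: `Nat.pair x p` codes `x` followed
by the sequence coded by `p`. -/
def dec : ℕ → ℕ → ℕ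
  | p, 0 => p.unpair.1
  | p, i + 1 => dec p.unpair.2 i

theorem dec_pair (x p : ℕ) : dec (Nat.pair x p) = scons x (dec p) := by
  funext i
  cases i <;> simp only [dec, Nat.unpair_pair, scons_zero, scons_succ]

section Codes

variable {ι : Type}

/-- The number of codes of set parameters from which a code is built. -/
def arity : ι ⊕ (Fm × Fm × ℕ) → ℕ
  | .inl _ => 0
  | .inr (_, _, n) => n

/-- Codes of the sets that are obtained from basic sets with indices in `ι` by bounded
`Δ⁰₁`-comprehension. -/
abbrev Code (ι : Type) : Type := WType fun c : ι ⊕ (Fm × Fm × ℕ) => Fin (arity c)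

instance [Countable ι] : Countable (Code ι) := by
  have := Encodable.ofCountable Fm
  have := Encodable.ofCountable ι
  infer_instance

/-- The code of a basic set. -/
def Code.basic (t : ι) : Code ι := .mk (.inl t) Fin.elim0

/-- The code of the set that is defined by `∃ y, θ` and by `∀ y, χ`. -/
def Code.delta (θ χ : Fm) {n : ℕ} (f : Fin n → Code ι) : Code ι := .mk (.inr (θ, χ, n)) f

/-- The assignment of the set parameters `F`, where the `j`-th entry of the sequence coded by `q` is
the parameter of `F j`. -/
def setEnv {n : ℕ} (F : Fin n → ℕ → Set ℕ) (q j : ℕ) : Set ℕ :=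
  if h : j < n then F ⟨j, h⟩ (dec q j) else ∅

/-- The set given by a code and a number parameter `p`, with the basic sets `D`. The two components
of `p` code the number parameters of the formulas and the parameters of the set parameters. The
quantifier `∃ y` is restricted to `y < B`, and `∀ y` to the numbers below a witness for `θ`. -/
def Code.eval (D : ι → Set ℕ) (B : ℕ) : Code ι → ℕ → Set ℕ
  | ⟨.inl t, _⟩, _ => D t
  | ⟨.inr (θ, χ, _), f⟩, p =>
    let v (y z : ℕ) : ℕ → ℕ := scons y (scons z (dec p.unpair.1))
    let s : ℕ → Set ℕ := setEnv (fun j => eval D B (f j)) p.unpair.2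
    {z | ∃ y < B, θ.Sat (v y z) s ∧ ∀ y' ≤ y, χ.Sat (v y' z) s}

theorem Code.eval_basic (D : ι → Set ℕ) (B : ℕ) (t : ι) (p : ℕ) : (basic t).eval D B p = D t := by
  rfl

theorem Code.eval_delta (D : ι → Set ℕ) (B : ℕ) (θ χ : Fm) {n : ℕ} (f : Fin n → Code ι)
    (p q : ℕ) : (delta θ χ f).eval D B (Nat.pair p q) =
      {z | ∃ y < B, θ.Sat (scons y (scons z (dec p))) (setEnv (fun j => (f j).eval D B) q) ∧
        ∀ y' ≤ y, χ.Sat (scons y' (scons z (dec p))) (setEnv (fun j => (f j).eval D B) q)} := by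
  change {z | ∃ y < B, θ.Sat (scons y (scons z (dec (Nat.pair p q).unpair.1))) (setEnv _ _) ∧
    ∀ y' ≤ y, χ.Sat (scons y' (scons z (dec (Nat.pair p q).unpair.1))) (setEnv _ _)} = _
  rw [Nat.unpair_pair]
  rfl

/-- The least witness of a formula, with parameters coded by `p` as in `Code.eval`. -/
noncomputable def leastWitness (D : ι → Set ℕ) (B : ℕ) (θ : Fm) {n : ℕ} (f : Fin n → Code ι)
    (p : ℕ) : ℕ :=
  sInf {y | θ.Sat (scons y (dec p.unpair.1)) (setEnv (fun j => (f j).eval D B) p.unpair.2)}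

end Codes

/-! ### Internal sequences in an ultrapower of the natural numbers -/

section Ultrafilter

variable {α : Type*} (U : Ultrafilter α)

theorem eventually_forall_imp_iff {β : Type*} [Nonempty β] {R P : α → β → Prop} :
    (∀ᶠ k in U, ∀ x, R k x → P k x) ↔
      ∀ x : α → β, (∀ᶠ k in U, R k (x k)) → ∀ᶠ k in U, P k (x k) := by
  refine ⟨fun h x hx => (h.and hx).mono fun k hk => hk.1 _ hk.2, fun h => ?_⟩
  by_contra hn
  have hn := Ultrafilter.eventually_not.2 hn
  push Not at hn
  obtain ⟨x, hx⟩ := skolem.1 hn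
  obtain ⟨k, hP, -, hnP⟩ := ((h x (hx.mono fun k hk => hk.1)).and hx).exists
  exact hnP hP

theorem eventually_of_induction {P : α → ℕ → Prop} {c : α → ℕ} (zero : ∀ᶠ k in U, P k 0)
    (succ : ∀ x : α → ℕ, (∀ᶠ k in U, x k < c k) → (∀ᶠ k in U, P k (x k)) →
      ∀ᶠ k in U, P k (x k + 1)) : ∀ᶠ k in U, P k (c k) := by
  have hsucc : ∀ᶠ k in U, ∀ x, x < c k ∧ P k x → P k (x + 1) :=
    (eventually_forall_imp_iff U).2 fun x hx =>
      succ x (hx.mono fun _ h => h.1) (hx.mono fun _ h => h.2)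
  filter_upwards [zero, hsucc] with k hzero hsucc
  have hP (x : ℕ) (hx : x ≤ c k) : P k x := by
    induction x with
    | zero => exact hzero
    | succ x ih => exact hsucc x ⟨hx, ih (Nat.le_of_succ_le hx)⟩
  exact hP _ le_rfl

end Ultrafilter

/-! ### Cuts in an ultrapower of the natural numbers -/

/-- Intervals `[a n, b n]` in an ultrapower of the natural numbers that determine a cut: its
elements are those below some `a n`. By `ack_le`, the cut is closed under all primitive recursive
functions. By `gap`, no least witness for a formula with parameters below a given `a m` is above the
cut but below all of the `b n`. The basic sets `D` are to be included in the structure given by the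
cut. -/
structure Cut (ι : Type) where
  U : Ultrafilter ℕ
  D : ℕ → ι → Set ℕ
  a : ℕ → ℕ → ℕ
  b : ℕ → ℕ → ℕ
  ack_le : ∀ n m, ∀ᶠ k in U, ack m (a n k) ≤ a (n + 1) k
  b_anti : ∀ n, ∀ᶠ k in U, b (n + 1) k ≤ b n k
  lt : ∀ n, ∀ᶠ k in U, a n k < b n k
  gap : ∀ (θ : Fm) {n : ℕ} (f : Fin n → Code ι) (m : ℕ), ∃ l ≥ m, ∀ᶠ k in U, ∀ p ≤ a l k,
    ¬ (a (l + 1) k < leastWitness (D k) (b 0 k) θ f p ∧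
      leastWitness (D k) (b 0 k) θ f p < b (l + 1) k)

theorem Cut.exists {ι : Type} [Countable ι] (D : ℕ → ι → Set ℕ) :
    ∃ C : Cut ι, C.D = D ∧ (∀ k, C.a 0 k = k) ∧ ∀ k, C.b 0 k = ack k k := by
  have : Nonempty (Fm × (Σ n, Fin n → Code ι)) := ⟨.falsum, 0, Fin.elim0⟩
  obtain ⟨r, hr⟩ := exists_surjective_nat (Fm × (Σ n, Fin n → Code ι))
  choose a b ha hb hab using fun k => exists_nested_intervals k fun l =>
    leastWitness (D k) (ack k k) (r l.unpair.1).1 (r l.unpair.1).2.2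
  have hlarge (m : ℕ) : ∀ᶠ k in (hyperfilter ℕ : Filter ℕ), m < k :=
    (Nat.cofinite_eq_atTop ▸ hyperfilter_le_cofinite : (hyperfilter ℕ : Filter ℕ) ≤ atTop)
      (eventually_gt_atTop m)
  refine ⟨⟨hyperfilter ℕ, D, fun n k => a k n, fun n k => b k n, fun n m => ?_, fun n => ?_,
    fun n => ?_, fun θ n f m => ?_⟩, rfl, ha, hb⟩
  · filter_upwards [hlarge (m + 3 * (n + 1))] with k hk
    exact (ack_mono_left _ (by omega)).trans (hab k n (by omega)).1
  · exact (hlarge _).mono fun k hk => (hab k n hk).2.1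
  · exact (hlarge _).mono fun k hk => (hab k n hk).2.2.1
  · obtain ⟨i, hi⟩ := hr (θ, ⟨n, f⟩)
    refine ⟨Nat.pair i m, Nat.right_le_pair i m, ?_⟩
    filter_upwards [hlarge (3 * (Nat.pair i m + 1))] with k hk p hp
    have h := (hab k _ hk).2.2.2 p hp
    rwa [Nat.unpair_pair, hi, ← hb] at h

namespace Cut

variable {ι : Type} (C : Cut ι)

/-- The sequence represents an element of the cut. -/
def Bdd (f : ℕ → ℕ) : Prop := ∃ n, ∀ᶠ k in C.U, f k ≤ C.a n k

variable {C}

theorem Bdd.mono {f g : ℕ → ℕ} (hg : C.Bdd g) (h : ∀ᶠ k in C.U, f k ≤ g k) : C.Bdd f := by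
  obtain ⟨n, hn⟩ := hg
  exact ⟨n, (h.and hn).mono fun k hk => hk.1.trans hk.2⟩

theorem eventually_a_le {n m : ℕ} (h : n ≤ m) : ∀ᶠ k in C.U, C.a n k ≤ C.a m k := by
  induction m, h using Nat.le_induction with
  | base => exact .of_forall fun _ => le_rfl
  | succ m _ ih =>
    filter_upwards [ih, C.ack_le m 0] with k hnm hm
    exact hnm.trans ((lt_ack_right 0 _).le.trans hm)

theorem eventually_b_le {n m : ℕ} (h : n ≤ m) : ∀ᶠ k in C.U, C.b m k ≤ C.b n k := by
  induction m, h using Nat.le_induction with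
  | base => exact .of_forall fun _ => le_rfl
  | succ m _ ih => filter_upwards [ih, C.b_anti m] with k hmn hm using hm.trans hmn

theorem Bdd.exists_ge {f : ℕ → ℕ} (hf : C.Bdd f) (m : ℕ) :
    ∃ n ≥ m, ∀ᶠ k in C.U, f k ≤ C.a n k := by
  obtain ⟨n, hn⟩ := hf
  refine ⟨max n m, le_max_right _ _, ?_⟩
  filter_upwards [hn, eventually_a_le (le_max_left n m)] with k hf ha using hf.trans ha

theorem Bdd.lt_b {f : ℕ → ℕ} (hf : C.Bdd f) (m : ℕ) : ∀ᶠ k in C.U, f k < C.b m k := by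
  obtain ⟨n, hm, hn⟩ := hf.exists_ge m
  filter_upwards [hn, C.lt n, eventually_b_le hm] with k hf hab hb
  exact (hf.trans_lt hab).trans_le hb

theorem bdd_a (n : ℕ) : C.Bdd (C.a n) := ⟨n, .of_forall fun _ => le_rfl⟩

theorem Bdd.max {f g : ℕ → ℕ} (hf : C.Bdd f) (hg : C.Bdd g) : C.Bdd fun k => max (f k) (g k) := by
  obtain ⟨n, hn⟩ := hf
  obtain ⟨m, hm, h⟩ := hg.exists_ge n
  refine ⟨m, ?_⟩
  filter_upwards [hn, h, eventually_a_le hm] with k hf hg ha using max_le (hf.trans ha) hg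

theorem Bdd.sq {f : ℕ → ℕ} (hf : C.Bdd f) : C.Bdd fun k => (f k + 2) ^ 2 := by
  obtain ⟨n, hn⟩ := hf
  refine ⟨n + 1, ?_⟩
  filter_upwards [hn, C.ack_le n 3] with k hf ha
  have hack := ack_add_one_sq_lt_ack_add_three 0 (C.a n k)
  rw [ack_zero, zero_add] at hack
  exact ((Nat.pow_le_pow_left (by omega) 2).trans hack).trans ha

theorem Bdd.add {f g : ℕ → ℕ} (hf : C.Bdd f) (hg : C.Bdd g) : C.Bdd fun k => f k + g k :=
  (hf.max hg).sq.mono (.of_forall fun k => by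
    nlinarith [le_max_left (f k) (g k), le_max_right (f k) (g k)])

theorem Bdd.mul {f g : ℕ → ℕ} (hf : C.Bdd f) (hg : C.Bdd g) : C.Bdd fun k => f k * g k :=
  (hf.max hg).sq.mono (.of_forall fun k => calc
    f k * g k ≤ (f k ⊔ g k) * (f k ⊔ g k) := Nat.mul_le_mul (le_max_left _ _) (le_max_right _ _)
    _ = (f k ⊔ g k) ^ 2 := (pow_two _).symm
    _ ≤ (f k ⊔ g k + 2) ^ 2 := Nat.pow_le_pow_left (Nat.le_add_right _ 2) 2)

theorem Bdd.pair {f g : ℕ → ℕ} (hf : C.Bdd f) (hg : C.Bdd g) :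
    C.Bdd fun k => Nat.pair (f k) (g k) :=
  (hf.max hg).sq.mono (.of_forall fun k =>
    (Nat.pair_lt_max_add_one_sq _ _).le.trans (Nat.pow_le_pow_left (by omega) 2))

theorem bdd_const (n : ℕ) : C.Bdd fun _ => n := by
  induction n with
  | zero => exact ⟨0, .of_forall fun _ => Nat.zero_le _⟩
  | succ n ih => exact ih.sq.mono (.of_forall fun _ => by nlinarith)

theorem exists_dec_eq (n : ℕ) {v : ℕ → ℕ → ℕ} (hv : ∀ i, C.Bdd (v i)) :
    ∃ p, C.Bdd p ∧ ∀ k, ∀ i < n, dec (p k) i = v i k := by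
  induction n generalizing v with
  | zero => exact ⟨_, bdd_const 0, fun k i hi => (Nat.not_lt_zero i hi).elim⟩
  | succ n ih =>
    obtain ⟨p, hp, h⟩ := ih fun i => hv (i + 1)
    refine ⟨_, (hv 0).pair hp, fun k i hi => ?_⟩
    rw [dec_pair]
    cases i with
    | zero => rfl
    | succ i => exact h k i (Nat.lt_of_succ_lt_succ hi)

/-- If `∃ y, A y` and `∀ y, B y` are equivalent in the cut, then they are equivalent to an internal
property. In the direction from right to left, a witness outside the cut bounds all elements of the
cut, so that `∀ y, B y` holds there. -/
theorem exists_bdd_iff_eventually_exists {A B : ℕ → ℕ → Prop}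
    (h : (∃ y, C.Bdd y ∧ ∀ᶠ k in C.U, A k (y k)) ↔ ∀ y, C.Bdd y → ∀ᶠ k in C.U, B k (y k)) :
    (∃ y, C.Bdd y ∧ ∀ᶠ k in C.U, A k (y k)) ↔
      ∀ᶠ k in C.U, ∃ y < C.b 0 k, A k y ∧ ∀ y' ≤ y, B k y' := by
  constructor
  · intro hA
    have hB := h.1 hA
    obtain ⟨y, hy, hAy⟩ := hA
    have hBy : ∀ᶠ k in C.U, ∀ y' ≤ y k, B k y' :=
      (eventually_forall_imp_iff C.U).2 fun z hz => hB z (hy.mono hz)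
    filter_upwards [hAy, hBy, hy.lt_b 0] with k hA hB hlt using ⟨y k, hlt, hA, hB⟩
  · intro hAB
    obtain ⟨y, hy⟩ := skolem.1 hAB
    by_cases hb : C.Bdd y
    · exact ⟨y, hb, hy.mono fun k hk => hk.2.1⟩
    · refine h.2 fun z ⟨n, hz⟩ => ?_
      have hlt : ∀ᶠ k in C.U, ¬ y k ≤ C.a n k :=
        Ultrafilter.eventually_not.2 fun h => hb ⟨n, h⟩
      filter_upwards [hy, hz, hlt] with k hy hz hlt
      exact hy.2.2 _ (hz.trans (not_le.1 hlt).le)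

/-! ### The structure given by a cut -/

variable (C) in
/-- The elements of the cut. -/
def Num : Type :=
  Quotient ((germSetoid (C.U : Filter ℕ) ℕ).comap (Subtype.val : {f // C.Bdd f} → ℕ → ℕ))

/-- The element of the cut that is represented by a sequence. -/
def ofSeq (f : ℕ → ℕ) (hf : C.Bdd f) : C.Num := Quotient.mk _ ⟨f, hf⟩

/-- A representing sequence for an element of the cut. -/
noncomputable def rep (x : C.Num) : ℕ → ℕ := x.out.1

theorem bdd_rep (x : C.Num) : C.Bdd (rep x) := x.out.2

theorem rep_ofSeq (f : ℕ → ℕ) (hf : C.Bdd f) : ∀ᶠ k in C.U, rep (ofSeq f hf) k = f k :=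
  Quotient.mk_out (s := (germSetoid (C.U : Filter ℕ) ℕ).comap Subtype.val) ⟨f, hf⟩

theorem eq_iff {x y : C.Num} : x = y ↔ ∀ᶠ k in C.U, rep x k = rep y k :=
  Quotient.out_equiv_out.symm

noncomputable instance : Zero C.Num := ⟨ofSeq _ (bdd_const 0)⟩
noncomputable instance : One C.Num := ⟨ofSeq _ (bdd_const 1)⟩
noncomputable instance : Add C.Num := ⟨fun x y => ofSeq _ ((bdd_rep x).add (bdd_rep y))⟩
noncomputable instance : Mul C.Num := ⟨fun x y => ofSeq _ ((bdd_rep x).mul (bdd_rep y))⟩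
instance : LT C.Num := ⟨fun x y => ∀ᶠ k in C.U, rep x k < rep y k⟩

theorem rep_zero : ∀ᶠ k in C.U, rep (0 : C.Num) k = 0 := rep_ofSeq _ _
theorem rep_one : ∀ᶠ k in C.U, rep (1 : C.Num) k = 1 := rep_ofSeq _ _
theorem rep_add (x y : C.Num) : ∀ᶠ k in C.U, rep (x + y) k = rep x k + rep y k := rep_ofSeq _ _
theorem rep_mul (x y : C.Num) : ∀ᶠ k in C.U, rep (x * y) k = rep x k * rep y k := rep_ofSeq _ _
theorem lt_iff {x y : C.Num} : x < y ↔ ∀ᶠ k in C.U, rep x k < rep y k := Iff.rfl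

theorem rep_add_one (x : C.Num) : ∀ᶠ k in C.U, rep (x + 1) k = rep x k + 1 := by
  filter_upwards [rep_add x 1, rep_one] with k hadd hone
  rw [hadd, hone]

variable (C) in
/-- The sets of the structure, given by a code and a parameter. -/
def Sets : Type := Code ι × C.Num

/-- The components of a set in the ultrapower. -/
noncomputable def Sets.comp (X : C.Sets) (k : ℕ) : Set ℕ :=
  X.1.eval (C.D k) (C.b 0 k) (rep X.2 k)

instance : Membership C.Num C.Sets := ⟨fun X x => ∀ᶠ k in C.U, rep x k ∈ X.comp k⟩

theorem mem_iff {x : C.Num} {X : C.Sets} : x ∈ X ↔ ∀ᶠ k in C.U, rep x k ∈ X.comp k := Iff.rfl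

/-- The `k`-th component of an assignment to the number variables. -/
noncomputable def repAt (v : ℕ → C.Num) (k i : ℕ) : ℕ := rep (v i) k

/-- The `k`-th component of an assignment to the set variables. -/
noncomputable def compAt (s : ℕ → C.Sets) (k j : ℕ) : Set ℕ := (s j).comp k

theorem repAt_scons (x : C.Num) (v : ℕ → C.Num) (k : ℕ) :
    repAt (scons x v) k = scons (rep x k) (repAt v k) :=
  comp_scons (fun x : C.Num => rep x k) x v

theorem rep_val (t : Tm) (v : ℕ → C.Num) : ∀ᶠ k in C.U, rep (t.val v) k = t.val (repAt v k) := by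
  induction t with
  | var i => exact .of_forall fun _ => rfl
  | zero => exact rep_zero
  | one => exact rep_one
  | add s t hs ht =>
    filter_upwards [hs, ht, rep_add (s.val v) (t.val v)] with k hs ht hadd
    rw [Tm.val, hadd, hs, ht, Tm.val]
  | mul s t hs ht =>
    filter_upwards [hs, ht, rep_mul (s.val v) (t.val v)] with k hs ht hmul
    rw [Tm.val, hmul, hs, ht, Tm.val]

/-- Łoś's theorem. For unbounded formulas it fails, since the cut is a proper part of the
ultrapower. -/
theorem sat_iff_of_isBounded {θ : Fm} (hθ : IsBounded θ) (v : ℕ → C.Num) (s : ℕ → C.Sets) :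
    θ.Sat v s ↔ ∀ᶠ k in C.U, θ.Sat (repAt v k) (compAt s k) := by
  induction hθ generalizing v with
  | falsum => exact (eventually_const (f := (C.U : Filter ℕ))).symm
  | eq t u =>
    rw [sat_eq, eq_iff]
    refine eventually_congr ?_
    filter_upwards [rep_val t v, rep_val u v] with k ht hu
    rw [ht, hu, sat_eq]
  | lt t u =>
    rw [sat_lt, lt_iff]
    refine eventually_congr ?_
    filter_upwards [rep_val t v, rep_val u v] with k ht hu
    rw [ht, hu, sat_lt]
  | mem t X =>
    rw [sat_mem, mem_iff]
    refine eventually_congr ?_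
    filter_upwards [rep_val t v] with k ht
    rw [ht, sat_mem, compAt]
  | imp _ _ hφ hψ =>
    simp only [sat_imp, hφ, hψ]
    exact Ultrafilter.eventually_imp.symm
  | @ballN t φ _ ih =>
    simp only [sat_ballN, ih, repAt_scons]
    rw [eventually_forall_imp_iff]
    constructor
    · intro h x hx
      have hb : C.Bdd x := (bdd_rep (t.val v)).mono (by
        filter_upwards [hx, rep_val t v] with k hlt ht using ht ▸ hlt.le)
      have hlt : ofSeq x hb < t.val v := by
        filter_upwards [hx, rep_val t v, rep_ofSeq x hb] with k hlt ht hx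
        rwa [hx, ht]
      filter_upwards [h _ hlt, rep_ofSeq x hb] with k hφ hx
      rwa [hx] at hφ
    · intro h x hx
      refine h _ ?_
      filter_upwards [rep_val t v, hx] with k ht hlt using ht ▸ hlt

theorem sat_exN_iff {θ : Fm} (hθ : IsBounded θ) (v : ℕ → C.Num) (s : ℕ → C.Sets) :
    θ.exN.Sat v s ↔
      ∃ y, C.Bdd y ∧ ∀ᶠ k in C.U, θ.Sat (scons (y k) (repAt v k)) (compAt s k) := by
  simp only [sat_exN, sat_iff_of_isBounded hθ, repAt_scons]
  refine ⟨fun ⟨y, hy⟩ => ⟨_, bdd_rep y, hy⟩, fun ⟨y, hy, h⟩ => ⟨ofSeq y hy, ?_⟩⟩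
  filter_upwards [h, rep_ofSeq y hy] with k hθ hk
  rwa [hk]

theorem sat_allN_iff {θ : Fm} (hθ : IsBounded θ) (v : ℕ → C.Num) (s : ℕ → C.Sets) :
    θ.allN.Sat v s ↔
      ∀ y, C.Bdd y → ∀ᶠ k in C.U, θ.Sat (scons (y k) (repAt v k)) (compAt s k) := by
  simp only [sat_allN, sat_iff_of_isBounded hθ, repAt_scons]
  refine ⟨fun h y hy => ?_, fun h y => h _ (bdd_rep y)⟩
  filter_upwards [h (ofSeq y hy), rep_ofSeq y hy] with k hθ hk
  rwa [hk] at hθ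

theorem exists_params (n m : ℕ) (v : ℕ → C.Num) (s : ℕ → C.Sets) :
    ∃ (f : Fin m → Code ι) (p q : ℕ → ℕ), C.Bdd p ∧ C.Bdd q ∧
      (∀ k, ∀ i < n, dec (p k) i = repAt v k i) ∧
      ∀ k, ∀ j < m, setEnv (fun j => (f j).eval (C.D k) (C.b 0 k)) (q k) j = compAt s k j := by
  obtain ⟨p, hp, hv⟩ := exists_dec_eq n fun i => bdd_rep (v i)
  obtain ⟨q, hq, hs⟩ := exists_dec_eq m fun j => bdd_rep (s j).2
  refine ⟨fun j => (s j).1, p, q, hp, hq, hv, fun k j hj => ?_⟩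
  rw [setEnv, dif_pos hj, hs k j hj]
  rfl

/-- By the gap property of the cut, bounded parameters have bounded least witnesses. -/
theorem exists_witness_bound (θ : Fm) (v : ℕ → C.Num) (s : ℕ → C.Sets) {c : ℕ → ℕ}
    (hc : C.Bdd c) : ∃ α β : ℕ → ℕ, C.Bdd α ∧ (∀ f, C.Bdd f → ∀ᶠ k in C.U, f k < β k) ∧
      ∀ᶠ k in C.U, ∀ x ≤ c k, ∀ y < β k,
        θ.Sat (scons y (scons x (repAt v k))) (compAt s k) →
        ∃ y ≤ α k, θ.Sat (scons y (scons x (repAt v k))) (compAt s k) := by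
  obtain ⟨f, p, q, hp, hq, hv, hs⟩ := exists_params θ.boundN θ.boundS v s
  obtain ⟨m, hm⟩ := (hc.pair hp).pair hq
  obtain ⟨l, hl, hgap⟩ := C.gap θ f m
  refine ⟨C.a (l + 1), C.b (l + 1), bdd_a _, fun g hg => hg.lt_b _, ?_⟩
  filter_upwards [hm, hgap, eventually_a_le hl] with k hm hgap hml x hx y hy hxy
  have hpair : Monotone fun z => Nat.pair (Nat.pair z (p k)) (q k) := StrictMono.monotone
    fun _ _ h => Nat.pair_lt_pair_left _ (Nat.pair_lt_pair_left _ h)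
  let W : Set ℕ := {y | θ.Sat (scons y (scons x (repAt v k))) (compAt s k)}
  have hwitness : leastWitness (C.D k) (C.b 0 k) θ f (Nat.pair (Nat.pair x (p k)) (q k)) =
      sInf W := by
    refine congrArg sInf (Set.ext fun y => ?_)
    rw [Nat.unpair_pair, dec_pair]
    refine θ.sat_congr (fun i hi => ?_) (hs k)
    rcases i with _ | _ | i
    · rfl
    · rfl
    · exact hv k i (by omega)
  have hgap := hgap _ ((hpair hx).trans (hm.trans hml))
  have hW : sInf W ∈ W := Nat.sInf_mem ⟨y, hxy⟩
  rw [hwitness] at hgap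
  exact ⟨sInf W, not_lt.1 fun h => hgap ⟨h, (Nat.sInf_le hxy).trans_lt hy⟩, hW⟩

theorem exists_sat_exN_iff_eventually {θ : Fm} (hθ : IsBounded θ) (v : ℕ → C.Num)
    (s : ℕ → C.Sets) (c : C.Num) :
    ∃ P : ℕ → ℕ → Prop, ∀ x : C.Num, (∀ᶠ k in C.U, rep x k ≤ rep c k) →
      (θ.exN.Sat (scons x v) s ↔ ∀ᶠ k in C.U, P k (rep x k)) := by
  obtain ⟨α, β, hα, hβ, h⟩ := exists_witness_bound θ v s (bdd_rep c)
  refine ⟨fun k x => ∃ y ≤ α k, θ.Sat (scons y (scons x (repAt v k))) (compAt s k), fun x hx => ?_⟩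
  simp only [sat_exN_iff hθ, repAt_scons]
  constructor
  · rintro ⟨y, hy, hxy⟩
    filter_upwards [h, hx, hβ y hy, hxy] with k h hx hy hxy using h _ hx _ hy hxy
  · intro hP
    obtain ⟨y, hy⟩ := skolem.1 hP
    exact ⟨y, hα.mono (hy.mono fun k hk => hk.1), hy.mono fun k hk => hk.2⟩

theorem sat_induction {φ : Fm} (hφ : IsSigma1 φ) (v : ℕ → C.Num) (s : ℕ → C.Sets) :
    (induction φ).Sat v s := by
  obtain ⟨θ, hθ, rfl⟩ := hφ
  simp only [induction, sat_imp, sat_and, Fm.sat_instN, Tm.val_zero]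
  rw [sat_allN, sat_allN]
  simp only [sat_imp, Fm.sat_instSucc]
  rintro ⟨zero, succ⟩ c
  obtain ⟨P, hP⟩ := exists_sat_exN_iff_eventually hθ v s c
  refine (hP c (.of_forall fun _ => le_rfl)).2 (eventually_of_induction C.U ?_ fun x hxc hx => ?_)
  · filter_upwards [(hP 0 (rep_zero.mono fun k hk => hk ▸ Nat.zero_le _)).1 zero, rep_zero]
      with k hzero hk using hk ▸ hzero
  · have hb : C.Bdd x := (bdd_rep c).mono (hxc.mono fun k hk => hk.le)
    have hrep := rep_ofSeq x hb
    have hrep' : ∀ᶠ k in C.U, rep (ofSeq x hb + 1) k = x k + 1 := by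
      filter_upwards [hrep, rep_add_one (ofSeq x hb)] with k hx hadd
      rw [hadd, hx]
    have hsat : θ.exN.Sat (scons (ofSeq x hb) v) s := by
      refine (hP _ ?_).2 ?_
      · filter_upwards [hrep, hxc] with k hx hlt using hx ▸ hlt.le
      · filter_upwards [hrep, hx] with k hx hPx using hx ▸ hPx
    have hsucc := (hP _ ?_).1 (succ _ hsat)
    · filter_upwards [hrep', hsucc] with k hx hPx using hx ▸ hPx
    · filter_upwards [hrep', hxc] with k hx hlt using hx ▸ hlt

theorem exists_sets_comp_eq (θ χ : Fm) (v : ℕ → C.Num) (s : ℕ → C.Sets) :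
    ∃ X : C.Sets, ∀ᶠ k in C.U, X.comp k = {z | ∃ y < C.b 0 k,
      θ.Sat (scons y (scons z (repAt v k))) (compAt s k) ∧
      ∀ y' ≤ y, χ.Sat (scons y' (scons z (repAt v k))) (compAt s k)} := by
  obtain ⟨f, p, q, hp, hq, hv, hs⟩ := exists_params (max θ.boundN χ.boundN)
    (max θ.boundS χ.boundS) v s
  refine ⟨(Code.delta θ χ f, ofSeq _ (hp.pair hq)), ?_⟩
  filter_upwards [rep_ofSeq _ (hp.pair hq)] with k hk
  have hsat (φ : Fm) (hN : φ.boundN ≤ max θ.boundN χ.boundN)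
      (hS : φ.boundS ≤ max θ.boundS χ.boundS) (y z : ℕ) :
      φ.Sat (scons y (scons z (dec (p k))))
          (setEnv (fun j => (f j).eval (C.D k) (C.b 0 k)) (q k)) ↔
        φ.Sat (scons y (scons z (repAt v k))) (compAt s k) := by
    refine φ.sat_congr (fun i hi => ?_) fun j hj => hs k j (hj.trans_le hS)
    rcases i with _ | _ | i
    · rfl
    · rfl
    · exact hv k i (by omega)
  change (Code.delta θ χ f).eval (C.D k) (C.b 0 k) (rep (ofSeq _ _) k) = _
  rw [hk, Code.eval_delta]
  simp only [hsat θ (le_max_left _ _) (le_max_left _ _),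
    hsat χ (le_max_right _ _) (le_max_right _ _)]

theorem sat_comprehension {φ ψ : Fm} (hφ : IsSigma1 φ) (hψ : IsPi1 ψ) (v : ℕ → C.Num)
    (s : ℕ → C.Sets) : (comprehension φ ψ).Sat v s := by
  obtain ⟨θ, hθ, rfl⟩ := hφ
  obtain ⟨χ, hχ, rfl⟩ := hψ
  rw [comprehension, sat_imp, sat_exS, sat_allN]
  intro hiff
  obtain ⟨X, hX⟩ := exists_sets_comp_eq θ χ v s
  refine ⟨X, fun x => ?_⟩
  have hx := hiff x
  rw [sat_iff, sat_exN_iff hθ, sat_allN_iff hχ] at hx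
  rw [sat_iff, Fm.sat_liftS, sat_mem, Tm.val_var, scons_zero, scons_zero, sat_exN_iff hθ, mem_iff]
  refine .trans ?_ (exists_bdd_iff_eventually_exists
    (A := fun k y => θ.Sat (scons y (repAt (scons x v) k)) (compAt s k))
    (B := fun k y => χ.Sat (scons y (repAt (scons x v) k)) (compAt s k)) hx).symm
  simp only [repAt_scons]
  refine eventually_congr (hX.mono fun k hk => ?_)
  rw [hk, Set.mem_ofPred_eq]

theorem isModel : IsModel C.Num C.Sets := by
  intro φ hφ v s
  cases hφ with
  | succ_ne_zero =>
    exact (sat_iff_of_isBounded (.imp (.eq _ _) .falsum) v s).2 (.of_forall fun k => by simp)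
  | succ_inj =>
    exact (sat_iff_of_isBounded (.imp (.eq _ _) (.eq _ _)) v s).2 (.of_forall fun k => by simp)
  | add_zero => exact (sat_iff_of_isBounded (.eq _ _) v s).2 (.of_forall fun k => by simp)
  | add_succ =>
    exact (sat_iff_of_isBounded (.eq _ _) v s).2 (.of_forall fun k => by simp [add_assoc])
  | mul_zero => exact (sat_iff_of_isBounded (.eq _ _) v s).2 (.of_forall fun k => by simp)
  | mul_succ =>
    exact (sat_iff_of_isBounded (.eq _ _) v s).2 (.of_forall fun k => by simp [mul_add])
  | not_lt_zero =>
    exact (sat_iff_of_isBounded (.imp (.lt _ _) .falsum) v s).2 (.of_forall fun k => by simp)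
  | lt_succ =>
    have neg {φ : Fm} (h : IsBounded φ) : IsBounded φ.neg := .imp h .falsum
    have hlt : IsBounded (♯0 ≺ ♯1 + 1) := .lt _ _
    have hle : IsBounded (♯0 ≺ ♯1 ⋎ ♯0 ≐ ♯1) := .imp (neg (.lt _ _)) (.eq _ _)
    have hiff : IsBounded (♯0 ≺ ♯1 + 1 ⟺ₐ (♯0 ≺ ♯1 ⋎ ♯0 ≐ ♯1)) :=
      neg (.imp (.imp hlt hle) (neg (.imp hle hlt)))
    refine (sat_iff_of_isBounded hiff v s).2 (.of_forall fun k => ?_)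
    rw [sat_iff, sat_or]
    exact Order.lt_add_one_iff.trans le_iff_lt_or_eq
  | induction h => exact sat_induction h v s
  | comprehension h h' => exact sat_comprehension h h' v s

end Cut

/-! ### The descent in the structure given by a cut -/

namespace Cut

variable {ι : Type} {C : Cut ι}

/-- The set of the structure that is given by a basic set. -/
noncomputable def basicSet (t : ι) : C.Sets := (Code.basic t, 0)

theorem comp_basicSet (t : ι) (k : ℕ) : (basicSet t : C.Sets).comp k = C.D k t := by
  rw [Sets.comp, basicSet, Code.eval_basic]

theorem rep_numPair (i j : C.Num) :
    ∀ᶠ k in C.U, rep (numPair i j) k = numPair (rep i k) (rep j k) := by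
  filter_upwards [rep_add ((i + j) * (i + j)) i, rep_mul (i + j) (i + j), rep_add i j]
    with k h₁ h₂ h₃
  rw [numPair, h₁, h₂, h₃, numPair]

section Lift

variable {L : ℕ → ℕ → ℕ} (hL : ∀ i, C.Bdd i → C.Bdd fun k => L k (i k))
  {R : ℕ → ℕ → ℕ → ℕ} (hR : ∀ i j, C.Bdd i → C.Bdd j → C.Bdd fun k => R k (i k) (j k))

/-- The unary function on the cut that is given by a sequence of functions. -/
noncomputable def lift (i : C.Num) : C.Num := ofSeq _ (hL _ (bdd_rep i))

/-- The binary function on the cut that is given by a sequence of functions. -/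
noncomputable def lift₂ (i j : C.Num) : C.Num := ofSeq _ (hR _ _ (bdd_rep i) (bdd_rep j))

theorem rep_lift (i : C.Num) : ∀ᶠ k in C.U, rep (lift hL i) k = L k (rep i k) := rep_ofSeq _ _

theorem rep_lift_add_one (i : C.Num) :
    ∀ᶠ k in C.U, rep (lift hL (i + 1)) k = L k (rep i k + 1) := by
  filter_upwards [rep_lift hL (i + 1), rep_add_one i] with k hL hi
  rw [hL, hi]

theorem rep_lift₂ (i j : C.Num) :
    ∀ᶠ k in C.U, rep (lift₂ hR i j) k = R k (rep i k) (rep j k) := rep_ofSeq _ _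

theorem rep_lift₂_add_one (i j : C.Num) :
    ∀ᶠ k in C.U, rep (lift₂ hR (i + 1) j) k = R k (rep i k + 1) (rep j k) := by
  filter_upwards [rep_lift₂ hR (i + 1) j, rep_add_one i] with k hR hi
  rw [hR, hi]

theorem numPair_mem_basicSet_iff {t : ι}
    (ht : ∀ k, C.D k t = {z | ∃ i, z = numPair i (L k i)}) (i l : C.Num) :
    numPair i l ∈ (basicSet t : C.Sets) ↔ l = lift hL i := by
  rw [mem_iff, eq_iff]
  refine eventually_congr ?_
  filter_upwards [rep_numPair i l, rep_lift hL i] with k hil hi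
  rw [hil, hi, comp_basicSet, ht]
  refine ⟨fun ⟨i', h⟩ => ?_, fun h => ⟨_, by rw [h]⟩⟩
  obtain ⟨hi', hl⟩ := numPair_inj.1 h
  rw [hl, hi']

theorem numPair_numPair_mem_basicSet_iff {t : ι}
    (ht : ∀ k, C.D k t = {z | ∃ i j, z = numPair (numPair i j) (R k i j)}) (i j x : C.Num) :
    numPair (numPair i j) x ∈ (basicSet t : C.Sets) ↔ x = lift₂ hR i j := by
  rw [mem_iff, eq_iff]
  refine eventually_congr ?_
  filter_upwards [rep_numPair (numPair i j) x, rep_numPair i j, rep_lift₂ hR i j]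
    with k hijx hij hx
  rw [hijx, hij, hx, comp_basicSet, ht]
  refine ⟨fun ⟨i', j', h⟩ => ?_, fun h => ⟨_, _, by rw [h]⟩⟩
  obtain ⟨h, hx'⟩ := numPair_inj.1 h
  obtain ⟨hi', hj'⟩ := numPair_inj.1 h
  rw [hx', hi', hj']

theorem lift_lex_lt_of_length_lt {i : C.Num}
    (h : ∀ᶠ k in C.U, L k (rep i k + 1) < L k (rep i k) ∧
      ∀ j < L k (rep i k + 1), R k (rep i k) j = R k (rep i k + 1) j) :
    lift hL (i + 1) < lift hL i ∧ ∀ j < lift hL (i + 1), lift₂ hR i j = lift₂ hR (i + 1) j := by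
  refine ⟨lt_iff.2 ?_, fun j hj => eq_iff.2 ?_⟩
  · filter_upwards [h, rep_lift hL i, rep_lift_add_one hL i] with k h hi hi'
    rw [hi', hi]
    exact h.1
  · filter_upwards [h, lt_iff.1 hj, rep_lift_add_one hL i, rep_lift₂ hR i j,
      rep_lift₂_add_one hR i j] with k h hj hi' hij hij'
    rw [hij, hij']
    exact h.2 _ (hi' ▸ hj)

theorem lift_lex_lt_of_entry_lt {i : C.Num}
    (h : ∀ᶠ k in C.U, ∃ j, j < L k (rep i k) ∧ j < L k (rep i k + 1) ∧
      R k (rep i k + 1) j < R k (rep i k) j ∧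
      ∀ l < j, R k (rep i k) l = R k (rep i k + 1) l) :
    ∃ j, j < lift hL i ∧ j < lift hL (i + 1) ∧ lift₂ hR (i + 1) j < lift₂ hR i j ∧
      ∀ l < j, lift₂ hR i l = lift₂ hR (i + 1) l := by
  obtain ⟨j, hj⟩ := skolem.1 h
  have hb : C.Bdd j := (hL _ (bdd_rep i)).mono (hj.mono fun k hk => hk.1.le)
  have rep_j := rep_ofSeq j hb
  refine ⟨ofSeq j hb, lt_iff.2 ?_, lt_iff.2 ?_, lt_iff.2 ?_, fun l hl => eq_iff.2 ?_⟩
  · filter_upwards [hj, rep_j, rep_lift hL i] with k h hj hi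
    rw [hj, hi]
    exact h.1
  · filter_upwards [hj, rep_j, rep_lift_add_one hL i] with k h hj hi'
    rw [hj, hi']
    exact h.2.1
  · filter_upwards [hj, rep_j, rep_lift₂ hR i (ofSeq j hb), rep_lift₂_add_one hR i (ofSeq j hb)]
      with k h hj hij hij'
    rw [hij, hij', hj]
    exact h.2.2.1
  · filter_upwards [hj, rep_j, lt_iff.1 hl, rep_lift₂ hR i l, rep_lift₂_add_one hR i l]
      with k h hj hl hil hil'
    rw [hil, hil']
    exact h.2.2.2 _ (hj ▸ hl)

end Lift

section Instances

variable [Nonempty ι]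

instance : Nonempty C.Sets := .map basicSet inferInstance

noncomputable instance : CommSemiring C.Num := (isModel (C := C)).commSemiring
noncomputable instance : LinearOrder C.Num := (isModel (C := C)).linearOrder
instance : IsStrictOrderedRing C.Num := (isModel (C := C)).isStrictOrderedRing
instance : CanonicallyOrderedAdd C.Num := (isModel (C := C)).canonicallyOrderedAdd
noncomputable instance : SuccAddOrder C.Num := (isModel (C := C)).succAddOrder
instance : RCAModel C.Num C.Sets := ⟨isModel⟩

end Instances

theorem isDescending_lift [Nonempty ι] {L : ℕ → ℕ → ℕ}
    (hL : ∀ i, C.Bdd i → C.Bdd fun k => L k (i k)) {R : ℕ → ℕ → ℕ → ℕ}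
    (hR : ∀ i j, C.Bdd i → C.Bdd j → C.Bdd fun k => R k (i k) (j k))
    (antitone : ∀ k i j, j + 1 < L k i → R k i (j + 1) ≤ R k i j)
    (lex_lt : ∀ i, C.Bdd i → ∀ᶠ k in C.U,
      (L k (i k + 1) < L k (i k) ∧ ∀ j < L k (i k + 1), R k (i k) j = R k (i k + 1) j) ∨
      ∃ j, j < L k (i k) ∧ j < L k (i k + 1) ∧ R k (i k + 1) j < R k (i k) j ∧
        ∀ l < j, R k (i k) l = R k (i k + 1) l) :
    IsDescending (lift hL) (lift₂ hR) where
  antitone i j hj := by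
    refine not_lt.1 fun hlt => ?_
    obtain ⟨k, hlt, hj, hi, hij, hij', hj'⟩ := ((lt_iff.1 hlt).and <| (lt_iff.1 hj).and <|
      (rep_lift hL i).and <| (rep_lift₂ hR i j).and <| (rep_lift₂ hR i (j + 1)).and <|
      rep_add_one j).exists
    rw [hij, hij', hj'] at hlt
    rw [hj', hi] at hj
    exact hlt.not_ge (antitone _ _ _ hj)
  lex_lt i := (Ultrafilter.eventually_or.1 (lex_lt _ (bdd_rep i))).imp
    (lift_lex_lt_of_length_lt hL hR) (lift_lex_lt_of_entry_lt hL hR)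

end Cut

/-- The descent from `⟨k⟩` with the counter starting at `k` takes at least `ack k k - k` steps, and
so it does not end within the cut. -/
theorem not_proves_wellOrder : ¬ Proves RCA₀ (omegaOmegaSatisfies isWellOrder) := by
  intro h
  let L (k i : ℕ) : ℕ := (descent k [k] i).length
  let R (k i j : ℕ) : ℕ := revEntry (descent k [k] i) j
  obtain ⟨C, hD, ha, hb⟩ := Cut.exists fun k t => match t with
    | true => {z | ∃ i, z = numPair i (L k i)}
    | false => {z | ∃ i j, z = numPair (numPair i j) (R k i j)}
  have hid : C.Bdd id := ⟨0, .of_forall fun k => (ha k).ge⟩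
  have hL (i : ℕ → ℕ) (hi : C.Bdd i) : C.Bdd fun k => L k (i k) :=
    ((Cut.bdd_const 1).add (hi.mul (hid.add hi))).mono
      (.of_forall fun k => length_descent_le k [k] (i k))
  have hR (i j : ℕ → ℕ) (_ : C.Bdd i) (_ : C.Bdd j) : C.Bdd fun k => R k (i k) (j k) :=
    hid.mono (.of_forall fun k =>
      revEntry_le (descent_mem_le k (fun _ hy => (List.mem_singleton.1 hy).le) (i k)) (j k))
  have hdesc : IsDescending (Cut.lift hL) (Cut.lift₂ hR) := by
    refine Cut.isDescending_lift hL hR (fun k i j hj => ?_) fun i hi => ?_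
    · exact revEntry_add_one_le (descent_pairwise_le k (List.pairwise_singleton _ _) i) hj
    · filter_upwards [(hid.add hi).lt_b 0] with k hk
      rw [hb] at hk
      exact descend_lex_lt _ (descent_ne_nil hk)
  have hΛ := Cut.numPair_mem_basicSet_iff hL (t := true) fun k => by rw [hD]
  have hE := Cut.numPair_numPair_mem_basicSet_iff hR (t := false) fun k => by rw [hD]
  exact not_sat_omegaOmega_isWellOrder hΛ hE hdesc (fun _ => 0) (fun _ => Classical.arbitrary _)
    (h.sound Cut.isModel _ _ (by simp))

end SOA

theorem mainTheorem10 :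
    SOA.Proves SOA.RCA₀ (SOA.omegaOmegaSatisfies SOA.isWeakWellOrder) ∧
      ¬ SOA.Proves SOA.RCA₀ (SOA.omegaOmegaSatisfies SOA.isWellOrder) :=
  ⟨SOA.proves_weakWellOrder, SOA.not_proves_wellOrder⟩
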